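/- Let $S$ be a connected, oriented smooth surface (Hausdorff, second countable, possibly with boundary; for instance any closed oriented surface or any oriented surface of finite type). Let $0<\lambda<1/2$ and let $C_\lambda=\bigcap_{n\ge 0}\bigcup\mathcal I_n\subset[0,1]$ be the central Cantor set, where $\mathcal I_0=\{[0,1]\}$ and $\mathcal I_{n+1}$ is obtained from $\mathcal I_n$ by removing from every interval $J\in\mathcal I_n$ its open middle subinterval of length $(1-2\lambda)|J|$. Embed $C_\lambda$ in $S$ as the image of $C_\lambda\subset[0,1]$ under a smooth embedding $[0,1]\hookrightarrow S$, and denote the image again by $C_\lambda$. Let $\mathrm{Diff}(S,C_\lambda)$ be the group of orientation-preserving $C^\infty$-diffeomorphisms $f$ of $S$ with $f(C_\lambda)=C_\lambda$, with the $C^\infty$ (compact-open) topology, let $\mathrm{Diff}_0(S,C_\lambda)$ be its identity component, and let $$\mathcal M^\infty(S,C_\lambda)=\mathrm{Diff}(S,C_\lambda)/\mathrm{Diff}_0(S,C_\lambda).$$ This group acts on $C_\lambda$ by homeomorphisms, a class acting as the restriction to $C_\lambda$ of any of its representatives. Then for every subgroup $\Gamma$ of $\mathcal M^\infty(S,C_\lambda)$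 (not necessarily finitely generated), at least one of the following holds: 1. $\Gamma$ contains a free subgroup on two generators; 2. the action of $\Gamma$ on $C_\lambda$ has an invariant Borel probability measure, i.e. there is a Borel probability measure $\mu$ on $C_\lambda$ with $g_*\mu=\mu$ for all $g\in\Gamma$. -/

import Mathlib

open scoped Manifold ContDiff Topology

noncomputable section

namespace SmoothMCG

/-! ### The `C^∞` compact-open topology, through iterated tangent maps -/

/-- A finite-dimensional smooth real manifold (possibly with boundary), bundled together with its
model, so that the tangent functor can be iterated. -/
structure SmoothMfd.{u, v} where
  E : Type
  [normedE : NormedAddCommGroup E]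
  [spaceE : NormedSpace ℝ E]
  [finE : FiniteDimensional ℝ E]
  H : Type u
  [topH : TopologicalSpace H]
  I : ModelWithCorners ℝ E H
  M : Type v
  [topM : TopologicalSpace M]
  [charted : ChartedSpace H M]
  [mfd : IsManifold I ∞ M]

attribute [instance] SmoothMfd.normedE SmoothMfd.spaceE SmoothMfd.finE SmoothMfd.topH
  SmoothMfd.topM SmoothMfd.charted SmoothMfd.mfd

/-- Smooth maps between bundled manifolds. -/
abbrev SmoothMfd.Hom (X Y : SmoothMfd) : Type _ := {f : X.M → Y.M // ContMDiff X.I Y.I ∞ f}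

/-- The total space `TX` of the tangent bundle of `X`. -/
def SmoothMfd.tangent (X : SmoothMfd) : SmoothMfd where
  E := X.E × X.E
  H := ModelProd X.H X.E
  I := X.I.tangent
  M := TangentBundle X.I X.M

/-- The tangent map `Tf : TX → TY`. -/
def SmoothMfd.Hom.tangent {X Y : SmoothMfd} (f : X.Hom Y) : X.tangent.Hom Y.tangent :=
  ⟨tangentMap X.I Y.I f.1, f.2.contMDiff_tangentMap (m := ∞) (by simp)⟩

/-- The `k`-th iterated tangent bundle `T^k X = T(T(⋯TX))`. -/
def SmoothMfd.iterTangent : ℕ → SmoothMfd → SmoothMfd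
  | 0, X => X
  | k + 1, X => SmoothMfd.iterTangent k X.tangent

/-- The `k`-th iterated tangent map `T^k f : T^k X → T^k Y`. -/
def SmoothMfd.Hom.iterTangent : ∀ (k : ℕ) {X Y : SmoothMfd},
    X.Hom Y → (X.iterTangent k).Hom (Y.iterTangent k)
  | 0, _, _, f => f
  | k + 1, _, _, f => SmoothMfd.Hom.iterTangent k f.tangent

/-- Composition of smooth maps. -/
def SmoothMfd.Hom.comp {X Y Z : SmoothMfd} (g : Y.Hom Z) (f : X.Hom Y) : X.Hom Z :=
  ⟨g.1 ∘ f.1, g.2.comp f.2⟩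

/-- A smooth map as a continuous map. -/
def SmoothMfd.Hom.toC {X Y : SmoothMfd} (f : X.Hom Y) : C(X.M, Y.M) := ⟨f.1, f.2.continuous⟩

theorem SmoothMfd.Hom.tangent_comp {X Y Z : SmoothMfd} (g : Y.Hom Z) (f : X.Hom Y) :
    (g.comp f).tangent = g.tangent.comp f.tangent :=
  Subtype.ext (tangentMap_comp (g.2.mdifferentiable (by simp)) (f.2.mdifferentiable (by simp)))

theorem SmoothMfd.Hom.iterTangent_comp (k : ℕ) : ∀ {X Y Z : SmoothMfd} (g : Y.Hom Z)
    (f : X.Hom Y), (g.comp f).iterTangent k = (g.iterTangent k).comp (f.iterTangent k) := by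
  induction k with
  | zero => intros; rfl
  | succ k ih =>
    intro X Y Z g f
    show (g.comp f).tangent.iterTangent k = _
    rw [SmoothMfd.Hom.tangent_comp, ih]
    rfl

instance (X : SmoothMfd) : LocallyCompactSpace X.M :=
  Manifold.locallyCompact_of_finiteDimensional X.I

/-! ### The topological group of diffeomorphisms -/

section Diffeo

variable {E : Type} [NormedAddCommGroup E] [NormedSpace ℝ E] {H : Type*} [TopologicalSpace H]
  {I : ModelWithCorners ℝ E H} {S : Type*} [TopologicalSpace S] [ChartedSpace H S]

/-- The group structure on smooth self-diffeomorphisms, given by composition. -/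
instance : Group (S ≃ₘ⟮I, I⟯ S) where
  mul f g := g.trans f
  one := Diffeomorph.refl I S ∞
  inv f := f.symm
  mul_assoc _ _ _ := rfl
  one_mul _ := rfl
  mul_one _ := rfl
  inv_mul_cancel f := Diffeomorph.self_trans_symm f

theorem mul_apply (f g : S ≃ₘ⟮I, I⟯ S) (x : S) : (f * g) x = f (g x) := rfl

theorem one_apply (x : S) : (1 : S ≃ₘ⟮I, I⟯ S) x = x := rfl

theorem inv_eq_symm (f : S ≃ₘ⟮I, I⟯ S) : f⁻¹ = f.symm := rfl

variable [FiniteDimensional ℝ E] [IsManifold I ∞ S]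

variable (I S) in
/-- The bundled version of the manifold `S`. -/
def bundled : SmoothMfd where
  E := E
  H := H
  I := I
  M := S

/-- A diffeomorphism of `S` as a smooth map. -/
def toHom (f : S ≃ₘ⟮I, I⟯ S) : (bundled I S).Hom (bundled I S) := ⟨f, f.contMDiff⟩

variable (I S) in
/-- The space of continuous self-maps of `T^k S`; it carries the compact-open topology. -/
abbrev IterC (k : ℕ) : Type _ :=
  C(((bundled I S).iterTangent k).M, ((bundled I S).iterTangent k).M)

/-- `T^k f` as a continuous self-map of `T^k S`. -/
def iterT (k : ℕ) (f : S ≃ₘ⟮I, I⟯ S) : IterC I S k := ((toHom f).iterTangent k).toC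

theorem iterT_mul (k : ℕ) (f g : S ≃ₘ⟮I, I⟯ S) :
    iterT k (f * g) = (iterT k f).comp (iterT k g) := by
  have h : toHom (f * g) = (toHom f).comp (toHom g) := rfl
  unfold iterT
  rw [h, SmoothMfd.Hom.iterTangent_comp]
  rfl

/-- The `C^∞` topology on `Diff(S)`: uniform convergence of all derivatives of `f` and `f⁻¹` on
compact sets. It is the coarsest topology for which all the maps `f ↦ T^k f` and `f ↦ T^k (f⁻¹)`
into the continuous self-maps of `T^k S`, with the compact-open topology, are continuous. -/
instance : TopologicalSpace (S ≃ₘ⟮I, I⟯ S) :=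
  ⨅ k : ℕ, TopologicalSpace.induced (fun f ↦ (iterT k f, iterT k f⁻¹)) inferInstance

theorem continuous_iterT_pair (k : ℕ) :
    Continuous fun f : S ≃ₘ⟮I, I⟯ S ↦ (iterT k f, iterT k f⁻¹) :=
  continuous_iInf_dom (i := k) continuous_induced_dom

theorem continuous_iterT (k : ℕ) : Continuous fun f : S ≃ₘ⟮I, I⟯ S ↦ iterT k f :=
  (continuous_iterT_pair k).fst

theorem continuous_iterT_inv (k : ℕ) : Continuous fun f : S ≃ₘ⟮I, I⟯ S ↦ iterT k f⁻¹ :=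
  (continuous_iterT_pair k).snd

instance : IsTopologicalGroup (S ≃ₘ⟮I, I⟯ S) where
  continuous_mul := by
    refine continuous_iInf_rng.2 fun k ↦ continuous_induced_rng.2 ?_
    refine Continuous.prodMk (f := fun p : (S ≃ₘ⟮I, I⟯ S) × (S ≃ₘ⟮I, I⟯ S) ↦ iterT k (p.1 * p.2))
      (g := fun p ↦ iterT k (p.1 * p.2)⁻¹) ?_ ?_
    · simp only [iterT_mul]
      exact ((continuous_iterT k).comp continuous_fst).compCM
        ((continuous_iterT k).comp continuous_snd)
    · simp only [mul_inv_rev, iterT_mul]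
      exact ((continuous_iterT_inv k).comp continuous_snd).compCM
        ((continuous_iterT_inv k).comp continuous_fst)
  continuous_inv := by
    refine continuous_iInf_rng.2 fun k ↦ continuous_induced_rng.2 ?_
    refine Continuous.prodMk (f := fun f : S ≃ₘ⟮I, I⟯ S ↦ iterT k f⁻¹)
      (g := fun f ↦ iterT k f⁻¹⁻¹) (continuous_iterT_inv k) ?_
    simpa only [inv_inv] using continuous_iterT k

theorem continuous_eval (x : S) : Continuous fun f : S ≃ₘ⟮I, I⟯ S ↦ f x :=
  (continuous_eval_const (F := C(S, S)) x).comp (continuous_iterT 0)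

end Diffeo

/-! ### Oriented surfaces and the smooth mapping class group -/

/-- The Euclidean plane. -/
abbrev Plane : Type := EuclideanSpace ℝ (Fin 2)

section Surface

variable {H : Type*} [TopologicalSpace H] {I : ModelWithCorners ℝ Plane H}
  {S : Type*} [TopologicalSpace S] [ChartedSpace H S] [IsManifold I ∞ S]

variable (I S) in
/-- An orientation of a surface: an orientation of each tangent plane, which is locally constant
when it is read in the local trivializations of the tangent bundle. -/
structure SurfaceOrientation where
  orient : ∀ x : S, Orientation ℝ (TangentSpace I x) (Fin 2)
  locallyConstant : ∀ x : S, ∃ o₀ : Orientation ℝ Plane (Fin 2), ∀ᶠ y in 𝓝 x,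
    ∀ hy : y ∈ (trivializationAt Plane (TangentSpace I) x).baseSet,
      Orientation.map (Fin 2)
        ((trivializationAt Plane (TangentSpace I) x).linearEquivAt ℝ y hy) (orient y) = o₀

/-- The differential of a diffeomorphism at a point, as a linear isomorphism. -/
def differential (f : S ≃ₘ⟮I, I⟯ S) (x : S) : TangentSpace I x ≃ₗ[ℝ] TangentSpace I (f x) :=
  (f.mfderivToContinuousLinearEquiv (by simp) x).toLinearEquiv

/-- `f` preserves the orientation `o`: its differentials map `o` at `x` to `o` at `f x`. -/
def OrientationPreserving (o : SurfaceOrientation I S) (f : S ≃ₘ⟮I, I⟯ S) : Prop :=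
  ∀ x, Orientation.map (Fin 2) (differential f x) (o.orient x) = o.orient (f x)

theorem differential_mul (f g : S ≃ₘ⟮I, I⟯ S) (x : S) :
    differential (f * g) x = (differential g x).trans (differential f (g x)) := by
  refine LinearEquiv.ext fun v ↦ ?_
  exact congrArg (fun L ↦ L v) (mfderiv_comp x (f.mdifferentiable (by simp) (g x))
    (g.mdifferentiable (by simp) x))

theorem differential_one (x : S) :
    differential (1 : S ≃ₘ⟮I, I⟯ S) x = LinearEquiv.refl ℝ (TangentSpace I x) := by
  refine LinearEquiv.ext fun v ↦ ?_
  exact congrArg (fun L ↦ L v) (mfderiv_id (I := I) (x := x))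

theorem map_differential_mul (f g : S ≃ₘ⟮I, I⟯ S) (x : S)
    (r : Orientation ℝ (TangentSpace I x) (Fin 2)) :
    Orientation.map (Fin 2) (differential (f * g) x) r =
      Orientation.map (Fin 2) (differential f (g x))
        (Orientation.map (Fin 2) (differential g x) r) := by
  rw [differential_mul]
  induction r using Module.Ray.ind with
  | h v hv => rfl

theorem OrientationPreserving.one (o : SurfaceOrientation I S) :
    OrientationPreserving o (1 : S ≃ₘ⟮I, I⟯ S) := by
  intro x
  rw [differential_one]
  exact congrArg (fun e ↦ e (o.orient x))
    (Orientation.map_refl (R := ℝ) (M := TangentSpace I x) (Fin 2))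

theorem OrientationPreserving.mul {o : SurfaceOrientation I S} {f g : S ≃ₘ⟮I, I⟯ S}
    (hf : OrientationPreserving o f) (hg : OrientationPreserving o g) :
    OrientationPreserving o (f * g) := by
  intro x
  rw [map_differential_mul, hg x]
  exact hf (g x)

theorem OrientationPreserving.inv {o : SurfaceOrientation I S} {f : S ≃ₘ⟮I, I⟯ S}
    (hf : OrientationPreserving o f) : OrientationPreserving o f⁻¹ := by
  intro y
  refine (Orientation.map (Fin 2) (differential f (f⁻¹ y))).injective ?_
  have key : ∀ h : S ≃ₘ⟮I, I⟯ S, h = 1 →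
      Orientation.map (Fin 2) (differential h y) (o.orient y) = o.orient (h y) := by
    rintro _ rfl
    exact OrientationPreserving.one o y
  rw [hf (f⁻¹ y), ← map_differential_mul]
  exact key (f * f⁻¹) (mul_inv_cancel f)

/-- `Diff(S, K)`: the group of orientation-preserving smooth diffeomorphisms `f` of `S` with
`f(K) = K`. As a subgroup of `Diff(S)` it carries the `C^∞` topology. -/
def DiffRel (o : SurfaceOrientation I S) (K : Set S) : Subgroup (S ≃ₘ⟮I, I⟯ S) where
  carrier := {f | OrientationPreserving o f ∧ f '' K = K}
  one_mem' := ⟨.one o, by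
    have : (⇑(1 : S ≃ₘ⟮I, I⟯ S) : S → S) = id := rfl
    simp [this]⟩
  mul_mem' := by
    rintro f g ⟨hf, hfK⟩ ⟨hg, hgK⟩
    refine ⟨hf.mul hg, ?_⟩
    have : (⇑(f * g) : S → S) = f ∘ g := rfl
    rw [this, Set.image_comp, hgK, hfK]
  inv_mem' := by
    rintro f ⟨hf, hfK⟩
    refine ⟨hf.inv, ?_⟩
    nth_rewrite 1 [← hfK]
    rw [inv_eq_symm, Diffeomorph.symm_image_image]

/-- `Diff₀(S, K)`: the identity component of `Diff(S, K)`. -/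
def DiffRelZero (o : SurfaceOrientation I S) (K : Set S) : Subgroup (DiffRel o K) :=
  Subgroup.connectedComponentOfOne (DiffRel o K)

instance (o : SurfaceOrientation I S) (K : Set S) : (DiffRelZero o K).Normal where
  conj_mem f hf g := by
    have hc : Continuous fun h : DiffRel o K ↦ g * h * g⁻¹ := by fun_prop
    have := hc.image_connectedComponent_subset 1 (Set.mem_image_of_mem _ hf)
    rw [mul_one, mul_inv_cancel] at this
    exact this

/-- The smooth mapping class group `M^∞(S, K) = Diff(S, K) / Diff₀(S, K)`. -/
abbrev MCG (o : SurfaceOrientation I S) (K : Set S) : Type _ := DiffRel o K ⧸ DiffRelZero o K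

theorem DiffRel.apply_mem {o : SurfaceOrientation I S} {K : Set S} (f : DiffRel o K) {x : S}
    (hx : x ∈ K) : f.1 x ∈ K := by
  have := Set.mem_image_of_mem f.1 hx
  rwa [f.2.2] at this

/-- Restriction of the elements of `Diff(S, K)` to `K`. -/
def DiffRel.restrict (o : SurfaceOrientation I S) (K : Set S) : DiffRel o K →* (K ≃ₜ K) where
  toFun f :=
    { toFun := fun x ↦ ⟨f.1 x, DiffRel.apply_mem f x.2⟩
      invFun := fun x ↦ ⟨f⁻¹.1 x, DiffRel.apply_mem f⁻¹ x.2⟩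
      left_inv := fun x ↦ Subtype.ext (f.1.symm_apply_apply x)
      right_inv := fun x ↦ Subtype.ext (f.1.apply_symm_apply x)
      continuous_toFun := (f.1.continuous.comp continuous_subtype_val).subtype_mk _
      continuous_invFun := (f⁻¹.1.continuous.comp continuous_subtype_val).subtype_mk _ }
  map_one' := rfl
  map_mul' _ _ := rfl

theorem DiffRel.restrict_eq_one {o : SurfaceOrientation I S} {K : Set S}
    (hK : IsTotallyDisconnected K) (f : DiffRel o K) (hf : f ∈ DiffRelZero o K) :
    DiffRel.restrict o K f = 1 := by
  refine Homeomorph.ext fun x ↦ Subtype.ext ?_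
  have hc : Continuous fun g : DiffRel o K ↦ g.1 x.1 :=
    (continuous_eval x.1).comp continuous_subtype_val
  refine hK ((fun g : DiffRel o K ↦ g.1 x.1) '' connectedComponent 1) ?_
    (isPreconnected_connectedComponent.image _ hc.continuousOn)
    (Set.mem_image_of_mem _ hf) ⟨1, mem_connectedComponent, rfl⟩
  rintro _ ⟨g, -, rfl⟩
  exact DiffRel.apply_mem g x.2

/-- The action of `M^∞(S, K)` on a totally disconnected set `K`: a mapping class acts as the
restriction to `K` of any diffeomorphism that represents it. -/
def MCG.action (o : SurfaceOrientation I S) {K : Set S} (hK : IsTotallyDisconnected K) :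
    MCG o K →* (K ≃ₜ K) :=
  QuotientGroup.lift (DiffRelZero o K) (DiffRel.restrict o K) (DiffRel.restrict_eq_one hK)

end Surface

/-! ### The Cantor set `C_lam` in a surface -/

/-- The left endpoints of the `2 ^ n` intervals of length `lam ^ n` of the `n`-th step of the
construction: from each interval `[a, a + lam ^ n]` of step `n`, the open middle subinterval of
relative length `1 - 2 * lam` is removed, which leaves the intervals of length `lam ^ (n + 1)`
starting at `a` and ending at `a + lam ^ n`. -/
def leftEndpoints (lam : ℝ) : ℕ → Finset ℝ
  | 0 => {0}
  | n + 1 => leftEndpoints lam n ∪ (leftEndpoints lam n).image fun a ↦ a + lam ^ n - lam ^ (n + 1)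

/-- The central Cantor set `C_lam ⊆ [0, 1]`. -/
def centralCantorSet (lam : ℝ) : Set ℝ :=
  ⋂ n : ℕ, ⋃ a ∈ leftEndpoints lam n, Set.Icc a (a + lam ^ n)

theorem centralCantorSet_subset (lam : ℝ) : centralCantorSet lam ⊆ Set.Icc 0 1 := by
  intro x hx
  have := Set.mem_iInter.1 hx 0
  simpa [leftEndpoints] using this

theorem card_leftEndpoints_le (lam : ℝ) (n : ℕ) : (leftEndpoints lam n).card ≤ 2 ^ n := by
  induction n with
  | zero => simp [leftEndpoints]
  | succ n ih =>
    refine (Finset.card_union_le _ _).trans ?_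
    have := Finset.card_image_le (s := leftEndpoints lam n)
      (f := fun a ↦ a + lam ^ n - lam ^ (n + 1))
    have h2 : 2 ^ (n + 1) = 2 ^ n + 2 ^ n := by ring
    omega

theorem isTotallyDisconnected_centralCantorSet {lam : ℝ} (h0 : 0 < lam) (h1 : lam < 1 / 2) :
    IsTotallyDisconnected (centralCantorSet lam) := by
  intro t ht hpre x hx y hy
  wlog hxy : x ≤ y generalizing x y
  · exact (this hy hx (le_of_not_ge hxy)).symm
  have hsub : Set.Icc x y ⊆ t := hpre.Icc_subset hx hy
  have hbound : ∀ n : ℕ, y - x ≤ (2 * lam) ^ n := by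
    intro n
    have hvol : MeasureTheory.volume (Set.Icc x y) ≤ ENNReal.ofReal ((2 * lam) ^ n) := calc
      MeasureTheory.volume (Set.Icc x y)
          ≤ MeasureTheory.volume (⋃ a ∈ leftEndpoints lam n, Set.Icc a (a + lam ^ n)) :=
            MeasureTheory.measure_mono ((hsub.trans ht).trans (Set.iInter_subset _ n))
      _ ≤ ∑ a ∈ leftEndpoints lam n, MeasureTheory.volume (Set.Icc a (a + lam ^ n)) :=
            MeasureTheory.measure_biUnion_finset_le _ _
      _ = (leftEndpoints lam n).card * ENNReal.ofReal (lam ^ n) := by simp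
      _ ≤ (2 ^ n : ℕ) * ENNReal.ofReal (lam ^ n) := by
            gcongr
            exact card_leftEndpoints_le lam n
      _ = ENNReal.ofReal ((2 * lam) ^ n) := by
            rw [mul_pow, ENNReal.ofReal_mul (by positivity)]
            congr 1
            rw [← ENNReal.ofReal_natCast]
            simp
    rw [Real.volume_Icc] at hvol
    exact (ENNReal.ofReal_le_ofReal_iff (by positivity)).1 hvol
  have hlim := tendsto_pow_atTop_nhds_zero_of_lt_one (r := 2 * lam) (by linarith) (by linarith)
  have := ge_of_tendsto' hlim hbound
  linarith

/-- An embedded segment in `S`: a smooth embedding of `[0, 1]`, that is, an injective smooth map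
with nowhere vanishing velocity. (The values of `toFun` outside `[0, 1]` are irrelevant.) -/
structure EmbeddedSegment {H : Type*} [TopologicalSpace H] (I : ModelWithCorners ℝ Plane H)
    (S : Type*) [TopologicalSpace S] [ChartedSpace H S] where
  toFun : ℝ → S
  smooth : ContMDiffOn 𝓘(ℝ, ℝ) I ∞ toFun (Set.Icc 0 1)
  injOn : Set.InjOn toFun (Set.Icc 0 1)
  velocity_ne_zero : ∀ t ∈ Set.Icc (0 : ℝ) 1,
    mfderivWithin 𝓘(ℝ, ℝ) I toFun (Set.Icc 0 1) t ≠ 0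

section Segment

variable {H : Type*} [TopologicalSpace H] {I : ModelWithCorners ℝ Plane H}
  {S : Type*} [TopologicalSpace S] [ChartedSpace H S]

/-- The copy of `C_lam` contained in an embedded segment of `S`. -/
def EmbeddedSegment.cantorSet (l : EmbeddedSegment I S) (lam : ℝ) : Set S :=
  l.toFun '' centralCantorSet lam

theorem EmbeddedSegment.isTotallyDisconnected_cantorSet [T2Space S] (l : EmbeddedSegment I S)
    {lam : ℝ} (h0 : 0 < lam) (h1 : lam < 1 / 2) : IsTotallyDisconnected (l.cantorSet lam) := by
  have hc : Continuous ((Set.Icc (0 : ℝ) 1).domRestrict l.toFun) := l.smooth.continuousOn.domRestrict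
  have hemb := (hc.isClosedEmbedding l.injOn.injective).isEmbedding
  have hpre : IsTotallyDisconnected
      ((↑) ⁻¹' centralCantorSet lam : Set (Set.Icc (0 : ℝ) 1)) := by
    rw [← Topology.IsEmbedding.subtypeVal.isTotallyDisconnected_image,
      Subtype.image_preimage_coe, Set.inter_eq_right.2 (centralCantorSet_subset lam)]
    exact isTotallyDisconnected_centralCantorSet h0 h1
  have himg : l.cantorSet lam =
      (Set.Icc (0 : ℝ) 1).domRestrict l.toFun '' ((↑) ⁻¹' centralCantorSet lam) := by
    rw [Set.domRestrict_eq, Set.image_comp, Subtype.image_preimage_coe,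
      Set.inter_eq_right.2 (centralCantorSet_subset lam)]
    rfl
  rw [himg]
  exact hemb.isTotallyDisconnected_image.2 hpre

end Segment

end SmoothMCG

end

/-! Measure the distance of two points of the Cantor set by the length of the largest gap between
them. This is an ultrametric, it induces the usual topology, and every nontrivial gap has length
`lam ^ n * (1 - 2 * lam)` for some natural `n`. A diffeomorphism that preserves the embedded copy
has a nonzero strict derivative along the Cantor set at each of its points. Locally it is therefore
monotone, carries gaps to gaps, and multiplies their lengths by a power of `lam` close to the
absolute value of the derivative. Such powers are isolated, so it is a local similarity with ratio
in `lam ^ ℤ`. A monotone isometry of a ball into itself is the identity, so an isometric return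
forces periodicity near the centre. `CantorPoint.isLocalSimilarityAction` records this; the dynamics
below uses only these properties and compactness.

For one element `f`, the exponent of the local ratio is a locally constant integer cocycle, positive
where `f` contracts. Each point is elliptic, lies in the basin of an attracting periodic orbit, or
is itself attracting periodic for `f⁻¹` (`elliptic_or_basin_or_attracting_inv`). By compactness some
power of `f` is the identity on a clopen set and has north-south type dynamics, with finitely many
attracting and repelling fixed points, off it (`exists_hyperbolicData`).

For the group, weak compactness reduces the invariant measure to finitely generated subgroups. Take
a minimal closed invariant set `M`. A finite orbit in `M` carries an invariant measure. If the
exponents on `M` are bounded, the group permutes finite families of arbitrarily small balls, and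
averaging gives a measure. If they are unbounded, some element contracts a ball centred in `M` into
itself (`exists_not_elliptic`). Elliptic sets are directed downwards
(`exists_elliptic_subset_inter`), so compactness and minimality yield an element that is elliptic
nowhere on `M`. When all orbits in `M` are infinite, Neumann's covering lemma gives a conjugate of
it with disjoint fixed points in `M`, and ping-pong produces a free group. -/

section

open Set Filter Metric MeasureTheory

/-! ### Local similarity actions, their exponents, and similarities between balls -/

/-- An action of `G` on an ultrametric space `X` by local similarities whose ratios are integral
powers of `lam`, such that a ball that returns isometrically into itself contains, up to shrinking
it about its centre, only periodic points of a common period. -/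
structure IsLocalSimilarityAction (lam : ℝ) (G X : Type*) [Group G] [MetricSpace X]
    [MulAction G X] : Prop where
  pos : 0 < lam
  lt_one : lam < 1
  sim : ∀ (g : G) (x : X), ∃ k : ℤ, ∃ O ∈ 𝓝 x, ∀ y ∈ O, ∀ z ∈ O,
    dist (g • y) (g • z) = lam ^ k * dist y z
  isometric_return : ∀ (g : G) (x : X) (r : ℝ), 0 < r →
    (∀ y ∈ closedBall x r, ∀ z ∈ closedBall x r, dist (g • y) (g • z) = dist y z) →
    (∀ y ∈ closedBall x r, g • y ∈ closedBall x r) → ∃ N, 0 < N ∧ ∀ᶠ y in 𝓝 x, g ^ N • y = y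
  perfect : ∀ x : X, (𝓝[≠] x).NeBot

namespace IsLocalSimilarityAction

variable {lam : ℝ} {G X : Type*} [Group G] [MetricSpace X] [MulAction G X]

theorem subgroup (h : IsLocalSimilarityAction lam G X) (K : Subgroup G) :
    IsLocalSimilarityAction lam K X where
  pos := h.pos
  lt_one := h.lt_one
  sim g := h.sim g.1
  isometric_return g := h.isometric_return g.1
  perfect := h.perfect

/-- The exponent of the local ratio of `g` at `x`. -/
noncomputable def exponent (h : IsLocalSimilarityAction lam G X) (g : G) (x : X) : ℤ :=
  (h.sim g x).choose

theorem exponent_spec (h : IsLocalSimilarityAction lam G X) (g : G) (x : X) :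
    ∃ O ∈ 𝓝 x, ∀ y ∈ O, ∀ z ∈ O, dist (g • y) (g • z) = lam ^ h.exponent g x * dist y z :=
  (h.sim g x).choose_spec

/-- Since `X` is perfect, there is a second point close to `x`; its distance to `x` determines the
ratio, and `lam < 1` makes the exponent of a power of `lam` unique. -/
theorem exponent_eq (h : IsLocalSimilarityAction lam G X) {g : G} {x : X} {k : ℤ} {O : Set X}
    (hO : O ∈ 𝓝 x) (hk : ∀ y ∈ O, ∀ z ∈ O, dist (g • y) (g • z) = lam ^ k * dist y z) :
    h.exponent g x = k := by
  obtain ⟨O', hO', hk'⟩ := h.exponent_spec g x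
  have := h.perfect x
  obtain ⟨y, ⟨hy, hy'⟩, hne⟩ := ((𝓝[≠] x).nonempty_of_mem
    (inter_mem (mem_nhdsWithin_of_mem_nhds (inter_mem hO hO')) self_mem_nhdsWithin))
  have h1 := hk y hy x (mem_of_mem_nhds hO)
  rw [hk' y hy' x (mem_of_mem_nhds hO')] at h1
  have h2 := mul_right_cancel₀ (dist_pos.2 hne).ne' h1
  exact (zpow_right_injective₀ h.pos h.lt_one.ne) h2

theorem exponent_one (h : IsLocalSimilarityAction lam G X) (x : X) :
    h.exponent (1 : G) x = 0 :=
  h.exponent_eq univ_mem (by simp)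

theorem eventually_exponent_eq (h : IsLocalSimilarityAction lam G X) (g : G) (x : X) :
    ∀ᶠ y in 𝓝 x, h.exponent g y = h.exponent g x := by
  obtain ⟨O, hO, hk⟩ := h.exponent_spec g x
  filter_upwards [eventually_mem_nhds_iff.2 hO] with y hy
  exact h.exponent_eq hy hk

theorem exponent_congr (h : IsLocalSimilarityAction lam G X) {g g' : G} {x : X}
    (hg : ∀ᶠ y in 𝓝 x, g • y = g' • y) : h.exponent g x = h.exponent g' x := by
  obtain ⟨O, hO, hk⟩ := h.exponent_spec g' x
  refine h.exponent_eq (inter_mem hO hg) ?_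
  rintro y ⟨hy, hy'⟩ z ⟨hz, hz'⟩
  rw [show g • y = g' • y from hy', show g • z = g' • z from hz', hk y hy z hz]

section

variable [ContinuousConstSMul G X]

theorem exponent_mul (h : IsLocalSimilarityAction lam G X) (g g' : G) (x : X) :
    h.exponent (g * g') x = h.exponent g (g' • x) + h.exponent g' x := by
  obtain ⟨O, hO, hk⟩ := h.exponent_spec g (g' • x)
  obtain ⟨O', hO', hk'⟩ := h.exponent_spec g' x
  refine h.exponent_eq (inter_mem hO' ((continuous_const_smul g').continuousAt hO)) ?_
  rintro y ⟨hy, hy'⟩ z ⟨hz, hz'⟩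
  rw [mul_smul, mul_smul, hk _ hy' _ hz', hk' y hy z hz, zpow_add₀ h.pos.ne', mul_assoc]

theorem exponent_inv (h : IsLocalSimilarityAction lam G X) (g : G) (x : X) :
    h.exponent g⁻¹ (g • x) = - h.exponent g x := by
  have := h.exponent_mul g⁻¹ g x
  rw [inv_mul_cancel, h.exponent_one] at this
  omega

theorem exponent_inv' (h : IsLocalSimilarityAction lam G X) (g : G) (x : X) :
    h.exponent g⁻¹ x = - h.exponent g (g⁻¹ • x) := by
  have := h.exponent_mul g g⁻¹ x
  rw [mul_inv_cancel, h.exponent_one] at this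
  omega

theorem exponent_pow_mul (h : IsLocalSimilarityAction lam G X) {g : G} {x : X} (hx : g • x = x)
    (n : ℕ) : h.exponent (g ^ n) x = n * h.exponent g x := by
  induction n with
  | zero => simp [h.exponent_one]
  | succ n ih =>
    rw [pow_succ, h.exponent_mul, hx, ih]
    push_cast
    ring

theorem exponent_conj (h : IsLocalSimilarityAction lam G X) {g k : G} {x : X} (hx : g • x = x)  :
    h.exponent (k * g * k⁻¹) (k • x) = h.exponent g x := by
  rw [h.exponent_mul, h.exponent_mul, h.exponent_inv, inv_smul_smul, hx]
  ring

end

/-- `g` maps the ball of radius `lam ^ n` about `x` onto the ball of radius `lam ^ (n + k)` about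
`g • x`, as a similarity of ratio `lam ^ k`. -/
def Sim (lam : ℝ) (g : G) (x : X) (n k : ℤ) : Prop :=
  (∀ y ∈ closedBall x (lam ^ n), ∀ z ∈ closedBall x (lam ^ n),
    dist (g • y) (g • z) = lam ^ k * dist y z) ∧
  (g • ·) '' closedBall x (lam ^ n) = closedBall (g • x) (lam ^ (n + k))

theorem Sim.one (x : X) (n : ℤ) : Sim lam (1 : G) x n 0 := by
  constructor <;> simp

theorem Sim.mem {g : G} {x y : X} {n k : ℤ}
    (hs : Sim lam g x n k) (hy : y ∈ closedBall x (lam ^ n)) :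
    g • y ∈ closedBall (g • x) (lam ^ (n + k)) := hs.2 ▸ mem_image_of_mem _ hy

theorem Sim.exponent_eq (h : IsLocalSimilarityAction lam G X) {g : G} {x : X} {n k : ℤ}
    (hs : Sim lam g x n k) : h.exponent g x = k :=
  h.exponent_eq (closedBall_mem_nhds x (zpow_pos h.pos n)) hs.1

theorem Sim.mul (h : IsLocalSimilarityAction lam G X) {g g' : G} {x : X} {n k k' : ℤ}
    (hs' : Sim lam g' x n k') (hs : Sim lam g (g' • x) (n + k') k) :
    Sim lam (g * g') x n (k + k') := by
  constructor
  · intro y hy z hz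
    rw [mul_smul, mul_smul, hs.1 _ (hs'.mem hy) _ (hs'.mem hz), hs'.1 y hy z hz,
      zpow_add₀ h.pos.ne', mul_assoc]
  · have : ((g * g') • · : X → X) = (g • ·) ∘ (g' • ·) := by ext; simp [mul_smul]
    rw [this, image_comp, hs'.2, hs.2, mul_smul]
    congr 2
    ring

theorem zpow_le (h : IsLocalSimilarityAction lam G X) {m n : ℤ} (hmn : n ≤ m) :
    lam ^ m ≤ lam ^ n := zpow_le_zpow_right_of_le_one₀ h.pos h.lt_one.le hmn

theorem closedBall_subset (h : IsLocalSimilarityAction lam G X) (x : X) {m n : ℤ} (hmn : n ≤ m) :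
    closedBall x (lam ^ m) ⊆ closedBall x (lam ^ n) :=
  closedBall_subset_closedBall (h.zpow_le hmn)

theorem exists_zpow_lt (h : IsLocalSimilarityAction lam G X) {ε : ℝ} (hε : 0 < ε) :
    ∃ n : ℤ, ∀ m, n ≤ m → lam ^ m < ε := by
  obtain ⟨n, hn⟩ := exists_pow_lt_of_lt_one hε h.lt_one
  exact ⟨n, fun m hm ↦ (h.zpow_le hm).trans_lt (by simpa using hn)⟩

theorem exists_closedBall_subset (h : IsLocalSimilarityAction lam G X) {x : X} {O : Set X}
    (hO : O ∈ 𝓝 x) : ∃ n : ℤ, ∀ m, n ≤ m → closedBall x (lam ^ m) ⊆ O := by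
  obtain ⟨ε, hε, hO⟩ := Metric.mem_nhds_iff.1 hO
  obtain ⟨n, hn⟩ := h.exists_zpow_lt hε
  exact ⟨n, fun m hm ↦ (closedBall_subset_ball (hn m hm)).trans hO⟩

theorem Sim.mono (h : IsLocalSimilarityAction lam G X) {g : G} {x : X} {n k m : ℤ}
    (hs : Sim lam g x n k) (hnm : n ≤ m) : Sim lam g x m k := by
  have hsub := h.closedBall_subset x hnm
  have h0 := (zpow_pos h.pos n).le
  have h0' := (zpow_pos h.pos m).le
  refine ⟨fun y hy z hz ↦ hs.1 y (hsub hy) z (hsub hz), subset_antisymm ?_ ?_⟩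
  · rintro _ ⟨y, hy, rfl⟩
    rw [mem_closedBall] at hy ⊢
    dsimp only
    rw [hs.1 y (hsub hy) x (mem_closedBall_self h0), zpow_add₀ h.pos.ne', mul_comm]
    exact mul_le_mul_of_nonneg_right hy (zpow_pos h.pos k).le
  · intro w hw
    have hw' : w ∈ (g • ·) '' closedBall x (lam ^ n) := by
      rw [hs.2]
      exact h.closedBall_subset _ (by omega) hw
    obtain ⟨y, hy, rfl⟩ := hw'
    refine ⟨y, ?_, rfl⟩
    rw [mem_closedBall] at hw ⊢
    dsimp only at hw
    rw [hs.1 y hy x (mem_closedBall_self h0), zpow_add₀ h.pos.ne', mul_comm] at hw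
    exact le_of_mul_le_mul_right hw (zpow_pos h.pos k)

variable [IsUltrametricDist X]

theorem Sim.of_mem {g : G} {x y : X} {n k : ℤ}
    (hs : Sim lam g x n k) (hy : y ∈ closedBall x (lam ^ n)) : Sim lam g y n k := by
  have e := IsUltrametricDist.closedBall_eq_of_mem hy
  have e' := IsUltrametricDist.closedBall_eq_of_mem (hs.mem hy)
  rw [Sim, ← e, ← e']
  exact hs

variable [ContinuousConstSMul G X]

theorem exists_sim_nhds (h : IsLocalSimilarityAction lam G X) (g : G) (x : X) :
    ∃ n, ∀ m, n ≤ m → ∀ y ∈ closedBall x (lam ^ n), Sim lam g y m (h.exponent g y) := by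
  obtain ⟨O, hO, hk⟩ := h.exponent_spec g x
  obtain ⟨O', hO', hk'⟩ := h.exponent_spec g⁻¹ (g • x)
  rw [exponent_inv] at hk'
  obtain ⟨m, hm⟩ := h.exists_closedBall_subset hO
  obtain ⟨p, hp⟩ := h.exists_closedBall_subset hO'
  set k := h.exponent g x
  -- Level `p - k` puts the target ball, of level `n + k`, inside the region where `g⁻¹` is a
  -- similarity. This is what gives surjectivity onto that ball.
  set n := max m (p - k)
  have hs : Sim lam g x n k := by
    have h0 := (zpow_pos h.pos n).le
    have hsub := hm n (le_max_left _ _)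
    have h1 : p ≤ n + k := by have := le_max_right m (p - k); omega
    have hsub' := hp (n + k) h1
    refine ⟨fun y hy z hz ↦ hk y (hsub hy) z (hsub hz), subset_antisymm ?_ ?_⟩
    · rintro _ ⟨y, hy, rfl⟩
      rw [mem_closedBall] at hy ⊢
      dsimp only
      rw [hk y (hsub hy) x (mem_of_mem_nhds hO), zpow_add₀ h.pos.ne', mul_comm]
      exact mul_le_mul_of_nonneg_right hy (zpow_pos h.pos k).le
    · intro w hw
      refine ⟨g⁻¹ • w, ?_, by simp⟩
      have := hk' w (hsub' hw) (g • x) (mem_of_mem_nhds hO')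
      rw [mem_closedBall] at hw ⊢
      rw [inv_smul_smul] at this
      rw [this]
      calc lam ^ (-k) * dist w (g • x) ≤ lam ^ (-k) * lam ^ (n + k) :=
            mul_le_mul_of_nonneg_left hw (zpow_pos h.pos _).le
        _ = lam ^ n := by rw [← zpow_add₀ h.pos.ne']; congr 1; ring
  refine ⟨n, fun m hm y hy ↦ ?_⟩
  have := hs.of_mem hy
  rw [this.exponent_eq h]
  exact this.mono h hm

/-- Compactness makes the scale uniform: below a size depending only on `g`, every ball is mapped
onto a ball by a similarity. -/
theorem exists_sim_level [CompactSpace X] (h : IsLocalSimilarityAction lam G X) (g : G) :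
    ∃ n, ∀ m, n ≤ m → ∀ y, Sim lam g y m (h.exponent g y) := by
  choose n hn using h.exists_sim_nhds g
  obtain ⟨t, ht⟩ := isCompact_univ.elim_nhds_subcover (fun x ↦ closedBall x (lam ^ n x))
    fun x _ ↦ closedBall_mem_nhds x (zpow_pos h.pos _)
  obtain ⟨N, hN⟩ := (t.image n).exists_le
  refine ⟨N, fun m hm y ↦ ?_⟩
  obtain ⟨x, hx, hy⟩ := mem_iUnion₂.1 (ht.2 (mem_univ y))
  exact hn x m ((hN _ (Finset.mem_image_of_mem n hx)).trans hm) y hy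

theorem exists_sim_level_finset [CompactSpace X] (h : IsLocalSimilarityAction lam G X)
    (S : Finset G) : ∃ n, ∀ g ∈ S, ∀ m, n ≤ m → ∀ y, Sim lam g y m (h.exponent g y) := by
  choose n hn using h.exists_sim_level
  obtain ⟨N, hN⟩ := (S.image n).exists_le
  exact ⟨N, fun g hg m hm y ↦ hn g m ((hN _ (Finset.mem_image_of_mem n hg)).trans hm) y⟩

-- Ultrametric balls of equal radius coincide or are disjoint, so compactness leaves finitely many.
-- This is the source of every pigeonhole argument on balls.
omit [ContinuousConstSMul G X] in
theorem exists_finset_closedBall [CompactSpace X] (h : IsLocalSimilarityAction lam G X) (n : ℤ) :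
    ∃ t : Finset X, ∀ x, ∃ y ∈ t, closedBall x (lam ^ n) = closedBall y (lam ^ n) := by
  obtain ⟨t, -, ht⟩ := isCompact_univ.elim_nhds_subcover (fun x : X ↦ closedBall x (lam ^ n))
    fun x _ ↦ closedBall_mem_nhds x (zpow_pos h.pos _)
  refine ⟨t, fun x ↦ ?_⟩
  obtain ⟨y, hy, hx⟩ := mem_iUnion₂.1 (ht (mem_univ x))
  exact ⟨y, hy, (IsUltrametricDist.closedBall_eq_of_mem hx).symm⟩

omit [ContinuousConstSMul G X] in
/-- Infinitely many indices yield two points in the same ball of a given radius. -/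
theorem exists_infinite_closedBall [CompactSpace X] (h : IsLocalSimilarityAction lam G X) (n : ℤ)
    {J : Set ℕ} (hJ : J.Infinite) (u : ℕ → X) :
    ∃ J' ⊆ J, J'.Infinite ∧ ∀ i ∈ J', ∀ j ∈ J', u i ∈ closedBall (u j) (lam ^ n) := by
  obtain ⟨t, ht⟩ := h.exists_finset_closedBall n
  choose c hct hc using ht
  by_contra! hcon
  refine hJ ((t.finite_toSet.biUnion (t := fun y ↦ {i ∈ J | c (u i) = y}) fun y _ ↦ ?_).subset
    fun i hi ↦ mem_iUnion₂.2 ⟨_, hct (u i), hi, rfl⟩)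
  by_contra hinf
  obtain ⟨i, hi, j, hj, hij⟩ := hcon _ (fun i hi ↦ hi.1) hinf
  refine hij ?_
  rw [hc (u j), hj.2, ← hi.2, ← hc (u i)]
  exact mem_closedBall_self (zpow_pos h.pos n).le

end IsLocalSimilarityAction

/-! ### Pointwise dynamics of a single element -/

/-- The least value attained after time `T` is attained at such an index. From these times on, the
orbit exponents never fall below their current value, so the forward iterates stay similarities on a
ball of fixed size. -/
theorem infinite_setOf_forall_ge_le {D : ℕ → ℤ} {B : ℤ} (hB : ∀ i, B ≤ D i) :
    {i | ∀ j, i ≤ j → D i ≤ D j}.Infinite := by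
  refine infinite_of_forall_exists_gt fun T ↦ ?_
  obtain ⟨k, ⟨i, hi, rfl⟩, hk⟩ := Int.exists_least_of_bdd (P := fun k ↦ ∃ i, T + 1 ≤ i ∧ D i = k)
    ⟨B, by rintro _ ⟨i, -, rfl⟩; exact hB i⟩ ⟨_, T + 1, le_rfl, rfl⟩
  exact ⟨i, fun j hj ↦ hk _ ⟨j, hi.trans hj, rfl⟩, hi⟩

/-- The first time the sequence drops below its minimum over an initial segment is a strict record.
Seen backwards from a record time, the orbit only contracts. -/
theorem infinite_setOf_forall_lt_lt {D : ℕ → ℤ} (hD : ∀ B, ∃ i, D i < B) :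
    {i | ∀ j, j < i → D i < D j}.Infinite := by
  classical
  refine infinite_of_forall_exists_gt fun T ↦ ?_
  obtain ⟨j₀, -, hm⟩ := Finset.exists_min_image (Finset.range (T + 1)) D (by simp)
  have hex := hD (D j₀)
  refine ⟨Nat.find hex, fun j hj ↦ ?_, ?_⟩
  · exact (Nat.find_spec hex).trans_le (not_lt.1 (Nat.find_min hex hj))
  · by_contra! hle
    exact (hm (Nat.find hex) (Finset.mem_range.2 (by omega))).not_gt (Nat.find_spec hex)

theorem pow_smul_eq_of_dvd {G X : Type*} [Monoid G] [MulAction G X] {g : G} {x : X} {m n : ℕ}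
    (hmn : m ∣ n) (hx : g ^ m • x = x) : g ^ n • x = x := by
  obtain ⟨k, rfl⟩ := hmn
  rw [pow_mul]
  induction k with
  | zero => simp
  | succ k ih => rw [pow_succ, mul_smul, hx, ih]

theorem inv_pow_smul_eq_iff {G X : Type*} [Group G] [MulAction G X] {g : G} {x : X} {m : ℕ} :
    g⁻¹ ^ m • x = x ↔ g ^ m • x = x := by
  rw [inv_pow, inv_smul_eq_iff, eq_comm]

namespace IsLocalSimilarityAction

variable {lam : ℝ} {G X : Type*} [Group G] [MetricSpace X] [MulAction G X]
  [ContinuousConstSMul G X]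

/-- The successive images of the ball have levels `n + h.exponent (f ^ j) x`; as long as these stay
at least `n₀`, the uniform control of `f` applies at each step. -/
theorem sim_pow (h : IsLocalSimilarityAction lam G X) {f : G} {n₀ : ℤ}
    (hf : ∀ m, n₀ ≤ m → ∀ y, Sim lam f y m (h.exponent f y)) {x : X} {n : ℤ} {i : ℕ}
    (hi : ∀ j < i, n₀ ≤ n + h.exponent (f ^ j) x) :
    Sim lam (f ^ i) x n (h.exponent (f ^ i) x) := by
  induction i with
  | zero => rw [pow_zero, h.exponent_one]; exact Sim.one x n
  | succ i ih =>
    rw [pow_succ', h.exponent_mul]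
    exact (ih fun j hj ↦ hi j (by omega)).mul h (hf _ (hi i (by omega)) _)

theorem exponent_pow_pow_mul (h : IsLocalSimilarityAction lam G X) {f : G} {x : X} {m : ℕ}
    (hx : f ^ m • x = x) (t r : ℕ) :
    h.exponent (f ^ (r + m * t)) x = h.exponent (f ^ r) x + t * h.exponent (f ^ m) x := by
  rw [pow_add, h.exponent_mul, pow_smul_eq_of_dvd (dvd_mul_right m t) hx, pow_mul,
    h.exponent_pow_mul hx]

/-- Near `x`, some positive power of `f` is the identity. -/
def Elliptic (f : G) (x : X) : Prop := ∃ m, 0 < m ∧ ∀ᶠ y in 𝓝 x, f ^ m • y = y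

/-- `x` is an attracting periodic point of `f`. -/
def Attracting (h : IsLocalSimilarityAction lam G X) (f : G) (x : X) : Prop :=
  ∃ m, 0 < m ∧ f ^ m • x = x ∧ 0 < h.exponent (f ^ m) x

/-- A neighbourhood of `x` is uniformly asymptotic to an attracting periodic orbit of `f`. -/
def Basin (h : IsLocalSimilarityAction lam G X) (f : G) (x : X) : Prop :=
  ∃ a, h.Attracting f a ∧ ∃ O ∈ 𝓝 x, ∀ T : ℤ, ∃ n₁ : ℕ, ∀ n, n₁ ≤ n → ∀ y ∈ O,
    T ≤ h.exponent (f ^ n) y ∧ dist (f ^ n • y) (f ^ n • a) ≤ lam ^ T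

omit [ContinuousConstSMul G X] in
theorem Elliptic.inv {f : G} {x : X} (hx : Elliptic f x) : Elliptic f⁻¹ x := by
  obtain ⟨m, hm, hx⟩ := hx
  exact ⟨m, hm, hx.mono fun y ↦ inv_pow_smul_eq_iff.2⟩

omit [ContinuousConstSMul G X] in
theorem elliptic_inv_iff {f : G} {x : X} : Elliptic f⁻¹ x ↔ Elliptic f x :=
  ⟨fun hx ↦ inv_inv f ▸ hx.inv, Elliptic.inv⟩

omit [ContinuousConstSMul G X] in
theorem isOpen_setOf_elliptic (f : G) : IsOpen {x : X | Elliptic f x} := by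
  refine isOpen_iff_mem_nhds.2 fun x ⟨m, hm, hx⟩ ↦ ?_
  filter_upwards [hx.eventually_nhds] with y hy
  exact ⟨m, hm, hy⟩

theorem exponent_inv_pow (h : IsLocalSimilarityAction lam G X) {f : G} {x : X} {m : ℕ}
    (hx : f ^ m • x = x) : h.exponent (f⁻¹ ^ m) x = - h.exponent (f ^ m) x := by
  have := h.exponent_inv (f ^ m) x
  rwa [hx, ← inv_pow] at this

theorem Attracting.exponent_pos (h : IsLocalSimilarityAction lam G X) {f : G} {x : X}
    (hx : h.Attracting f x) {m : ℕ} (hm : 0 < m) (hmx : f ^ m • x = x) :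
    0 < h.exponent (f ^ m) x := by
  obtain ⟨m', hm', hx', hpos⟩ := hx
  have h1 := h.exponent_pow_pow_mul hmx m' 0
  have h2 := h.exponent_pow_pow_mul hx' m 0
  rw [mul_comm m m', h2] at h1
  have : (0 : ℤ) < m' := by exact_mod_cast hm'
  have : (0 : ℤ) < m := by exact_mod_cast hm
  by_contra! hle
  nlinarith

theorem Attracting.exponent_neg (h : IsLocalSimilarityAction lam G X) {f : G} {x : X}
    (hx : h.Attracting f⁻¹ x) {m : ℕ} (hm : 0 < m) (hmx : f ^ m • x = x) :
    h.exponent (f ^ m) x < 0 := by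
  have := hx.exponent_pos h hm (inv_pow_smul_eq_iff.2 hmx)
  rw [h.exponent_inv_pow hmx] at this
  omega

theorem Attracting.not_inv (h : IsLocalSimilarityAction lam G X) {f : G} {x : X}
    (hx : h.Attracting f x) : ¬ h.Attracting f⁻¹ x := by
  intro hx'
  obtain ⟨m, hm, hmx, hpos⟩ := hx
  have := hx'.exponent_neg h hm hmx
  omega

theorem Attracting.not_elliptic (h : IsLocalSimilarityAction lam G X) {f : G} {x : X}
    (hx : h.Attracting f x) : ¬ Elliptic f x := by
  rintro ⟨m, hm, he⟩
  have h1 := hx.exponent_pos h hm he.self_of_nhds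
  rw [h.exponent_congr (g' := 1) (by simpa using he), h.exponent_one] at h1
  omega

theorem Attracting.smul_of_commute (h : IsLocalSimilarityAction lam G X) {f c : G} {x : X}
    (hx : h.Attracting f x) (hc : Commute c f) : h.Attracting f (c • x) := by
  obtain ⟨m, hm, hmx, hpos⟩ := hx
  have hc' : c * f ^ m = f ^ m * c := (hc.pow_right m).eq
  refine ⟨m, hm, by rw [smul_smul, ← hc', mul_smul, hmx], ?_⟩
  have h1 := h.exponent_conj hmx (k := c)
  rw [hc', mul_inv_cancel_right] at h1
  rwa [h1]

/-- Near `x` the exponents of high iterates are large, whereas along a periodic orbit they grow by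
the exponent of one period; that exponent must be positive. -/
theorem Basin.eventually (h : IsLocalSimilarityAction lam G X) {f : G} {x : X}
    (hx : h.Basin f x) :
    ∀ᶠ y in 𝓝 x, ∀ m, 0 < m → f ^ m • y = y → 0 < h.exponent (f ^ m) y := by
  obtain ⟨a, -, O, hO, hT⟩ := hx
  filter_upwards [hO] with y hy m hm hmy
  obtain ⟨n₁, hn⟩ := hT 1
  have h1 := (hn (0 + m * n₁) (by nlinarith) y hy).1
  rw [h.exponent_pow_pow_mul hmy, pow_zero, h.exponent_one, zero_add] at h1
  by_contra! hle
  nlinarith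

theorem Basin.eventually_not_elliptic (h : IsLocalSimilarityAction lam G X) {f : G} {x : X}
    (hx : h.Basin f x) : ∀ᶠ y in 𝓝 x, ¬ Elliptic f y := by
  filter_upwards [hx.eventually h] with y hy ⟨m, hm, he⟩
  have h1 := hy m hm he.self_of_nhds
  rw [h.exponent_congr (g' := 1) (by simpa using he), h.exponent_one] at h1
  omega

theorem Basin.eventually_not_attracting_inv (h : IsLocalSimilarityAction lam G X) {f : G} {x : X}
    (hx : h.Basin f x) : ∀ᶠ y in 𝓝 x, ¬ h.Attracting f⁻¹ y := by
  filter_upwards [hx.eventually h] with y hy hatt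
  obtain ⟨m, hm, hmy, -⟩ := id hatt
  rw [inv_pow_smul_eq_iff] at hmy
  have := hatt.exponent_neg h hm hmy
  have := hy m hm hmy
  omega

-- Along common multiples of the two periods both the periodic point and `a` return to themselves,
-- while their distance tends to zero.
omit [ContinuousConstSMul G X] in
theorem Basin.eventually_attracting_eq (h : IsLocalSimilarityAction lam G X) {f : G} {x : X}
    (hx : h.Basin f x) : ∃ a, ∀ᶠ y in 𝓝 x, h.Attracting f y → y = a := by
  obtain ⟨a, ⟨m, hm, hma, -⟩, O, hO, hT⟩ := hx
  refine ⟨a, ?_⟩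
  filter_upwards [hO] with y hy ⟨m', hm', hmy, _⟩
  refine dist_le_zero.1 (le_of_forall_pos_le_add fun ε hε ↦ ?_)
  obtain ⟨T, hT'⟩ := h.exists_zpow_lt hε
  obtain ⟨n₁, hn⟩ := hT T
  have h1 := (hn (m * m' * n₁) (by
    have : 1 ≤ m * m' := Nat.mul_pos hm hm'
    nlinarith) y hy).2
  rw [pow_smul_eq_of_dvd ⟨m * n₁, by ring⟩ hmy, pow_smul_eq_of_dvd ⟨m' * n₁, by ring⟩ hma] at h1
  linarith [hT' T le_rfl]

variable [CompactSpace X]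

omit [ContinuousConstSMul G X] in
theorem Sim.exists_fixedPoint (h : IsLocalSimilarityAction lam G X) {g : G} {x : X} {n k : ℤ}
    (hs : Sim lam g x n k) (hk : 0 < k)
    (hmaps : ∀ y ∈ closedBall x (lam ^ n), g • y ∈ closedBall x (lam ^ n)) :
    ∃ a ∈ closedBall x (lam ^ n), g • a = a ∧
      ∀ b ∈ closedBall x (lam ^ n), g • b = b → b = a := by
  have hlt : lam ^ k < 1 := by
    lift k to ℕ using hk.le
    exact_mod_cast pow_lt_one₀ h.pos.le h.lt_one (by omega)
  have hpos := zpow_pos h.pos k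
  have hc : ContractingWith ⟨lam ^ k, hpos.le⟩
      (MapsTo.restrict (g • ·) (closedBall x (lam ^ n)) (closedBall x (lam ^ n)) hmaps) := by
    refine ⟨by exact_mod_cast hlt, LipschitzWith.of_dist_le_mul fun y z ↦ ?_⟩
    exact (hs.1 y y.2 z z.2).le
  obtain ⟨a, ha, hfa, -⟩ := hc.exists_fixedPoint' (isClosed_closedBall.isComplete) hmaps
    (mem_closedBall_self (zpow_pos h.pos n).le) (edist_ne_top _ _)
  refine ⟨a, ha, hfa, fun b hb hgb ↦ ?_⟩
  have h1 := hs.1 b hb a ha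
  rw [hgb, show g • a = a from hfa] at h1
  refine dist_le_zero.1 ?_
  have : (1 - lam ^ k) * dist b a = 0 := by linarith
  rcases mul_eq_zero.1 this with h2 | h2
  · linarith
  · exact h2.le

variable [IsUltrametricDist X]

omit [ContinuousConstSMul G X] [CompactSpace X] in
theorem Sim.mapsTo (h : IsLocalSimilarityAction lam G X) {g : G} {x : X} {n k : ℤ}
    (hs : Sim lam g x n k) (hk : 0 ≤ k) (hx : g • x ∈ closedBall x (lam ^ n)) :
    ∀ y ∈ closedBall x (lam ^ n), g • y ∈ closedBall x (lam ^ n) := by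
  intro y hy
  rw [IsUltrametricDist.closedBall_eq_of_mem hx]
  exact h.closedBall_subset _ (by omega) (hs.mem hy)

/-- Take two future minima of the exponent at which the orbit visits the same ball of level `n₀`.
The return map sends this ball into itself with exponent at least zero. Exponent zero is an
isometric return, hence ellipticity; a positive exponent is a contraction, whose fixed point
attracts the ball. -/
theorem elliptic_or_basin_of_bddBelow (h : IsLocalSimilarityAction lam G X) {f : G} {x : X} {B : ℤ}
    (hB : ∀ i : ℕ, B ≤ h.exponent (f ^ i) x) : Elliptic f x ∨ h.Basin f x := by
  obtain ⟨n₀, hn₀⟩ := h.exists_sim_level f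
  obtain ⟨J, hJ, hJinf, hJball⟩ := h.exists_infinite_closedBall n₀
    (infinite_setOf_forall_ge_le hB) (fun i ↦ f ^ i • x)
  obtain ⟨i, hi⟩ := hJinf.nonempty
  obtain ⟨i', hi', hii'⟩ := hJinf.exists_gt i
  set q := f ^ i • x with hq
  have hpow (j : ℕ) : f ^ j • q = f ^ (i + j) • x := by rw [hq, smul_smul, ← pow_add, add_comm]
  have hexp (j : ℕ) : h.exponent (f ^ j) q = h.exponent (f ^ (i + j)) x - h.exponent (f ^ i) x := by
    rw [add_comm, pow_add, h.exponent_mul]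
    ring
  have hnn (j : ℕ) : 0 ≤ h.exponent (f ^ j) q := by
    have := hJ hi (i + j) (by omega)
    rw [hexp]
    omega
  have hsim (j : ℕ) : Sim lam (f ^ j) q n₀ (h.exponent (f ^ j) q) :=
    h.sim_pow hn₀ fun j _ ↦ by have := hnn j; omega
  obtain ⟨m, rfl⟩ := Nat.exists_eq_add_of_lt hii'
  rw [add_assoc] at hi'
  set M := m + 1
  have hmq : f ^ M • q ∈ closedBall q (lam ^ n₀) := by
    rw [hpow]
    exact hJball _ hi' _ hi
  have hmaps := (hsim M).mapsTo h (hnn M) hmq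
  rcases (hnn M).eq_or_lt with hzero | hpos
  · left
    have hs := hsim M
    rw [← hzero] at hs
    obtain ⟨N, hN, hev⟩ := h.isometric_return (f ^ M) q (lam ^ n₀) (zpow_pos h.pos _)
      (by simpa using hs.1) hmaps
    refine ⟨M * N, by positivity, ?_⟩
    have hc : Tendsto (fun y ↦ f ^ i • y) (𝓝 x) (𝓝 q) := (continuous_const_smul _).continuousAt
    filter_upwards [hc.eventually hev] with y hy
    rw [← pow_mul, smul_smul, ← pow_add, add_comm, pow_add, mul_smul] at hy
    exact smul_left_cancel _ hy
  · right
    obtain ⟨a, ha, hfa, -⟩ := (hsim M).exists_fixedPoint h hpos hmaps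
    have hea (j : ℕ) : h.exponent (f ^ j) a = h.exponent (f ^ j) q :=
      ((hsim j).of_mem ha).exponent_eq h
    have hatt : h.Attracting f a := ⟨M, by omega, hfa, by rwa [hea]⟩
    -- The attractor is pulled back by `f ^ i` to keep it in phase: after time `i`, the orbits of
    -- `y` and of the chosen point lie in the same ball about `q`.
    refine ⟨(f ^ i)⁻¹ • a, hatt.smul_of_commute h (Commute.self_pow f i).inv_right.symm,
      {y | f ^ i • y ∈ closedBall q (lam ^ n₀) ∧ h.exponent (f ^ i) y = h.exponent (f ^ i) x},
      ?_, fun T ↦ ?_⟩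
    · have hc : Tendsto (fun y ↦ f ^ i • y) (𝓝 x) (𝓝 q) := (continuous_const_smul _).continuousAt
      exact (hc.eventually (closedBall_mem_nhds q (zpow_pos h.pos n₀))).and
        (h.eventually_exponent_eq _ _)
    set N := (max (T - h.exponent (f ^ i) x) (T - n₀)).toNat with hN
    have hN' := Int.self_le_toNat (max (T - h.exponent (f ^ i) x) (T - n₀))
    rw [← hN, max_le_iff] at hN'
    refine ⟨i + M * N, fun n hn y ⟨hy, hy'⟩ ↦ ?_⟩
    obtain ⟨j, rfl⟩ := Nat.exists_eq_add_of_le ((Nat.le_add_right i _).trans hn)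
    have hj : (N : ℤ) ≤ h.exponent (f ^ j) q := by
      have h1 := h.exponent_pow_pow_mul hfa (j / M) (j % M)
      rw [Nat.mod_add_div, hea, hea, hea] at h1
      have h2 : N ≤ j / M := (Nat.le_div_iff_mul_le (by omega)).2 (by rw [mul_comm]; omega)
      have h3 := hnn (j % M)
      have h4 : (N : ℤ) ≤ (j / M : ℕ) := by exact_mod_cast h2
      nlinarith
    have hey : h.exponent (f ^ j) (f ^ i • y) = h.exponent (f ^ j) q :=
      ((hsim j).of_mem hy).exponent_eq h
    constructor
    · rw [add_comm i j, pow_add, h.exponent_mul, hey, hy']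
      omega
    · rw [add_comm i j, pow_add, mul_smul, mul_smul, smul_inv_smul, (hsim j).1 _ hy _ ha]
      have h1 : dist (f ^ i • y) a ≤ lam ^ n₀ := by
        rw [IsUltrametricDist.closedBall_eq_of_mem ha] at hy
        exact hy
      calc _ ≤ lam ^ h.exponent (f ^ j) q * lam ^ n₀ :=
            mul_le_mul_of_nonneg_left h1 (zpow_pos h.pos _).le
        _ = lam ^ (h.exponent (f ^ j) q + n₀) := by rw [zpow_add₀ h.pos.ne']
        _ ≤ lam ^ T := h.zpow_le (by omega)

/-- Between record lows that visit the same ball, inverse iterates contract this ball into itself.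
Returns from later records contract arbitrarily strongly and share one fixed point, which must
therefore be the orbit point itself. -/
theorem attracting_inv_of_not_bddBelow (h : IsLocalSimilarityAction lam G X) {f : G} {x : X}
    (hB : ∀ B : ℤ, ∃ i : ℕ, h.exponent (f ^ i) x < B) : h.Attracting f⁻¹ x := by
  obtain ⟨n₀, hn₀⟩ := h.exists_sim_level f⁻¹
  obtain ⟨J, hJ, hJinf, hJball⟩ := h.exists_infinite_closedBall n₀
    (infinite_setOf_forall_lt_lt hB) (fun i ↦ f ^ i • x)
  have hback (i j : ℕ) : f⁻¹ ^ j • f ^ (i + j) • x = f ^ i • x := by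
    rw [pow_add, ← pow_mul_comm, mul_smul, inv_pow, inv_smul_smul]
  have hexp (i j : ℕ) : h.exponent (f⁻¹ ^ j) (f ^ (i + j) • x) =
      h.exponent (f ^ i) x - h.exponent (f ^ (i + j)) x := by
    have h1 := h.exponent_mul (f⁻¹ ^ j) (f ^ (i + j)) x
    rw [pow_add, ← pow_mul_comm, ← mul_assoc, inv_pow, inv_mul_cancel, one_mul, pow_mul_comm,
      ← pow_add, ← inv_pow] at h1
    omega
  have hsim (i j : ℕ) (hij : i + j ∈ J) : Sim lam (f⁻¹ ^ j) (f ^ (i + j) • x) n₀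
      (h.exponent (f ^ i) x - h.exponent (f ^ (i + j)) x) := by
    rw [← hexp]
    refine h.sim_pow hn₀ fun j' hj' ↦ ?_
    have h1 := hexp (i + j - j') j'
    rw [Nat.sub_add_cancel (by omega)] at h1
    rw [h1]
    rcases Nat.eq_zero_or_pos j' with rfl | hpos
    · simp
    · have := hJ hij (i + j - j') (by omega)
      omega
  obtain ⟨i, hi⟩ := hJinf.nonempty
  have hball (j : ℕ) (hij : i + j ∈ J) :
      closedBall (f ^ (i + j) • x) (lam ^ n₀) = closedBall (f ^ i • x) (lam ^ n₀) :=
    (IsUltrametricDist.closedBall_eq_of_mem (hJball _ hi _ hij))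
  have hmaps (j : ℕ) (hj : 0 < j) (hij : i + j ∈ J) : ∀ y ∈ closedBall (f ^ i • x) (lam ^ n₀),
      f⁻¹ ^ j • y ∈ closedBall (f ^ i • x) (lam ^ n₀) := by
    have := (hsim i j hij).mapsTo h (by have := hJ hij i (by omega); omega)
      (by rw [hback]; exact hJball _ hi _ hij)
    rwa [hball j hij] at this
  have hfix (j : ℕ) (hj : 0 < j) (hij : i + j ∈ J) :
      ∃ a ∈ closedBall (f ^ i • x) (lam ^ n₀), f⁻¹ ^ j • a = a ∧
        ∀ b ∈ closedBall (f ^ i • x) (lam ^ n₀), f⁻¹ ^ j • b = b → b = a := by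
    have := (hsim i j hij).exists_fixedPoint h (by have := hJ hij i (by omega); omega)
      (by rw [hball j hij]; exact hmaps j hj hij)
    rwa [hball j hij] at this
  obtain ⟨i', hi', hii'⟩ := hJinf.exists_gt i
  obtain ⟨m, rfl⟩ := Nat.exists_eq_add_of_lt hii'
  rw [add_assoc] at hi'
  set M := m + 1
  obtain ⟨p, hp, hfp, huniq⟩ := hfix M (by omega) hi'
  have hpq : f ^ i • x = p := by
    refine dist_le_zero.1 (le_of_forall_pos_le_add fun ε hε ↦ ?_)
    obtain ⟨T, hT⟩ := h.exists_zpow_lt hε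
    obtain ⟨i₀, hi₀⟩ := hB (h.exponent (f ^ i) x - (T - n₀))
    obtain ⟨i'', hi'', hlt⟩ := hJinf.exists_gt (max i i₀)
    rw [max_lt_iff] at hlt
    obtain ⟨m', rfl⟩ := Nat.exists_eq_add_of_lt hlt.1
    rw [add_assoc] at hi'' hlt
    -- The later return commutes with the first one and preserves the ball, so it maps `p` to a
    -- fixed point of the first return, which is unique.
    have hfp' : f⁻¹ ^ (m' + 1) • p = p := by
      refine huniq _ (hmaps _ (by omega) hi'' p hp) ?_
      rw [smul_smul, pow_mul_comm, mul_smul, hfp]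
    have h1 := hsim i _ hi''
    have h2 := h1.1 _ (mem_closedBall_self (zpow_pos h.pos n₀).le) p (by rwa [hball _ hi''])
    rw [hback, hfp'] at h2
    have h3 : dist (f ^ (i + (m' + 1)) • x) p ≤ lam ^ n₀ := by
      rw [← hball _ hi''] at hp
      rw [dist_comm]
      exact hp
    have h4 := hJ hi'' i₀ hlt.2
    rw [h2, zero_add]
    calc _ ≤ lam ^ (h.exponent (f ^ i) x - h.exponent (f ^ (i + (m' + 1))) x) * lam ^ n₀ :=
          mul_le_mul_of_nonneg_left h3 (zpow_pos h.pos _).le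
      _ = lam ^ (h.exponent (f ^ i) x - h.exponent (f ^ (i + (m' + 1))) x + n₀) := by
          rw [zpow_add₀ h.pos.ne']
      _ ≤ ε := (hT _ (by omega)).le
  have hatt : h.Attracting f⁻¹ p := by
    refine ⟨M, by omega, hfp, ?_⟩
    have h1 := (hsim i M hi').of_mem (y := p) (by rwa [hball _ hi'])
    rw [h1.exponent_eq h]
    have := hJ hi' i (by omega)
    omega
  rw [← hpq] at hatt
  have := hatt.smul_of_commute h (c := (f ^ i)⁻¹) (Commute.pow_self f i).inv_inv
  rwa [inv_smul_smul] at this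

theorem elliptic_or_basin_or_attracting_inv (h : IsLocalSimilarityAction lam G X) (f : G) (x : X) :
    Elliptic f x ∨ h.Basin f x ∨ h.Attracting f⁻¹ x := by
  by_cases hB : ∃ B : ℤ, ∀ i : ℕ, B ≤ h.exponent (f ^ i) x
  · obtain ⟨B, hB⟩ := hB
    exact (h.elliptic_or_basin_of_bddBelow hB).imp_right Or.inl
  · push Not at hB
    exact .inr (.inr (h.attracting_inv_of_not_bddBelow hB))

end IsLocalSimilarityAction

/-! ### Global dynamics of a single element -/

namespace IsLocalSimilarityAction

variable {lam : ℝ} {G X : Type*} [Group G] [MetricSpace X] [MulAction G X]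

/-- The dynamics of `f`: it is the identity on the clopen set `U`, and elsewhere it moves points
from the finite set `R` of repelling fixed points to the finite set `A` of attracting ones. -/
structure HyperbolicData (h : IsLocalSimilarityAction lam G X) (f : G) (A R U : Set X) :
    Prop where
  finite_attracting : A.Finite
  finite_repelling : R.Finite
  disjoint : Disjoint A R
  isClopen : IsClopen U
  smul_eq : ∀ x ∈ U, f • x = x
  smul_eq_attracting : ∀ x ∈ A, f • x = x
  smul_eq_repelling : ∀ x ∈ R, f • x = x
  attracting_notMem : ∀ x ∈ A, x ∉ U
  repelling_notMem : ∀ x ∈ R, x ∉ U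
  forward : ∀ x ∉ U, x ∉ R → ∃ a ∈ A, ∃ O ∈ 𝓝 x, ∀ W ∈ 𝓝 a, ∀ T : ℤ, ∃ n₁ : ℕ, ∀ n, n₁ ≤ n →
    ∀ y ∈ O, f ^ n • y ∈ W ∧ T ≤ h.exponent (f ^ n) y
  backward : ∀ x ∉ U, x ∉ A → ∃ a ∈ R, ∃ O ∈ 𝓝 x, ∀ W ∈ 𝓝 a, ∀ T : ℤ, ∃ n₁ : ℕ, ∀ n, n₁ ≤ n →
    ∀ y ∈ O, f⁻¹ ^ n • y ∈ W ∧ T ≤ h.exponent (f⁻¹ ^ n) y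

theorem HyperbolicData.inv {h : IsLocalSimilarityAction lam G X} {f : G} {A R U : Set X}
    (H : h.HyperbolicData f A R U) : h.HyperbolicData f⁻¹ R A U where
  finite_attracting := H.finite_repelling
  finite_repelling := H.finite_attracting
  disjoint := H.disjoint.symm
  isClopen := H.isClopen
  smul_eq x hx := inv_smul_eq_iff.2 (H.smul_eq x hx).symm
  smul_eq_attracting x hx := inv_smul_eq_iff.2 (H.smul_eq_repelling x hx).symm
  smul_eq_repelling x hx := inv_smul_eq_iff.2 (H.smul_eq_attracting x hx).symm
  attracting_notMem := H.repelling_notMem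
  repelling_notMem := H.attracting_notMem
  forward := H.backward
  backward := by rw [inv_inv]; exact H.forward

/-- The complement of `U ∪ W'` is compact, so the locally uniform convergence to `A` becomes uniform
there. -/
theorem HyperbolicData.uniform [CompactSpace X] {h : IsLocalSimilarityAction lam G X} {f : G}
    {A R U : Set X} (H : h.HyperbolicData f A R U) {W W' : Set X} (hW : IsOpen W) (hAW : A ⊆ W)
    (hW' : IsOpen W') (hRW' : R ⊆ W') (T : ℤ) :
    ∃ n₁ : ℕ, ∀ n, n₁ ≤ n → ∀ x ∉ U, x ∉ W' → f ^ n • x ∈ W ∧ T ≤ h.exponent (f ^ n) x := by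
  have hK : IsCompact (U ∪ W')ᶜ := (H.isClopen.isOpen.union hW').isClosed_compl.isCompact
  have key : ∃ n₁ : ℕ, ∀ n, n₁ ≤ n → ∀ x ∈ (U ∪ W')ᶜ, f ^ n • x ∈ W ∧ T ≤ h.exponent (f ^ n) x := by
    refine hK.induction_on (p := fun s ↦ ∃ n₁ : ℕ, ∀ n, n₁ ≤ n → ∀ x ∈ s,
      f ^ n • x ∈ W ∧ T ≤ h.exponent (f ^ n) x) ?_ ?_ ?_ ?_
    · exact ⟨0, by simp⟩
    · rintro s t hst ⟨n₁, hn⟩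
      exact ⟨n₁, fun n hn' x hx ↦ hn n hn' x (hst hx)⟩
    · rintro s t ⟨n₁, hn⟩ ⟨n₂, hn₂⟩
      refine ⟨max n₁ n₂, fun n hn' x hx ↦ ?_⟩
      rw [max_le_iff] at hn'
      exact hx.elim (hn n hn'.1 x) (hn₂ n hn'.2 x)
    · intro x hx
      rw [mem_compl_iff, mem_union, not_or] at hx
      obtain ⟨a, ha, O, hO, hT⟩ := H.forward x hx.1 fun hxR ↦ hx.2 (hRW' hxR)
      exact ⟨O, mem_nhdsWithin_of_mem_nhds hO, hT W (hW.mem_nhds (hAW ha)) T⟩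
  obtain ⟨n₁, hn⟩ := key
  exact ⟨n₁, fun n hn' x hx hx' ↦ hn n hn' x (by simp [hx, hx'])⟩

variable [ContinuousConstSMul G X]

/-- A point that is fixed by a power of `f` with trivial exponent lies in the identity part. -/
theorem HyperbolicData.mem_of_exponent_eq_zero {h : IsLocalSimilarityAction lam G X} {f : G}
    {A R U : Set X} (H : h.HyperbolicData f A R U) {x : X} {m : ℕ} (hm : 0 < m)
    (hx : f ^ m • x = x) (hexp : h.exponent (f ^ m) x = 0) : x ∈ U := by
  by_contra hxU
  have key : ∀ {g : G} {A R : Set X}, h.HyperbolicData g A R U → g ^ m • x = x →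
      h.exponent (g ^ m) x = 0 → x ∉ R → False := by
    intro g A R H hx hexp hxR
    obtain ⟨a, -, O, hO, hT⟩ := H.forward x hxU hxR
    obtain ⟨n₁, hn⟩ := hT univ univ_mem 1
    have h1 := (hn (0 + m * n₁) (by nlinarith) x (mem_of_mem_nhds hO)).2
    rw [h.exponent_pow_pow_mul hx, hexp, pow_zero, h.exponent_one] at h1
    simp at h1
  by_cases hxR : x ∈ R
  · exact key H.inv (inv_pow_smul_eq_iff.2 hx) (by rw [h.exponent_inv_pow hx, hexp, neg_zero])
      fun hxA ↦ H.disjoint.notMem_of_mem_left hxA hxR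
  · exact key H hx hexp hxR

theorem HyperbolicData.elliptic_mem {h : IsLocalSimilarityAction lam G X} {f : G}
    {A R U : Set X} (H : h.HyperbolicData f A R U) {x : X} (hx : Elliptic f x) : x ∈ U := by
  obtain ⟨m, hm, he⟩ := hx
  refine H.mem_of_exponent_eq_zero hm he.self_of_nhds ?_
  rw [h.exponent_congr (g' := 1) (by simpa using he), h.exponent_one]

omit [MetricSpace X] [ContinuousConstSMul G X] in
theorem exists_pow_smul_eq_of_finite {f : G} {s : Set X} (hs : s.Finite)
    (hf : ∀ x ∈ s, ∃ m, 0 < m ∧ f ^ m • x = x) : ∃ N, 0 < N ∧ ∀ x ∈ s, f ^ N • x = x := by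
  induction s, hs using Set.Finite.induction_on with
  | empty => exact ⟨1, one_pos, by simp⟩
  | @insert x s _ _ ih =>
    obtain ⟨N, hN, h1⟩ := ih fun x hx ↦ hf x (mem_insert_of_mem _ hx)
    obtain ⟨m, hm, h2⟩ := hf x (mem_insert _ _)
    refine ⟨N * m, by positivity, ?_⟩
    rintro y (rfl | hy)
    · exact pow_smul_eq_of_dvd (dvd_mul_left _ _) h2
    · exact pow_smul_eq_of_dvd (dvd_mul_right _ _) (h1 y hy)

omit [ContinuousConstSMul G X] in
theorem exists_pow_smul_eq_of_isCompact {f : G} {s : Set X} (hs : IsCompact s)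
    (hf : ∀ x ∈ s, Elliptic f x) : ∃ N, 0 < N ∧ ∀ x ∈ s, f ^ N • x = x := by
  refine hs.induction_on (p := fun s ↦ ∃ N, 0 < N ∧ ∀ x ∈ s, f ^ N • x = x)
    ⟨1, one_pos, by simp⟩ ?_ ?_ ?_
  · rintro s t hst ⟨N, hN, h1⟩
    exact ⟨N, hN, fun x hx ↦ h1 x (hst hx)⟩
  · rintro s t ⟨N, hN, h1⟩ ⟨m, hm, h2⟩
    refine ⟨N * m, by positivity, ?_⟩
    rintro y (hy | hy)
    · exact pow_smul_eq_of_dvd (dvd_mul_right _ _) (h1 y hy)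
    · exact pow_smul_eq_of_dvd (dvd_mul_left _ _) (h2 y hy)
  · intro x hx
    obtain ⟨m, hm, he⟩ := hf x hx
    exact ⟨_, mem_nhdsWithin_of_mem_nhds he, m, hm, fun y hy ↦ hy⟩

variable [CompactSpace X] [IsUltrametricDist X]

/-- Applying the trichotomy to `f⁻¹` as well upgrades an attracting point of `f⁻¹` to a basin: no
point is attracting for both. All three alternatives now control a whole neighbourhood. -/
theorem elliptic_or_basin_or_basin_inv (h : IsLocalSimilarityAction lam G X) (f : G) (x : X) :
    Elliptic f x ∨ h.Basin f x ∨ h.Basin f⁻¹ x := by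
  rcases h.elliptic_or_basin_or_attracting_inv f x with h1 | h1 | h1
  · exact .inl h1
  · exact .inr (.inl h1)
  rcases h.elliptic_or_basin_or_attracting_inv f⁻¹ x with h2 | h2 | h2
  · exact .inl (elliptic_inv_iff.1 h2)
  · exact .inr (.inr h2)
  · exact absurd h2 (h1.not_inv h)

theorem isClopen_setOf_elliptic (h : IsLocalSimilarityAction lam G X) (f : G) :
    IsClopen {x : X | Elliptic f x} := by
  refine ⟨isOpen_compl_iff.1 (isOpen_iff_mem_nhds.2 fun x hx ↦ ?_), isOpen_setOf_elliptic f⟩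
  rcases h.elliptic_or_basin_or_basin_inv f x with h1 | h1 | h1
  · exact absurd h1 hx
  · exact h1.eventually_not_elliptic h
  · filter_upwards [h1.eventually_not_elliptic h] with y hy
    rwa [elliptic_inv_iff] at hy

theorem finite_setOf_attracting (h : IsLocalSimilarityAction lam G X) (f : G) :
    {x : X | h.Attracting f x}.Finite := by
  have key : ({x | h.Attracting f x} ∩ univ).Finite := by
    refine isCompact_univ.induction_on (p := fun s ↦ ({x | h.Attracting f x} ∩ s).Finite)
      (by simp) (fun s t hst ht ↦ ht.subset (inter_subset_inter_right _ hst))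
      (fun s t hs ht ↦ by rw [inter_union_distrib_left]; exact hs.union ht) fun x _ ↦ ?_
    rw [nhdsWithin_univ]
    rcases h.elliptic_or_basin_or_basin_inv f x with h1 | h1 | h1
    · refine ⟨_, (isOpen_setOf_elliptic f).mem_nhds h1, finite_empty.subset ?_⟩
      rintro y ⟨hy, hy'⟩
      exact absurd hy' (Attracting.not_elliptic h hy)
    · obtain ⟨a, ha⟩ := h1.eventually_attracting_eq h
      exact ⟨_, ha, (finite_singleton a).subset fun y hy ↦ hy.2 hy.1⟩
    · refine ⟨_, h1.eventually_not_attracting_inv h, finite_empty.subset ?_⟩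
      rintro y ⟨hy, hy'⟩
      rw [inv_inv] at hy'
      exact absurd hy hy'
  simpa using key

theorem exists_hyperbolicData (h : IsLocalSimilarityAction lam G X) (f : G) :
    ∃ N, 0 < N ∧ ∃ A R U, h.HyperbolicData (f ^ N) A R U := by
  have hU := h.isClopen_setOf_elliptic f
  obtain ⟨N₁, hN₁, h₁⟩ := exists_pow_smul_eq_of_isCompact hU.isClosed.isCompact fun x hx ↦ hx
  obtain ⟨N₂, hN₂, h₂⟩ := exists_pow_smul_eq_of_finite (h.finite_setOf_attracting f)
    fun x ⟨m, hm, hx, _⟩ ↦ ⟨m, hm, hx⟩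
  obtain ⟨N₃, hN₃, h₃⟩ := exists_pow_smul_eq_of_finite (f := f) (h.finite_setOf_attracting f⁻¹)
    fun x ⟨m, hm, hx, _⟩ ↦ ⟨m, hm, inv_pow_smul_eq_iff.1 hx⟩
  -- A common period for the elliptic, attracting and repelling points.
  set N := N₁ * N₂ * N₃ with hNdef
  have hN : 0 < N := by positivity
  have hf₁ : ∀ x, Elliptic f x → f ^ N • x = x := fun x hx ↦
    pow_smul_eq_of_dvd ⟨N₂ * N₃, by rw [hNdef]; ring⟩ (h₁ x hx)
  have hf₂ : ∀ x, h.Attracting f x → f ^ N • x = x := fun x hx ↦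
    pow_smul_eq_of_dvd ⟨N₁ * N₃, by rw [hNdef]; ring⟩ (h₂ x hx)
  have hf₃ : ∀ x, h.Attracting f⁻¹ x → f ^ N • x = x := fun x hx ↦
    pow_smul_eq_of_dvd ⟨N₁ * N₂, by rw [hNdef]; ring⟩ (h₃ x hx)
  have key : ∀ g : G, (∀ x, h.Attracting g x → g ^ N • x = x) → ∀ x, h.Basin g x →
      ∃ a, h.Attracting g a ∧ ∃ O ∈ 𝓝 x, ∀ W ∈ 𝓝 a, ∀ T : ℤ, ∃ n₁ : ℕ, ∀ n, n₁ ≤ n → ∀ y ∈ O,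
        (g ^ N) ^ n • y ∈ W ∧ T ≤ h.exponent ((g ^ N) ^ n) y := by
    rintro g hg x ⟨a, ha, O, hO, hT⟩
    refine ⟨a, ha, O, hO, fun W hW T ↦ ?_⟩
    obtain ⟨T', hT'⟩ := h.exists_closedBall_subset hW
    obtain ⟨n₁, hn⟩ := hT (max T T')
    refine ⟨n₁, fun n hn' y hy ↦ ?_⟩
    rw [← pow_mul]
    obtain ⟨h1, h2⟩ := hn (N * n) (by nlinarith) y hy
    refine ⟨hT' (max T T') (le_max_right _ _) ?_, (le_max_left _ _).trans h1⟩
    rwa [pow_smul_eq_of_dvd (dvd_mul_right N n) (hg a ha)] at h2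
  refine ⟨N, hN, {x | h.Attracting f x}, {x | h.Attracting f⁻¹ x}, {x | Elliptic f x}, ?_⟩
  exact
    { finite_attracting := h.finite_setOf_attracting f
      finite_repelling := h.finite_setOf_attracting f⁻¹
      disjoint := disjoint_left.2 fun x hx ↦ Attracting.not_inv h hx
      isClopen := hU
      smul_eq := hf₁
      smul_eq_attracting := hf₂
      smul_eq_repelling := hf₃
      attracting_notMem := fun x hx ↦ Attracting.not_elliptic h hx
      repelling_notMem := fun x hx hx' ↦ Attracting.not_elliptic h hx hx'.inv
      forward := fun x hx hx' ↦ key f hf₂ x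
        (((h.elliptic_or_basin_or_attracting_inv f x).resolve_left hx).resolve_right hx')
      backward := fun x hx hx' ↦ by
        rw [← inv_pow]
        refine key f⁻¹ (fun y hy ↦ inv_pow_smul_eq_iff.2 (hf₃ y hy)) x ?_
        refine ((h.elliptic_or_basin_or_attracting_inv f⁻¹ x).resolve_left ?_).resolve_right ?_
        · rwa [elliptic_inv_iff]
        · rwa [inv_inv] }

end IsLocalSimilarityAction

/-! ### The identity part of a product -/

namespace IsLocalSimilarityAction

variable {lam : ℝ} {G X : Type*} [Group G] [MetricSpace X] [MulAction G X]

/-- If `g` moves `a`, the orbit of `a` under `g` converges to an attracting point `a'`. When `a'`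
lies in `U`, a neighbourhood of `a` ends up in `U` for good. Otherwise the orbit eventually leaves
`U`; it is injective, so it meets the finite set `R` only finitely often. -/
theorem HyperbolicData.eventually_notMem_or_stays {h : IsLocalSimilarityAction lam G X} {f g : G}
    {A R U A' R' U' : Set X} (H : h.HyperbolicData f A R U) (H' : h.HyperbolicData g A' R' U')
    {a : X} (ha : a ∈ A) : ∀ᶠ m : ℕ in atTop,
      (g ^ m • a ∉ U ∧ g ^ m • a ∉ R) ∨ ∀ᶠ y in 𝓝 a, ∀ t, 0 < t → (g ^ m) ^ t • y ∈ U := by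
  by_cases hfix : g • a = a
  · refine .of_forall fun m ↦ .inl ?_
    rw [pow_smul_eq_of_dvd (one_dvd m) (by simpa using hfix)]
    exact ⟨H.attracting_notMem a ha, H.disjoint.notMem_of_mem_left ha⟩
  obtain ⟨a', ha', O, hO, hT⟩ := H'.forward a (fun h' ↦ hfix (H'.smul_eq a h'))
    (fun h' ↦ hfix (H'.smul_eq_repelling a h'))
  by_cases haU : a' ∈ U
  · obtain ⟨n₁, hn⟩ := hT U (H.isClopen.isOpen.mem_nhds haU) 0
    filter_upwards [eventually_ge_atTop n₁] with m hm
    right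
    filter_upwards [hO] with y hy t ht
    rw [← pow_mul]
    exact (hn _ (by nlinarith) y hy).1
  · obtain ⟨n₁, hn⟩ := hT Uᶜ (H.isClopen.compl.isOpen.mem_nhds haU) 0
    have hinj : Function.Injective fun m : ℕ ↦ g ^ m • a := by
      have key : ∀ m p : ℕ, 0 < p → g ^ m • a ≠ g ^ (m + p) • a := by
        intro m p hp heq
        rw [pow_add, mul_smul, smul_left_cancel_iff] at heq
        refine hfix ?_
        -- A periodic point whose orbit converges to `a'` equals `a'`, which `g` fixes.
        have haa' : a = a' := by
          by_contra hne
          obtain ⟨n₂, hn₂⟩ := hT {a}ᶜ (isOpen_compl_singleton.mem_nhds (Ne.symm hne)) 0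
          refine (hn₂ (p * n₂) (by nlinarith) a (mem_of_mem_nhds hO)).1 ?_
          exact pow_smul_eq_of_dvd (dvd_mul_right _ _) heq.symm
        rw [haa']
        exact H'.smul_eq_attracting a' ha'
      intro m m' heq
      rcases lt_trichotomy m m' with hlt | rfl | hlt
      · obtain ⟨p, rfl⟩ := Nat.exists_eq_add_of_lt hlt
        exact absurd heq (key m (p + 1) (by omega))
      · rfl
      · obtain ⟨p, rfl⟩ := Nat.exists_eq_add_of_lt hlt
        exact absurd heq.symm (key m' (p + 1) (by omega))
    have hfin := H.finite_repelling.preimage (f := fun m : ℕ ↦ g ^ m • a) hinj.injOn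
    have hev := hfin.eventually_cofinite_notMem
    rw [Nat.cofinite_eq_atTop] at hev
    filter_upwards [hev, eventually_ge_atTop n₁] with m hm hm'
    exact .inl ⟨(hn m hm' a (mem_of_mem_nhds hO)).1, hm⟩

variable [ContinuousConstSMul G X]

/-- If `φ` contracts `U ∪ W'` into `W`, more strongly than `ψ` can expand, and is the identity on
`U`, then a periodic orbit of `φ * ψ` with trivial exponent does not visit `W`. -/
theorem periodic_notMem (h : IsLocalSimilarityAction lam G X) {φ ψ : G} {U W W' : Set X} {B : ℤ}
    (h₁ : ∀ x ∈ U, φ • x = x) (h₂ : ∀ x ∉ U, x ∉ W' → φ • x ∈ W ∧ B + 1 ≤ h.exponent φ x)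
    (h₃ : ∀ x, -B ≤ h.exponent ψ x)
    (h₄ : ∀ x ∈ W, (ψ • x ∉ U ∧ ψ • x ∉ W') ∨ ∀ t, 0 < t → ψ ^ t • x ∈ U)
    (h₅ : ∀ x ∈ W, x ∉ U) {x : X} {N : ℕ} (hN : 0 < N) (hx : (φ * ψ) ^ N • x = x)
    (hexp : h.exponent ((φ * ψ) ^ N) x = 0) (i : ℕ) : (φ * ψ) ^ i • x ∉ W := by
  intro hi
  set k := φ * ψ with hk
  set z := k ^ i • x
  have hz : k ^ N • z = z := by
    rw [smul_smul, pow_mul_comm, mul_smul, hx]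
  have hzexp : h.exponent (k ^ N) z = 0 := by
    rw [← hexp, ← h.exponent_conj hx (k := k ^ i), pow_mul_comm, mul_inv_cancel_right]
  have key (j : ℕ) : k ^ j • z ∈ W ∧ (j : ℤ) ≤ h.exponent (k ^ j) z := by
    induction j with
    | zero => simp [h.exponent_one, hi]
    | succ j ih =>
      obtain ⟨hj, hej⟩ := ih
      rw [pow_succ', h.exponent_mul, mul_smul]
      set y := k ^ j • z
      -- In the first case one more turn lands in `W` and gains exponent at least one. In the
      -- second, the orbit remains in `U`, where `φ` is trivial, so it could not return to `y ∉ U`.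
      rcases h₄ y hj with ⟨hy, hy'⟩ | hy
      · obtain ⟨h6, h7⟩ := h₂ _ hy hy'
        have h8 := h₃ y
        refine ⟨by rwa [hk, mul_smul], ?_⟩
        have h9 : h.exponent k y = h.exponent φ (ψ • y) + h.exponent ψ y := by
          rw [hk, h.exponent_mul]
        push_cast
        omega
      · have hpow : ∀ t, k ^ t • y = ψ ^ t • y := by
          intro t
          induction t with
          | zero => simp
          | succ t iht =>
            rw [pow_succ', mul_smul, iht, hk, mul_smul, ← mul_smul ψ, ← pow_succ']
            exact h₁ _ (hy _ (by omega))
        have h6 := hy N hN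
        rw [← hpow, smul_smul, pow_mul_comm, mul_smul, hz] at h6
        exact absurd h6 (h₅ y hj)
  have := (key N).2
  omega

omit [ContinuousConstSMul G X] in
theorem exists_abs_exponent_le [CompactSpace X] (h : IsLocalSimilarityAction lam G X) (g : G) :
    ∃ B : ℤ, ∀ x, |h.exponent g x| ≤ B := by
  have key : ∃ B : ℤ, ∀ x ∈ (univ : Set X), |h.exponent g x| ≤ B := by
    refine isCompact_univ.induction_on (p := fun s ↦ ∃ B : ℤ, ∀ x ∈ s, |h.exponent g x| ≤ B)
      ⟨0, by simp⟩ ?_ ?_ ?_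
    · rintro s t hst ⟨B, hB⟩
      exact ⟨B, fun x hx ↦ hB x (hst hx)⟩
    · rintro s t ⟨B, hB⟩ ⟨B', hB'⟩
      exact ⟨max B B', fun x hx ↦ hx.elim (fun hx ↦ (hB x hx).trans (le_max_left _ _))
        fun hx ↦ (hB' x hx).trans (le_max_right _ _)⟩
    · intro x _
      exact ⟨_, mem_nhdsWithin_of_mem_nhds (h.eventually_exponent_eq g x), |h.exponent g x|,
        fun y hy ↦ by rw [show h.exponent g y = h.exponent g x from hy]⟩
  simpa using key

/-- The identity part of a suitable product of powers of `f` and `g` lies in the identity parts of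
`f` and of `g`. -/
theorem HyperbolicData.exists_mul [CompactSpace X] {h : IsLocalSimilarityAction lam G X} {f g : G}
    {A R U A' R' U' : Set X} (H : h.HyperbolicData f A R U) (H' : h.HyperbolicData g A' R' U') :
    ∃ n m : ℕ, ∀ N, 0 < N → ∀ x, (f ^ n * g ^ m) ^ N • x = x →
      h.exponent ((f ^ n * g ^ m) ^ N) x = 0 → x ∈ U ∩ U' := by
  obtain ⟨m, ⟨hmA, hmR⟩, hm0⟩ : ∃ m : ℕ, ((∀ a ∈ A, (g ^ m • a ∉ U ∧ g ^ m • a ∉ R) ∨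
        ∀ᶠ y in 𝓝 a, ∀ t, 0 < t → (g ^ m) ^ t • y ∈ U) ∧
      (∀ a ∈ R, (g⁻¹ ^ m • a ∉ U ∧ g⁻¹ ^ m • a ∉ A) ∨
        ∀ᶠ y in 𝓝 a, ∀ t, 0 < t → (g⁻¹ ^ m) ^ t • y ∈ U)) ∧ 0 < m :=
    (((eventually_all_finite H.finite_attracting).2 fun a ha ↦
      H.eventually_notMem_or_stays H' ha).and
    ((eventually_all_finite H.finite_repelling).2 fun a ha ↦
      H.inv.eventually_notMem_or_stays H'.inv ha) |>.and (eventually_gt_atTop 0)).exists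
  obtain ⟨ψ, hψ⟩ : ∃ ψ, ψ = g ^ m := ⟨_, rfl⟩
  rw [inv_pow] at hmR
  rw [← hψ] at hmA hmR
  have hsep : ∀ (ψ : G) {A R : Set X}, A.Finite → R.Finite → (∀ a ∈ R, a ∉ U) →
      (∀ a ∈ A, (ψ • a ∉ U ∧ ψ • a ∉ R) ∨ ∀ᶠ y in 𝓝 a, ∀ t, 0 < t → ψ ^ t • y ∈ U) →
      ∃ O O' : Set X, IsOpen O ∧ IsOpen O' ∧ (∀ a ∈ A, ψ • a ∈ O) ∧ R ⊆ O' ∧ Disjoint O O' := by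
    intro ψ A R hA hR hRU hmA
    obtain ⟨O, O', h1, h2, h3, h4, h5⟩ := SeparatedNhds.of_isCompact_isCompact
      (hA.image (ψ • ·)).isCompact hR.isCompact (by
        rw [disjoint_left]
        rintro _ ⟨a, ha, rfl⟩ hR
        rcases hmA a ha with h1 | h1
        · exact h1.2 hR
        · have := h1.self_of_nhds 1 one_pos
          rw [pow_one] at this
          exact hRU _ hR this)
    exact ⟨O, O', h1, h2, fun a ha ↦ h3 (mem_image_of_mem _ ha), h4, h5⟩
  have hnhds : ∀ (ψ : G) {A R O : Set X}, (∀ a ∈ A, a ∉ U) → IsOpen O → (∀ a ∈ A, ψ • a ∈ O) →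
      (∀ a ∈ A, (ψ • a ∉ U ∧ ψ • a ∉ R) ∨ ∀ᶠ y in 𝓝 a, ∀ t, 0 < t → ψ ^ t • y ∈ U) →
      A ⊆ interior {y | y ∉ U ∧
        ((ψ • y ∉ U ∧ ψ • y ∈ O) ∨ ∀ t, 0 < t → ψ ^ t • y ∈ U)} := by
    intro ψ A R O hAU hO hψO hmA a ha
    rw [mem_interior_iff_mem_nhds]
    have hUc := H.isClopen.compl.isOpen
    have h1 : ∀ᶠ y in 𝓝 a, y ∉ U := hUc.mem_nhds (hAU a ha)
    rcases hmA a ha with h2 | h2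
    · have hc : Tendsto (fun y ↦ ψ • y) (𝓝 a) (𝓝 (ψ • a)) := (continuous_const_smul _).continuousAt
      filter_upwards [h1, hc.eventually (hUc.mem_nhds h2.1), hc.eventually (hO.mem_nhds (hψO a ha))]
        with y hy hy' hy''
      exact ⟨hy, .inl ⟨hy', hy''⟩⟩
    · filter_upwards [h1, h2] with y hy hy'
      exact ⟨hy, .inr hy'⟩
  obtain ⟨O₁, O₂, hO₁, hO₂, hA₁, hR₂, hdisj⟩ := hsep ψ H.finite_attracting H.finite_repelling
    H.repelling_notMem hmA
  obtain ⟨O₃, O₄, hO₃, hO₄, hR₃, hA₄, hdisj'⟩ := hsep ψ⁻¹ H.finite_repelling H.finite_attracting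
    H.attracting_notMem hmR
  -- `W` surrounds `A` and `W'` surrounds `R`. Since `W'` lies in `O₂`, which is disjoint from `O₁`,
  -- each point of `W` is moved by `ψ` off `U ∪ W'` or stays in `U` under all positive powers of
  -- `ψ`. The symmetric property holds for `W'` and `ψ⁻¹`.
  set W := interior {y | y ∉ U ∧
    ((ψ • y ∉ U ∧ ψ • y ∈ O₁) ∨ ∀ t, 0 < t → ψ ^ t • y ∈ U)} ∩ O₄ with hW
  set W' := interior {y | y ∉ U ∧
    ((ψ⁻¹ • y ∉ U ∧ ψ⁻¹ • y ∈ O₃) ∨ ∀ t, 0 < t → ψ⁻¹ ^ t • y ∈ U)} ∩ O₂ with hW'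
  have hWo : IsOpen W := isOpen_interior.inter hO₄
  have hW'o : IsOpen W' := isOpen_interior.inter hO₂
  have hAW : A ⊆ W := subset_inter (hnhds ψ H.attracting_notMem hO₁ hA₁ hmA) hA₄
  have hRW' : R ⊆ W' := subset_inter (hnhds ψ⁻¹ H.repelling_notMem hO₃ hR₃ hmR) hR₂
  obtain ⟨B, hB⟩ := h.exists_abs_exponent_le ψ
  -- The margin `B + 1` lets the contraction of `f ^ n` beat the largest possible expansion of `ψ`
  -- by one.
  obtain ⟨n₁, hn₁⟩ := H.uniform hWo hAW hW'o hRW' (B + 1)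
  obtain ⟨n₂, hn₂⟩ := H.inv.uniform hW'o hRW' hWo hAW (B + 1)
  set n := max n₁ n₂
  refine ⟨n, m, fun N hN x hx hexp ↦ ?_⟩
  rw [← hψ] at hx hexp
  obtain ⟨φ, hφ⟩ : ∃ φ, φ = f ^ n := ⟨_, rfl⟩
  rw [← hφ] at hx hexp
  have hφU : ∀ y ∈ U, φ • y = y := fun y hy ↦ by
    rw [hφ]
    exact pow_smul_eq_of_dvd (one_dvd n) (by simpa using H.smul_eq y hy)
  have hφ₁ := hn₁ n (le_max_left _ _)
  have hφ₂ := hn₂ n (le_max_right _ _)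
  rw [inv_pow] at hφ₂
  rw [← hφ] at hφ₁ hφ₂
  have hnot := h.periodic_notMem hφU hφ₁ (fun y ↦ (abs_le.1 (hB y)).1)
    (fun y hy ↦ (interior_subset hy.1).2.imp_left fun hy' ↦
      ⟨hy'.1, fun hy'' ↦ hdisj.notMem_of_mem_left hy'.2 hy''.2⟩)
    (fun y hy ↦ (interior_subset hy.1).1) hN hx hexp
  have hconj (i : ℕ) : (φ⁻¹ * ψ⁻¹) ^ i = ψ * ((φ * ψ) ^ i)⁻¹ * ψ⁻¹ := by
    rw [← inv_pow, ← conj_pow]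
    congr 1
    group
  -- The same argument for the inverses: `φ⁻¹ * ψ⁻¹` is the conjugate by `ψ` of the inverse of `φ *
  -- ψ`, hence the base point `ψ • x`.
  have hnot' := h.periodic_notMem (φ := φ⁻¹) (ψ := ψ⁻¹) (x := ψ • x) (N := N)
    (fun y hy ↦ inv_smul_eq_iff.2 (hφU y hy).symm) hφ₂
    (fun y ↦ by rw [h.exponent_inv']; exact neg_le_neg (abs_le.1 (hB _)).2)
    (fun y hy ↦ (interior_subset hy.1).2.imp_left fun hy' ↦
      ⟨hy'.1, fun hy'' ↦ hdisj'.notMem_of_mem_left hy'.2 hy''.2⟩)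
    (fun y hy ↦ (interior_subset hy.1).1) hN
    (by rw [hconj, smul_smul, inv_mul_cancel_right, mul_smul, smul_left_cancel_iff,
          inv_smul_eq_iff, hx])
    (by
      have h1 := h.exponent_inv ((φ * ψ) ^ N) x
      rw [hx, hexp, neg_zero] at h1
      rw [hconj, h.exponent_conj (inv_smul_eq_iff.2 hx.symm), h1])
  -- Outside `U`, and outside `W'` by the inverse argument, `φ` would push the orbit into `W`. So
  -- `φ` only ever acts where it is the identity, and the orbit is one of `ψ` alone.
  have hmem (i : ℕ) : ψ • (φ * ψ) ^ i • x ∈ U := by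
    by_contra hU
    have h1 : ψ • (φ * ψ) ^ i • x ∉ W' := by
      have h1 := hnot' (N * i - i)
      rw [hconj, smul_smul, inv_mul_cancel_right, mul_smul] at h1
      have h2 : ((φ * ψ) ^ (N * i - i))⁻¹ • x = (φ * ψ) ^ i • x := by
        rw [inv_smul_eq_iff, smul_smul, ← pow_add, Nat.sub_add_cancel (by nlinarith),
          pow_smul_eq_of_dvd (dvd_mul_right N i) hx]
      rwa [h2] at h1
    refine hnot (i + 1) ?_
    rw [pow_succ', mul_smul, mul_smul]
    exact (hφ₁ _ hU h1).1
  have horb (i : ℕ) : (φ * ψ) ^ i • x = ψ ^ i • x ∧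
      h.exponent ((φ * ψ) ^ i) x = h.exponent (ψ ^ i) x := by
    induction i with
    | zero => simp
    | succ i ih =>
      have h1 : h.exponent φ (ψ • (φ * ψ) ^ i • x) = 0 := by
        rw [h.exponent_congr (g' := 1), h.exponent_one]
        filter_upwards [H.isClopen.isOpen.mem_nhds (hmem i)] with y hy
        rw [hφU y hy, one_smul]
      constructor
      · rw [pow_succ', mul_smul, mul_smul, hφU _ (hmem i), ih.1, smul_smul, pow_succ']
      · rw [pow_succ', h.exponent_mul, h.exponent_mul, h1, ih.1, ih.2, pow_succ', h.exponent_mul,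
          zero_add]
  constructor
  · have h1 := hmem (N - 1)
    rw [(horb _).1, smul_smul, ← pow_succ', Nat.sub_add_cancel hN, ← (horb _).1, hx] at h1
    exact h1
  · rw [(horb N).2, hψ, ← pow_mul] at hexp
    rw [(horb N).1, hψ, ← pow_mul] at hx
    exact H'.mem_of_exponent_eq_zero (by positivity) hx hexp

end IsLocalSimilarityAction

/-! ### Infinite orbits and minimal sets -/

section Action

variable {G X : Type*} [Group G] [MulAction G X]

/-- In a group that acts with infinite orbits on the points of a finite set, some element moves this
set off itself. -/
theorem exists_smul_notMem_of_infinite_orbit {P : Set X} (hP : P.Finite)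
    (horb : ∀ x ∈ P, (MulAction.orbit G x).Infinite) : ∃ g : G, ∀ x ∈ P, g • x ∉ P := by
  classical
  by_contra! hcon
  have hex : ∀ p : X × X, ∃ c : G, ∀ g : G, g • p.1 = p.2 → c • p.1 = p.2 := by
    intro p
    by_cases hp : ∃ g : G, g • p.1 = p.2
    · exact ⟨hp.choose, fun _ _ ↦ hp.choose_spec⟩
    · exact ⟨1, fun g hg ↦ absurd ⟨g, hg⟩ hp⟩
  choose c hc using hex
  -- Neumann's lemma: if every element sent some point of `P` into `P`, finitely many cosets of
  -- stabilizers would cover `G`. One stabilizer would then have finite index, contradicting the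
  -- infinite orbit.
  obtain ⟨p, hp, hfin⟩ := Subgroup.exists_finiteIndex_of_leftCoset_cover
    (s := hP.toFinset ×ˢ hP.toFinset) (H := fun p ↦ MulAction.stabilizer G p.1) (g := c) (by
      refine eq_univ_of_forall fun g ↦ ?_
      obtain ⟨x, hx, hgx⟩ := hcon g
      refine mem_iUnion₂.2 ⟨(x, g • x), by simp [hx, hgx], ?_⟩
      rw [mem_smul_set_iff_inv_smul_mem, SetLike.mem_coe, MulAction.mem_stabilizer_iff, smul_eq_mul,
        mul_smul, inv_smul_eq_iff]
      exact (hc (x, g • x) g rfl).symm)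
  simp only [Finset.mem_product, Finite.mem_toFinset] at hp
  have : Finite (G ⧸ MulAction.stabilizer G p.1) := inferInstance
  have := Finite.of_equiv _ (MulAction.orbitEquivQuotientStabilizer G p.1).symm
  exact horb p.1 hp.1 (toFinite _)

variable [TopologicalSpace X] [CompactSpace X] [ContinuousConstSMul G X]

variable (G X) in
theorem exists_isClosed_minimal [Nonempty X] : ∃ M : Set X, IsClosed M ∧ M.Nonempty ∧
    (∀ g : G, ∀ x ∈ M, g • x ∈ M) ∧
    ∀ x ∈ M, ∀ O : Set X, IsOpen O → (O ∩ M).Nonempty → ∃ g : G, g • x ∈ O := by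
  obtain ⟨M, ⟨hMc, hMne, hMinv⟩, hmin⟩ := zorn_superset
    {s : Set X | IsClosed s ∧ s.Nonempty ∧ ∀ g : G, ∀ x ∈ s, g • x ∈ s} (by
      intro c hc hchain
      rcases c.eq_empty_or_nonempty with rfl | hne
      · exact ⟨univ, ⟨isClosed_univ, univ_nonempty, by simp⟩, by simp⟩
      · refine ⟨⋂₀ c, ⟨isClosed_sInter fun s hs ↦ (hc hs).1, ?_, fun g x hx s hs ↦
          (hc hs).2.2 g x (hx s hs)⟩, fun s hs ↦ sInter_subset_of_mem hs⟩
        have := hne.to_subtype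
        refine IsCompact.nonempty_sInter_of_directed_nonempty_isCompact_isClosed ?_
          (fun s hs ↦ (hc hs).2.1) (fun s hs ↦ (hc hs).1.isCompact) fun s hs ↦ (hc hs).1
        intro s hs t ht
        rcases hchain.total hs ht with hst | hst
        · exact ⟨s, hs, subset_rfl, hst⟩
        · exact ⟨t, ht, hst, subset_rfl⟩)
  refine ⟨M, hMc, hMne, hMinv, fun x hx O hO ⟨y, hyO, hyM⟩ ↦ ?_⟩
  by_contra! hcon
  -- The points of `M` whose orbit avoids `O` form a closed invariant set; it contains `x`, so by
  -- minimality it is all of `M`.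
  have hmem : y ∈ M ∩ ⋂ g : G, (g • ·) ⁻¹' Oᶜ := by
    refine hmin ⟨hMc.inter (isClosed_iInter fun g ↦
      hO.isClosed_compl.preimage (continuous_const_smul g)), ⟨x, hx, mem_iInter.2 hcon⟩, ?_⟩
      inter_subset_left hyM
    rintro g z ⟨hz, hz'⟩
    refine ⟨hMinv g z hz, mem_iInter.2 fun g' ↦ ?_⟩
    have := mem_iInter.1 hz' (g' * g)
    simpa [mul_smul] using this
  exact mem_iInter.1 hmem.2 1 (by simpa using hyO)

end Action

/-! ### Invariant measures as weak limits -/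

section Measure

variable {G X : Type*} [Group G] [MulAction G X] [MetricSpace X] [CompactSpace X]
  [ContinuousConstSMul G X] [MeasurableSpace X] [BorelSpace X]

/-- If there are arbitrarily fine finite families of sets that are permuted by the group, then there
is an invariant probability measure. -/
theorem exists_invariant_measure_of_finite_families
    (hfam : ∀ ε > 0, ∃ P : Set (Set X), P.Finite ∧ P.Nonempty ∧ (∀ s ∈ P, s.Nonempty) ∧
      (∀ s ∈ P, ∀ x ∈ s, ∀ y ∈ s, dist x y < ε) ∧ ∀ g : G, ∀ s ∈ P, (g • ·) '' s ∈ P) :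
    ∃ μ : ProbabilityMeasure X, ∀ g : G, (μ : Measure X).map (g • ·) = μ := by
  classical
  choose P hPfin hPne hne hdist hinv using fun n : ℕ ↦ hfam (1 / (n + 1)) Nat.one_div_pos_of_nat
  obtain ⟨s₀, hs₀⟩ := hPne 0
  obtain ⟨x₀, -⟩ := hne 0 s₀ hs₀
  have : Nonempty X := ⟨x₀⟩
  obtain ⟨c, hc⟩ : ∃ c : Set X → X, ∀ s, s.Nonempty → c s ∈ s :=
    ⟨fun s ↦ if hs : s.Nonempty then hs.some else x₀, fun s hs ↦ by simp [hs, hs.some_mem]⟩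
  set F : ℕ → Finset (Set X) := fun n ↦ (hPfin n).toFinset with hF
  have hFmem (n : ℕ) (s : Set X) : s ∈ F n ↔ s ∈ P n := by simp [hF]
  have hcard (n : ℕ) : (F n).card ≠ 0 := by
    obtain ⟨s, hs⟩ := hPne n
    exact Finset.card_ne_zero_of_mem ((hFmem n s).2 hs)
  set ν : ℕ → Measure X := fun n ↦ ((F n).card : ENNReal)⁻¹ • ∑ s ∈ F n, Measure.dirac (c s) with hν
  have hprob (n : ℕ) : IsProbabilityMeasure (ν n) := by
    constructor
    simp only [hν, Measure.smul_apply, Measure.finsetSum_apply, measure_univ, Finset.sum_const,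
      smul_eq_mul, nsmul_eq_mul, mul_one]
    exact ENNReal.inv_mul_cancel (by simpa using hcard n) (ENNReal.natCast_ne_top _)
  have hint (n : ℕ) (φ : BoundedContinuousFunction X ℝ) :
      ∫ x, φ x ∂(ν n) = ((F n).card : ℝ)⁻¹ * ∑ s ∈ F n, φ (c s) := by
    rw [hν, integral_smul_measure, integral_finsetSum_measure fun s _ ↦ integrable_dirac (by simp)]
    simp
  set ν' : ℕ → ProbabilityMeasure X := fun n ↦ ⟨ν n, hprob n⟩ with hν'
  obtain ⟨μ, -, hμ⟩ := isCompact_univ.ultrafilter_le_nhds ((hyperfilter ℕ).map ν') (by simp)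
  refine ⟨μ, fun g ↦ ?_⟩
  have hg : Continuous fun x : X ↦ g • x := continuous_const_smul g
  have hlim : Tendsto ν' (hyperfilter ℕ) (𝓝 μ) := hμ
  have hlim₁ := ProbabilityMeasure.tendsto_map_of_tendsto_of_continuous ν' μ hlim hg
  -- Since `g` permutes the sets of a family, pushing `ν n` forward replaces the chosen point of
  -- each set by another point of the same set. The sets shrink, so uniform continuity gives both
  -- sequences the same limit.
  have hlim₂ : Tendsto (fun n ↦ (ν' n).map hg.aemeasurable) (hyperfilter ℕ) (𝓝 μ) := by
    rw [ProbabilityMeasure.tendsto_iff_forall_integral_tendsto] at hlim ⊢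
    intro φ
    refine (hlim φ).congr_dist ?_
    have hφ := CompactSpace.uniformContinuous_of_continuous φ.continuous
    rw [Metric.tendsto_nhds]
    intro ε hε
    obtain ⟨δ, hδ, hφδ⟩ := Metric.uniformContinuous_iff.1 hφ (ε / 2) (half_pos hε)
    obtain ⟨n₀, hn₀⟩ := exists_nat_one_div_lt hδ
    have hev : ∀ᶠ n in (hyperfilter ℕ : Filter ℕ), n₀ ≤ n := by
      refine Nat.hyperfilter_le_atTop ?_
      exact eventually_ge_atTop n₀
    filter_upwards [hev] with n hn
    have h1 : ∫ x, φ x ∂((ν' n).map hg.aemeasurable : Measure X) =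
        ((F n).card : ℝ)⁻¹ * ∑ s ∈ F n, φ (g • c s) := by
      rw [ProbabilityMeasure.toMeasure_map, integral_map hg.aemeasurable
        φ.continuous.aestronglyMeasurable]
      exact hint n (φ.compContinuous ⟨_, hg⟩)
    have h2 : ∑ s ∈ F n, φ (c s) = ∑ s ∈ F n, φ (c ((g • ·) '' s)) := by
      refine (Finset.sum_nbij' (fun s ↦ (g • ·) '' s) (fun s ↦ (g⁻¹ • ·) '' s) ?_ ?_ ?_ ?_ ?_).symm
      · exact fun s hs ↦ (hFmem n _).2 (hinv n g s ((hFmem n s).1 hs))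
      · exact fun s hs ↦ (hFmem n _).2 (hinv n g⁻¹ s ((hFmem n s).1 hs))
      · intro s _
        rw [← image_comp]
        simp
      · intro s _
        rw [← image_comp]
        simp
      · simp
    rw [h1, show ∫ x, φ x ∂(ν' n : Measure X) = _ from hint n φ, h2, dist_zero_right,
      Real.norm_eq_abs, abs_of_nonneg dist_nonneg, Real.dist_eq, ← mul_sub, ← Finset.sum_sub_distrib,
      abs_mul, abs_of_nonneg (by positivity)]
    have h3 : |∑ s ∈ F n, (φ (c ((g • ·) '' s)) - φ (g • c s))| ≤ (F n).card * (ε / 2) := by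
      refine (Finset.abs_sum_le_sum_abs _ _).trans ?_
      rw [← nsmul_eq_mul]
      refine Finset.sum_le_card_nsmul _ _ _ fun s hs ↦ ?_
      rw [hFmem] at hs
      have h4 := hdist n _ (hinv n g s hs) _ (hc _ ((hne n s hs).image _)) _
        (mem_image_of_mem _ (hc s (hne n s hs)))
      have h5 : (1 : ℝ) / (n + 1) ≤ 1 / (n₀ + 1) := by gcongr
      exact (hφδ (h4.trans (h5.trans_lt hn₀))).le
    have hpos : (0 : ℝ) < (F n).card := by exact_mod_cast Nat.pos_of_ne_zero (hcard n)
    calc _ ≤ ((F n).card : ℝ)⁻¹ * ((F n).card * (ε / 2)) := by gcongr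
      _ = ε / 2 := by field_simp
      _ < ε := half_lt_self hε
  have := tendsto_nhds_unique hlim₁ hlim₂
  have h6 := congrArg (fun ρ : ProbabilityMeasure X ↦ (ρ : Measure X)) this
  simpa using h6

omit [CompactSpace X] [ContinuousConstSMul G X] [BorelSpace X] [MeasurableSpace X] in
theorem exists_finite_families_of_finite_orbit {x : X} (hx : (MulAction.orbit G x).Finite) :
    ∀ ε > 0, ∃ P : Set (Set X), P.Finite ∧ P.Nonempty ∧ (∀ s ∈ P, s.Nonempty) ∧
      (∀ s ∈ P, ∀ x ∈ s, ∀ y ∈ s, dist x y < ε) ∧ ∀ g : G, ∀ s ∈ P, (g • ·) '' s ∈ P := by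
  intro ε hε
  refine ⟨(fun y ↦ {y}) '' MulAction.orbit G x, hx.image _, (MulAction.nonempty_orbit x).image _,
    ?_, ?_, ?_⟩
  · rintro _ ⟨y, -, rfl⟩
    exact singleton_nonempty y
  · rintro _ ⟨y, -, rfl⟩ z hz w hw
    rw [mem_singleton_iff.1 hz, mem_singleton_iff.1 hw, dist_self]
    exact hε
  · rintro g _ ⟨y, hy, rfl⟩
    exact ⟨g • y, MulAction.mem_orbit_of_mem_orbit g hy, by simp⟩

/-- If every finitely generated subgroup has an invariant probability measure, then so does the
group. -/
theorem exists_invariant_measure_of_fg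
    (hfg : ∀ S : Finset G, ∃ μ : ProbabilityMeasure X,
      ∀ g ∈ Subgroup.closure (S : Set G), (μ : Measure X).map (g • ·) = μ) :
    ∃ μ : ProbabilityMeasure X, ∀ g : G, (μ : Measure X).map (g • ·) = μ := by
  classical
  have hg (g : G) : Continuous fun x : X ↦ g • x := continuous_const_smul g
  set I : Finset G → Set (ProbabilityMeasure X) := fun S ↦
    {μ | ∀ g ∈ S, μ.map (hg g).aemeasurable = μ} with hI
  have hclosed (S : Finset G) : IsClosed (I S) := by
    have : I S = ⋂ g ∈ S, {μ | μ.map (hg g).aemeasurable = μ} := by ext; simp [hI]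
    rw [this]
    exact isClosed_biInter fun g _ ↦
      isClosed_eq (ProbabilityMeasure.continuous_map (hg g)) continuous_id
  obtain ⟨μ, hμ⟩ := IsCompact.nonempty_iInter_of_directed_nonempty_isCompact_isClosed I
    (fun S T ↦ ⟨S ∪ T, fun μ hμ g hgS ↦ hμ g (Finset.mem_union_left _ hgS),
      fun μ hμ g hgT ↦ hμ g (Finset.mem_union_right _ hgT)⟩)
    (fun S ↦ by
      obtain ⟨μ, hμ⟩ := hfg S
      refine ⟨μ, fun g hgS ↦ Subtype.ext ?_⟩
      exact hμ g (Subgroup.subset_closure hgS))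
    (fun S ↦ (hclosed S).isCompact) hclosed
  refine ⟨μ, fun g ↦ ?_⟩
  have := mem_iInter.1 hμ {g} g (Finset.mem_singleton_self g)
  exact congrArg (fun ρ : ProbabilityMeasure X ↦ (ρ : Measure X)) this

end Measure

/-! ### The alternative for local similarity actions -/

namespace IsLocalSimilarityAction

variable {lam : ℝ} {G X : Type*} [Group G] [MetricSpace X] [MulAction G X]
  [ContinuousConstSMul G X] [CompactSpace X] [IsUltrametricDist X]

omit [CompactSpace X] [IsUltrametricDist X] in
theorem sim_closure (h : IsLocalSimilarityAction lam G X) {S : Set G}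
    (hS : Subgroup.closure S = ⊤) {n₀ n B : ℤ}
    (hlevel : ∀ s ∈ S, ∀ m, n₀ ≤ m → ∀ y, Sim lam s y m (h.exponent s y))
    (hlevel' : ∀ s ∈ S, ∀ m, n₀ ≤ m → ∀ y, Sim lam s⁻¹ y m (h.exponent s⁻¹ y))
    (hn : n₀ + B ≤ n) {x : X} (hB : ∀ g : G, -B ≤ h.exponent g x) (g : G) :
    Sim lam g x n (h.exponent g x) := by
  have hg : g ∈ Subgroup.closure S := hS ▸ Subgroup.mem_top g
  induction hg using Subgroup.closure_induction_left with
  | one => rw [h.exponent_one]; exact Sim.one x n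
  | mul_left s hs y hy ih =>
    rw [h.exponent_mul]
    exact ih.mul h (hlevel s hs _ (by have := hB y; omega) _)
  | inv_mul_cancel s hs y hy ih =>
    rw [h.exponent_mul]
    exact ih.mul h (hlevel' s hs _ (by have := hB y; omega) _)

omit [CompactSpace X] [IsUltrametricDist X] in
/-- Every `g` has a tail `w`, as a word in the generators, that is a similarity on a ball of a fixed
level and contracts it at least as much as `g` does at the given point. -/
theorem exists_sim_of_closure (h : IsLocalSimilarityAction lam G X) {S : Set G}
    (hS : Subgroup.closure S = ⊤) {n₀ : ℤ}
    (hlevel : ∀ s ∈ S, ∀ m, n₀ ≤ m → ∀ y, Sim lam s y m (h.exponent s y))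
    (hlevel' : ∀ s ∈ S, ∀ m, n₀ ≤ m → ∀ y, Sim lam s⁻¹ y m (h.exponent s⁻¹ y)) (x : X) (g : G) :
    ∃ w u : G, g = w * u ∧ ∃ k, Sim lam w (u • x) n₀ k ∧ 0 ≤ k ∧ h.exponent g x ≤ k := by
  have step : ∀ s : G, (∀ m, n₀ ≤ m → ∀ y, Sim lam s y m (h.exponent s y)) → ∀ g : G,
      (∃ w u : G, g = w * u ∧ ∃ k, Sim lam w (u • x) n₀ k ∧ 0 ≤ k ∧ h.exponent g x ≤ k) →
      ∃ w u : G, s * g = w * u ∧ ∃ k, Sim lam w (u • x) n₀ k ∧ 0 ≤ k ∧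
        h.exponent (s * g) x ≤ k := by
    rintro s hs g ⟨w, u, rfl, k, hsim, hk, hle⟩
    have hsim' := hsim.mul h (hs (n₀ + k) (by omega) _)
    rw [h.exponent_mul, mul_smul]
    -- When the accumulated exponent becomes negative, the tail restarts empty. Forgetting this
    -- expanding part can only increase the recorded exponent.
    by_cases h0 : 0 ≤ h.exponent s (w • u • x) + k
    · exact ⟨s * w, u, by rw [mul_assoc], _, hsim', h0, by omega⟩
    · refine ⟨1, s * (w * u), by simp, 0, Sim.one _ _, le_rfl, by omega⟩
  have hg : g ∈ Subgroup.closure S := hS ▸ Subgroup.mem_top g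
  induction hg using Subgroup.closure_induction_left with
  | one => exact ⟨1, 1, by simp, 0, Sim.one _ _, le_rfl, (h.exponent_one x).le⟩
  | mul_left s hs y hy ih => exact step s (hlevel s hs) y ih
  | inv_mul_cancel s hs y hy ih => exact step s⁻¹ (hlevel' s hs) y ih

/-- Applied to inverses, the upper bound also gives a lower one, so from a small enough scale on the
whole group acts by similarities on balls centred in `M`. The images of such balls have finitely
many possible radii, hence are finitely many. -/
theorem exists_finite_families_of_bounded (h : IsLocalSimilarityAction lam G X) {S : Finset G}
    (hS : Subgroup.closure (S : Set G) = ⊤) {M : Set X} (hM : M.Nonempty)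
    (hinv : ∀ g : G, ∀ x ∈ M, g • x ∈ M) {B : ℤ}
    (hB : ∀ g : G, ∀ x ∈ M, h.exponent g x ≤ B) :
    ∀ ε > 0, ∃ P : Set (Set X), P.Finite ∧ P.Nonempty ∧ (∀ s ∈ P, s.Nonempty) ∧
      (∀ s ∈ P, ∀ x ∈ s, ∀ y ∈ s, dist x y < ε) ∧ ∀ g : G, ∀ s ∈ P, (g • ·) '' s ∈ P := by
  classical
  intro ε hε
  obtain ⟨n₁, hn₁⟩ := h.exists_sim_level_finset S
  obtain ⟨n₂, hn₂⟩ := h.exists_sim_level_finset (S.image (·⁻¹))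
  obtain ⟨T, hT⟩ := h.exists_zpow_lt hε
  set n₀ := max n₁ n₂
  set L := max (n₀ + B) (T + B) with hL
  have hL₁ : n₀ + B ≤ L := le_max_left _ _
  have hL₂ : T + B ≤ L := le_max_right _ _
  have hBneg (g : G) (x : X) (hx : x ∈ M) : -B ≤ h.exponent g x := by
    have h1 := hB g⁻¹ (g • x) (hinv g x hx)
    rw [h.exponent_inv] at h1
    omega
  have hsim (g : G) (x : X) (hx : x ∈ M) : Sim lam g x L (h.exponent g x) :=
    h.sim_closure hS (fun s hs m hm ↦ hn₁ s hs m ((le_max_left _ _).trans hm))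
      (fun s hs m hm ↦ hn₂ s⁻¹ (Finset.mem_image_of_mem _ hs) m ((le_max_right _ _).trans hm))
      hL₁ (fun g ↦ hBneg g x hx) g
  refine ⟨{s | ∃ g : G, ∃ x ∈ M, s = (g • ·) '' closedBall x (lam ^ L)}, ?_, ?_, ?_, ?_, ?_⟩
  · have hfin : (⋃ j ∈ Finset.Icc (L - B) (L + B),
        range fun x : X ↦ closedBall x (lam ^ j)).Finite := by
      refine (Finset.finite_toSet _).biUnion fun j _ ↦ ?_
      obtain ⟨t, ht⟩ := h.exists_finset_closedBall j
      refine (t.finite_toSet.image fun x ↦ closedBall x (lam ^ j)).subset ?_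
      rintro _ ⟨x, rfl⟩
      obtain ⟨y, hy, hxy⟩ := ht x
      exact ⟨y, hy, hxy.symm⟩
    refine hfin.subset ?_
    rintro _ ⟨g, x, hx, rfl⟩
    rw [(hsim g x hx).2]
    have h1 := hB g x hx
    have h2 := hBneg g x hx
    exact mem_iUnion₂.2 ⟨L + h.exponent g x, Finset.mem_Icc.2 ⟨by omega, by omega⟩, g • x, rfl⟩
  · obtain ⟨x, hx⟩ := hM
    exact ⟨_, 1, x, hx, rfl⟩
  · rintro _ ⟨g, x, hx, rfl⟩
    exact ⟨_, mem_image_of_mem _ (mem_closedBall_self (zpow_pos h.pos _).le)⟩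
  · rintro _ ⟨g, x, hx, rfl⟩ y hy z hz
    rw [(hsim g x hx).2] at hy hz
    refine lt_of_le_of_lt ?_ (hT (L + h.exponent g x) (by have := hBneg g x hx; omega))
    rwa [IsUltrametricDist.closedBall_eq_of_mem hz] at hy
  · rintro g _ ⟨g', x, hx, rfl⟩
    refine ⟨g * g', x, hx, ?_⟩
    rw [← image_comp]
    simp [mul_smul]

/-- Points of a minimal set are carried into a given open set with uniform control. -/
theorem exists_uniform_return (h : IsLocalSimilarityAction lam G X) {M : Set X}
    (hM : IsClosed M)
    (hmin : ∀ x ∈ M, ∀ O : Set X, IsOpen O → (O ∩ M).Nonempty → ∃ g : G, g • x ∈ O)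
    {O : Set X} (hO : IsOpen O) (hOM : (O ∩ M).Nonempty) :
    ∃ n₁ : ℤ, ∀ y ∈ M, ∀ n, n₁ ≤ n → ∃ γ : G, ∃ k, Sim lam γ y n k ∧ γ • y ∈ O ∧ -n₁ ≤ k := by
  refine hM.isCompact.induction_on (p := fun s ↦ ∃ n₁ : ℤ, ∀ y ∈ s, ∀ n, n₁ ≤ n →
    ∃ γ : G, ∃ k, Sim lam γ y n k ∧ γ • y ∈ O ∧ -n₁ ≤ k) ⟨0, by simp⟩ ?_ ?_ ?_
  · rintro s t hst ⟨n₁, hn⟩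
    exact ⟨n₁, fun y hy ↦ hn y (hst hy)⟩
  · rintro s t ⟨n₁, hn₁⟩ ⟨n₂, hn₂⟩
    refine ⟨max n₁ n₂, fun y hy n hn ↦ ?_⟩
    rw [max_le_iff] at hn
    rcases hy with hy | hy
    · obtain ⟨γ, k, h1, h2, h3⟩ := hn₁ y hy n hn.1
      exact ⟨γ, k, h1, h2, (neg_le_neg (le_max_left _ _)).trans h3⟩
    · obtain ⟨γ, k, h1, h2, h3⟩ := hn₂ y hy n hn.2
      exact ⟨γ, k, h1, h2, (neg_le_neg (le_max_right _ _)).trans h3⟩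
  · intro x hx
    obtain ⟨γ, hγ⟩ := hmin x hx O hO hOM
    obtain ⟨n₁, hn₁⟩ := h.exists_sim_level γ
    refine ⟨_, mem_nhdsWithin_of_mem_nhds (inter_mem (h.eventually_exponent_eq γ x)
      ((continuous_const_smul γ).continuousAt (hO.mem_nhds hγ))),
      max n₁ (-h.exponent γ x), fun y ⟨hy, hy'⟩ n hn ↦ ⟨γ, _, hn₁ n ((le_max_left _ _).trans hn) y,
      hy', ?_⟩⟩
    rw [show h.exponent γ y = h.exponent γ x from hy]
    have := le_max_right n₁ (-h.exponent γ x)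
    omega

/-- Unbounded exponents on a minimal set yield an element that is not elliptic somewhere on it. -/
theorem exists_not_elliptic (h : IsLocalSimilarityAction lam G X) {S : Finset G}
    (hS : Subgroup.closure (S : Set G) = ⊤) {M : Set X} (hM : IsClosed M)
    (hinv : ∀ g : G, ∀ x ∈ M, g • x ∈ M)
    (hmin : ∀ x ∈ M, ∀ O : Set X, IsOpen O → (O ∩ M).Nonempty → ∃ g : G, g • x ∈ O)
    (hB : ∀ B : ℤ, ∃ g : G, ∃ x ∈ M, B < h.exponent g x) :
    ∃ f : G, ∃ x ∈ M, ¬ Elliptic f x := by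
  classical
  obtain ⟨n₁, hn₁⟩ := h.exists_sim_level_finset S
  obtain ⟨n₂, hn₂⟩ := h.exists_sim_level_finset (S.image (·⁻¹))
  set n₀ := max n₁ n₂
  obtain ⟨t, ht⟩ := h.exists_finset_closedBall n₀
  have hret : ∀ y : X, ∃ n₁ : ℤ, (closedBall y (lam ^ n₀) ∩ M).Nonempty → ∀ z ∈ M, ∀ n, n₁ ≤ n →
      ∃ γ : G, ∃ k, Sim lam γ z n k ∧ γ • z ∈ closedBall y (lam ^ n₀) ∧ -n₁ ≤ k := by
    intro y
    by_cases hy : (closedBall y (lam ^ n₀) ∩ M).Nonempty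
    · obtain ⟨n₁, hn⟩ := h.exists_uniform_return hM hmin
        (IsUltrametricDist.isOpen_closedBall y (zpow_pos h.pos n₀).ne') hy
      exact ⟨n₁, fun _ ↦ hn⟩
    · exact ⟨0, fun h' ↦ absurd h' hy⟩
  choose N hN using hret
  obtain ⟨N₀, hN₀⟩ := (t.image N).exists_le
  -- Exceeding `N₀ - n₀` makes the image ball small enough for the uniform return; exceeding `N₀`
  -- outweighs the expansion of that return, so the composite still contracts.
  obtain ⟨g, x, hx, hgx⟩ := hB (max (N₀ - n₀) N₀)
  obtain ⟨w, u, -, k, hsim, -, hk⟩ := h.exists_sim_of_closure hS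
    (fun s hs m hm ↦ hn₁ s hs m ((le_max_left _ _).trans hm))
    (fun s hs m hm ↦ hn₂ s⁻¹ (Finset.mem_image_of_mem _ hs) m ((le_max_right _ _).trans hm)) x g
  have hlt := hgx.trans_le hk
  rw [max_lt_iff] at hlt
  set q := u • x
  have hq : q ∈ M := hinv u x hx
  obtain ⟨y, hyt, hy⟩ := ht q
  have hNy := hN₀ _ (Finset.mem_image_of_mem N hyt)
  have hself := mem_closedBall_self (x := q) (zpow_pos h.pos n₀).le
  obtain ⟨γ, k', hsim', hγ, hk'⟩ := hN y ⟨q, hy ▸ hself, hq⟩ (w • q) (hinv w q hq) (n₀ + k)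
    (by omega)
  rw [← hy] at hγ
  have hs := hsim.mul h hsim'
  set e := k' + k
  set f := γ * w with hf
  have he : 0 < e := by omega
  have hmaps := hs.mapsTo h he.le (by rwa [hf, mul_smul])
  refine ⟨f, q, hq, fun ⟨m, hm, hell⟩ ↦ ?_⟩
  have key : ∀ m : ℕ, f ^ m • q ∈ closedBall q (lam ^ n₀) ∧ h.exponent (f ^ m) q = m * e := by
    intro m
    induction m with
    | zero => simpa [h.exponent_one] using (zpow_pos h.pos n₀).le
    | succ m ih =>
      rw [pow_succ', mul_smul, h.exponent_mul, (hs.of_mem ih.1).exponent_eq h, ih.2]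
      refine ⟨hmaps _ ih.1, ?_⟩
      push_cast
      ring
  have h1 := (key m).2
  rw [h.exponent_congr (g' := 1) (by simpa using hell), h.exponent_one] at h1
  have : (0 : ℤ) < m := by exact_mod_cast hm
  nlinarith

omit [ContinuousConstSMul G X] [CompactSpace X] [IsUltrametricDist X] in
theorem elliptic_of_pow {f : G} {x : X} {N : ℕ} (hN : 0 < N) (hx : Elliptic (f ^ N) x) :
    Elliptic f x := by
  obtain ⟨m, hm, he⟩ := hx
  exact ⟨N * m, by positivity, by simpa [pow_mul] using he⟩

omit [CompactSpace X] [IsUltrametricDist X] in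
theorem HyperbolicData.mem_iff_elliptic {h : IsLocalSimilarityAction lam G X} {f : G} {N : ℕ}
    {A R U : Set X} (hN : 0 < N) (H : h.HyperbolicData (f ^ N) A R U) {x : X} :
    x ∈ U ↔ Elliptic f x := by
  refine ⟨fun hx ↦ elliptic_of_pow hN ⟨1, one_pos, ?_⟩, fun ⟨m, hm, he⟩ ↦ ?_⟩
  · filter_upwards [H.isClopen.isOpen.mem_nhds hx] with y hy
    rw [pow_one, H.smul_eq y hy]
  · refine H.elliptic_mem ⟨m, hm, he.mono fun y hy ↦ ?_⟩
    rw [← pow_mul]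
    exact pow_smul_eq_of_dvd (dvd_mul_left _ _) hy

/-- An elliptic point is fixed by a power with exponent zero, so `HyperbolicData.exists_mul` places
the elliptic points of the product in both identity parts. -/
theorem exists_elliptic_subset_inter (h : IsLocalSimilarityAction lam G X) (f g : G) :
    ∃ k : G, ∀ x : X, Elliptic k x → Elliptic f x ∧ Elliptic g x := by
  obtain ⟨N₁, hN₁, A, R, U, H⟩ := h.exists_hyperbolicData f
  obtain ⟨N₂, hN₂, A', R', U', H'⟩ := h.exists_hyperbolicData g
  obtain ⟨n, m, hnm⟩ := H.exists_mul H'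
  refine ⟨(f ^ N₁) ^ n * (g ^ N₂) ^ m, fun x ⟨N, hN, he⟩ ↦ ?_⟩
  have := hnm N hN x he.self_of_nhds (by
    rw [h.exponent_congr (g' := 1) (by simpa using he), h.exponent_one])
  exact ⟨(H.mem_iff_elliptic hN₁).1 this.1, (H'.mem_iff_elliptic hN₂).1 this.2⟩

omit [CompactSpace X] [IsUltrametricDist X] in
theorem Elliptic.conj {f : G} {x : X} (hx : Elliptic f x) (c : G) :
    Elliptic (c * f * c⁻¹) (c • x) := by
  obtain ⟨m, hm, he⟩ := hx
  refine ⟨m, hm, ?_⟩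
  have hc : Tendsto (fun y ↦ c⁻¹ • y) (𝓝 (c • x)) (𝓝 x) := by
    have := (continuous_const_smul c⁻¹ : Continuous fun y : X ↦ c⁻¹ • y).tendsto (c • x)
    rwa [inv_smul_smul] at this
  filter_upwards [hc.eventually he] with y hy
  rw [conj_pow, mul_smul, mul_smul, hy, smul_inv_smul]

/-- If some element is not elliptic somewhere on a minimal set, then some element is nowhere
elliptic on it. -/
theorem exists_forall_not_elliptic (h : IsLocalSimilarityAction lam G X) {M : Set X}
    (hM : IsClosed M)
    (hmin : ∀ x ∈ M, ∀ O : Set X, IsOpen O → (O ∩ M).Nonempty → ∃ g : G, g • x ∈ O)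
    {f : G} {p : X} (hp : p ∈ M) (hf : ¬ Elliptic f p) : ∃ k : G, ∀ x ∈ M, ¬ Elliptic k x := by
  by_contra! hcon
  have hclosed (k : G) : IsClosed (M ∩ {x | Elliptic k x}) :=
    hM.inter (h.isClopen_setOf_elliptic k).isClosed
  -- The traces on `M` of the elliptic sets form a directed family of compact sets; if none were
  -- empty, all elements would be elliptic at a common point. Minimality moves it into the open set
  -- where `f` is not elliptic, and conjugation gives a contradiction.
  obtain ⟨x, hx⟩ := IsCompact.nonempty_iInter_of_directed_nonempty_isCompact_isClosed
    (fun k : G ↦ M ∩ {x | Elliptic k x})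
    (fun k k' ↦ by
      obtain ⟨k'', hk⟩ := h.exists_elliptic_subset_inter k k'
      exact ⟨k'', fun x hx ↦ ⟨hx.1, (hk x hx.2).1⟩, fun x hx ↦ ⟨hx.1, (hk x hx.2).2⟩⟩)
    (fun k ↦ by
      obtain ⟨x, hx, hk⟩ := hcon k
      exact ⟨x, hx, hk⟩)
    (fun k ↦ (hclosed k).isCompact) hclosed
  rw [mem_iInter] at hx
  obtain ⟨c, hc⟩ := hmin x (hx 1).1 {x | Elliptic f x}ᶜ
    (h.isClopen_setOf_elliptic f).compl.isOpen ⟨p, hf, hp⟩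
  refine hc ?_
  have := (hx (c⁻¹ * f * c⁻¹⁻¹)).2.conj c
  rwa [show c * (c⁻¹ * f * c⁻¹⁻¹) * c⁻¹ = f by group] at this

/-- On `M` a power of `f` has no identity part. The element `γ` moves its fixed points in `M` off
themselves, so high powers of it and their conjugates by `γ` play ping-pong on `M`. -/
theorem exists_freeGroup_of_not_elliptic (h : IsLocalSimilarityAction lam G X) {M : Set X}
    (hM : IsClosed M) (hne : M.Nonempty) (hinv : ∀ g : G, ∀ x ∈ M, g • x ∈ M)
    (horb : ∀ x ∈ M, (MulAction.orbit G x).Infinite) {f : G} (hf : ∀ x ∈ M, ¬ Elliptic f x) :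
    ∃ φ : FreeGroup (Fin 2) →* G, Function.Injective φ := by
  obtain ⟨N, hN, A, R, U, H⟩ := h.exists_hyperbolicData f
  have hU : ∀ x ∈ M, x ∉ U := fun x hx hxU ↦ hf x hx ((H.mem_iff_elliptic hN).1 hxU)
  set k := f ^ N
  have hPfin : ((A ∪ R) ∩ M).Finite :=
    (H.finite_attracting.union H.finite_repelling).subset inter_subset_left
  obtain ⟨γ, hγ⟩ := exists_smul_notMem_of_infinite_orbit hPfin fun x hx ↦ horb x hx.2
  obtain ⟨O₁, O₂, hO₁, hO₂, hP₁, hP₂, hdisj⟩ := SeparatedNhds.of_isCompact_isCompact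
    hPfin.isCompact (hPfin.image (γ • ·)).isCompact (by
      rw [disjoint_right]
      rintro _ ⟨x, hx, rfl⟩
      exact hγ x hx)
  obtain ⟨O₃, O₄, hO₃, hO₄, hA₃, hR₄, hdisj'⟩ := SeparatedNhds.of_isCompact_isCompact
    H.finite_attracting.isCompact H.finite_repelling.isCompact H.disjoint
  -- Some attracting or repelling points may lie outside `M`. Adding `Mᶜ` covers them without
  -- affecting the game on `M`.
  have hO : IsOpen ((O₁ ∩ (γ • ·) ⁻¹' O₂) ∪ Mᶜ) :=
    (hO₁.inter (hO₂.preimage (continuous_const_smul γ))).union hM.isOpen_compl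
  have hPO : ∀ x ∈ A ∪ R, x ∈ (O₁ ∩ (γ • ·) ⁻¹' O₂) ∪ Mᶜ := by
    intro x hx
    by_cases hxM : x ∈ M
    · exact .inl ⟨hP₁ ⟨hx, hxM⟩, hP₂ (mem_image_of_mem _ ⟨hx, hxM⟩)⟩
    · exact .inr hxM
  set W := O₃ ∩ ((O₁ ∩ (γ • ·) ⁻¹' O₂) ∪ Mᶜ) with hW
  set W' := O₄ ∩ ((O₁ ∩ (γ • ·) ⁻¹' O₂) ∪ Mᶜ) with hW'
  have hWo : IsOpen W := hO₃.inter hO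
  have hW'o : IsOpen W' := hO₄.inter hO
  have hAW : A ⊆ W := fun x hx ↦ ⟨hA₃ hx, hPO x (.inl hx)⟩
  have hRW' : R ⊆ W' := fun x hx ↦ ⟨hR₄ hx, hPO x (.inr hx)⟩
  obtain ⟨n₁, hn₁⟩ := H.uniform hWo hAW hW'o hRW' 0
  obtain ⟨n₂, hn₂⟩ := H.inv.uniform hW'o hRW' hWo hAW 0
  set n := max n₁ n₂
  set b := k ^ n with hb
  have hbW : ∀ x ∈ M, x ∉ W' → b • x ∈ W := fun x hx hxW ↦
    (hn₁ n (le_max_left _ _) x (hU x hx) hxW).1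
  have hbW' : ∀ x ∈ M, x ∉ W → b⁻¹ • x ∈ W' := fun x hx hxW ↦ by
    rw [hb, ← inv_pow]
    exact (hn₂ n (le_max_right _ _) x (hU x hx) hxW).1
  have hWne : ∃ x ∈ M, x ∈ W := by
    obtain ⟨x, hx⟩ := hne
    obtain ⟨y, hy, hyR⟩ := (horb x hx).exists_notMem_finite H.finite_repelling
    have hyM : y ∈ M := by
      obtain ⟨g, rfl⟩ := hy
      exact hinv g x hx
    obtain ⟨a, ha, O, hO', hT⟩ := H.forward y (hU y hyM) hyR
    obtain ⟨n₃, hn₃⟩ := hT W (hWo.mem_nhds (hAW ha)) 0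
    exact ⟨_, hinv (k ^ n₃) y hyM, (hn₃ n₃ le_rfl y (mem_of_mem_nhds hO')).1⟩
  let Ms : SubMulAction G X := ⟨M, fun g x hx ↦ hinv g x hx⟩
  let c : Fin 2 → G := ![1, γ]
  let V : Fin 2 → Set X := ![O₁, O₂]
  have hV : ∀ i j, i ≠ j → Disjoint (V i) (V j) := by
    intro i j hij
    fin_cases i <;> fin_cases j <;> simp_all [V, hdisj.symm]
  have hcV : ∀ i, ∀ x ∈ M, (c i)⁻¹ • x ∈ W ∪ W' → x ∈ V i := by
    intro i x hx hxW
    have h1 : (c i)⁻¹ • x ∈ O₁ ∩ (γ • ·) ⁻¹' O₂ := by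
      have h2 : (c i)⁻¹ • x ∈ (O₁ ∩ (γ • ·) ⁻¹' O₂) ∪ Mᶜ := hxW.elim (fun h ↦ h.2) fun h ↦ h.2
      exact h2.resolve_right fun h3 ↦ h3 (hinv _ x hx)
    fin_cases i
    · simpa [c, V] using h1.1
    · simpa [c, V] using h1.2
  have hinj : Function.Injective
      (FreeGroup.lift fun i : ULift (Fin 2) ↦ c i.down * b * (c i.down)⁻¹) := by
    refine FreeGroup.injective_lift_of_ping_pong (α := Ms) _
      (fun i ↦ {x : Ms | (c i.down)⁻¹ • x.1 ∈ W}) (fun i ↦ {x : Ms | (c i.down)⁻¹ • x.1 ∈ W'})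
      ?_ ?_ ?_ ?_ ?_ ?_
    · intro i
      obtain ⟨x, hx, hxW⟩ := hWne
      exact ⟨⟨c i.down • x, hinv _ x hx⟩, by simpa using hxW⟩
    · intro i j hij
      refine disjoint_left.2 fun x hx hx' ↦ ?_
      exact (hV i.down j.down fun he ↦ hij (ULift.ext _ _ he)).notMem_of_mem_left (hcV i.down x x.2 (.inl hx)) (hcV j.down x x.2 (.inl hx'))
    · intro i j hij
      refine disjoint_left.2 fun x hx hx' ↦ ?_
      exact (hV i.down j.down fun he ↦ hij (ULift.ext _ _ he)).notMem_of_mem_left (hcV i.down x x.2 (.inr hx)) (hcV j.down x x.2 (.inr hx'))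
    · intro i j
      refine disjoint_left.2 fun x hx hx' ↦ ?_
      by_cases hij : i = j
      · subst hij
        exact hdisj'.notMem_of_mem_left hx.1 hx'.1
      · exact (hV i.down j.down fun he ↦ hij (ULift.ext _ _ he)).notMem_of_mem_left (hcV i.down x x.2 (.inl hx)) (hcV j.down x x.2 (.inr hx'))
    · rintro i _ ⟨x, hx, rfl⟩
      have := hbW ((c i.down)⁻¹ • x.1) (hinv _ _ x.2) hx
      simpa [mul_smul] using this
    · rintro i _ ⟨x, hx, rfl⟩
      have := hbW' ((c i.down)⁻¹ • x.1) (hinv _ _ x.2) hx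
      simpa [mul_smul] using this
  exact ⟨(FreeGroup.lift _).comp (FreeGroup.freeGroupCongr Equiv.ulift.symm).toMonoidHom,
    hinj.comp (FreeGroup.freeGroupCongr Equiv.ulift.symm).injective⟩

variable [MeasurableSpace X] [BorelSpace X]

theorem exists_freeGroup_or_exists_measure_of_closure [Nonempty X]
    (h : IsLocalSimilarityAction lam G X) {S : Finset G}
    (hS : Subgroup.closure (S : Set G) = ⊤) :
    (∃ φ : FreeGroup (Fin 2) →* G, Function.Injective φ) ∨
    ∃ μ : ProbabilityMeasure X, ∀ g : G, (μ : Measure X).map (g • ·) = μ := by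
  obtain ⟨M, hM, hne, hinv, hmin⟩ := exists_isClosed_minimal G X
  by_cases horb : ∃ x ∈ M, (MulAction.orbit G x).Finite
  · obtain ⟨x, -, hx⟩ := horb
    exact .inr (exists_invariant_measure_of_finite_families
      (exists_finite_families_of_finite_orbit hx))
  push Not at horb
  by_cases hB : ∃ B : ℤ, ∀ g : G, ∀ x ∈ M, h.exponent g x ≤ B
  · obtain ⟨B, hB⟩ := hB
    exact .inr (exists_invariant_measure_of_finite_families
      (h.exists_finite_families_of_bounded hS hne hinv hB))
  push Not at hB
  obtain ⟨f, p, hp, hf⟩ := h.exists_not_elliptic hS hM hinv hmin hB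
  obtain ⟨k, hk⟩ := h.exists_forall_not_elliptic hM hmin hp hf
  exact .inl (h.exists_freeGroup_of_not_elliptic hM hne hinv horb hk)

/-- Tits alternative for groups of local similarities of a compact ultrametric space. -/
theorem exists_freeGroup_or_exists_measure [Nonempty X] (h : IsLocalSimilarityAction lam G X) :
    (∃ φ : FreeGroup (Fin 2) →* G, Function.Injective φ) ∨
    ∃ μ : ProbabilityMeasure X, ∀ g : G, (μ : Measure X).map (g • ·) = μ := by
  classical
  by_cases hfree : ∃ φ : FreeGroup (Fin 2) →* G, Function.Injective φ
  · exact .inl hfree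
  -- Without a free subgroup in `G` there is none in its finitely generated subgroups, so each of
  -- these has an invariant measure.
  refine .inr (exists_invariant_measure_of_fg fun S ↦ ?_)
  have hfg : (Subgroup.closure (S : Set G)).FG := ⟨S, rfl⟩
  obtain ⟨S', hS'⟩ := ((Group.fg_iff_subgroup_fg _).2 hfg).out
  have : ContinuousConstSMul (Subgroup.closure (S : Set G)) X :=
    ⟨fun g ↦ continuous_const_smul g.1⟩
  rcases (h.subgroup (Subgroup.closure (S : Set G))).exists_freeGroup_or_exists_measure_of_closure
    hS' with ⟨φ, hφ⟩ | ⟨μ, hμ⟩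
  · exact absurd ⟨(Subgroup.subtype _).comp φ, (Subgroup.subtype_injective _).comp hφ⟩ hfree
  · exact ⟨μ, fun g hg ↦ hμ ⟨g, hg⟩⟩

end IsLocalSimilarityAction

/-! ### The gap metric of a subset of the line -/

/-- The lengths of the gaps of `K` between `x` and `y`; trivial gaps are allowed. -/
def gapLengths (K : Set ℝ) (x y : ℝ) : Set ℝ :=
  {r | ∃ a ∈ K, ∃ b ∈ K, a ∈ uIcc x y ∧ b ∈ uIcc x y ∧ (∀ c ∈ K, c ∈ uIcc a b → c = a ∨ c = b) ∧
    r = |b - a|}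

/-- The length of the largest gap of `K` between `x` and `y`. -/
noncomputable def gapDist (K : Set ℝ) (x y : ℝ) : ℝ := sSup (gapLengths K x y)

section GapDist

variable {K : Set ℝ} {x y z w : ℝ}

theorem abs_sub_le_of_mem_uIcc {a b : ℝ} (ha : a ∈ uIcc x y) (hb : b ∈ uIcc x y) :
    |b - a| ≤ |y - x| := abs_sub_le_of_uIcc_subset_uIcc (uIcc_subset_uIcc ha hb)

theorem bddAbove_gapLengths : BddAbove (gapLengths K x y) := by
  refine ⟨|y - x|, ?_⟩
  rintro _ ⟨a, -, b, -, ha, hb, -, rfl⟩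
  exact abs_sub_le_of_mem_uIcc ha hb

theorem zero_mem_gapLengths (hx : x ∈ K) : 0 ∈ gapLengths K x y :=
  ⟨x, hx, x, hx, left_mem_uIcc, left_mem_uIcc, by simp, by simp⟩

theorem le_gapDist {r : ℝ} (hr : r ∈ gapLengths K x y) : r ≤ gapDist K x y :=
  le_csSup bddAbove_gapLengths hr

theorem gapDist_nonneg (K : Set ℝ) (x y : ℝ) : 0 ≤ gapDist K x y :=
  Real.sSup_nonneg (by rintro _ ⟨a, -, b, -, -, -, -, rfl⟩; exact abs_nonneg _)

theorem gapDist_le_abs_sub (K : Set ℝ) (x y : ℝ) : gapDist K x y ≤ |y - x| :=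
  Real.sSup_le (by
    rintro _ ⟨a, -, b, -, ha, hb, -, rfl⟩
    exact abs_sub_le_of_mem_uIcc ha hb) (abs_nonneg _)

theorem gapDist_comm (K : Set ℝ) (x y : ℝ) : gapDist K x y = gapDist K y x := by
  simp only [gapDist, gapLengths, uIcc_comm]

theorem gapDist_self (K : Set ℝ) (x : ℝ) : gapDist K x x = 0 :=
  le_antisymm ((gapDist_le_abs_sub K x x).trans (by simp)) (gapDist_nonneg K x x)

theorem gapDist_mono (hx : x ∈ K) (h : uIcc x y ⊆ uIcc z w) : gapDist K x y ≤ gapDist K z w := by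
  refine csSup_le_csSup bddAbove_gapLengths ⟨0, zero_mem_gapLengths hx⟩ ?_
  rintro _ ⟨a, ha, b, hb, hax, hbx, hgap, rfl⟩
  exact ⟨a, ha, b, hb, h hax, h hbx, hgap, rfl⟩

/-- A gap cannot contain the point `y` of `K` in its interior, so each gap between `x` and `z` lies
on one side of `y`. -/
theorem gapDist_le_max (hy : y ∈ K) :
    gapDist K x z ≤ max (gapDist K x y) (gapDist K y z) := by
  refine Real.sSup_le ?_ ((gapDist_nonneg K x y).trans (le_max_left _ _))
  rintro _ ⟨a, ha, b, hb, hax, hbx, hgap, rfl⟩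
  wlog hab : a ≤ b generalizing a b
  · rw [abs_sub_comm]
    exact this b hb a ha hbx hax (fun c hc hcab ↦ (hgap c hc (uIcc_comm a b ▸ hcab)).symm)
      (le_of_not_ge hab)
  have hgap' := hgap y hy
  rw [uIcc_of_le hab] at hgap'
  by_cases h : (a ∈ uIcc x y ∧ b ∈ uIcc x y)
  · exact (le_gapDist ⟨a, ha, b, hb, h.1, h.2, hgap, rfl⟩).trans (le_max_left _ _)
  · have h' : a ∈ uIcc y z ∧ b ∈ uIcc y z := by
      simp only [mem_uIcc, mem_Icc] at *
      grind
    exact (le_gapDist ⟨a, ha, b, hb, h'.1, h'.2, hgap, rfl⟩).trans (le_max_right _ _)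

/-- A map that preserves betweenness near two points, and scales all the gaps between them by the
same factor, scales their gap distance. -/
theorem gapDist_image {τ : ℝ → ℝ} {N : Set ℝ} {r : ℝ} (hr : 0 ≤ r) (hx : x ∈ K) (hy : y ∈ K)
    (hKN : ∀ c ∈ K, c ∈ uIcc x y → c ∈ N) (hτK : ∀ c ∈ K, τ c ∈ K)
    (hbetw : ∀ a ∈ N, ∀ b ∈ N, ∀ c ∈ N, (τ c ∈ uIcc (τ a) (τ b) ↔ c ∈ uIcc a b))
    (hsurj : ∀ c ∈ K, c ∈ uIcc (τ x) (τ y) → ∃ c' ∈ K, c' ∈ N ∧ τ c' = c)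
    (hscale : ∀ a ∈ K, ∀ b ∈ K, a ∈ N → b ∈ N → (∀ c ∈ K, c ∈ uIcc a b → c = a ∨ c = b) →
      (∀ c ∈ K, c ∈ uIcc (τ a) (τ b) → c = τ a ∨ c = τ b) → |τ b - τ a| = r * |b - a|) :
    gapDist K (τ x) (τ y) = r * gapDist K x y := by
  have hxN := hKN x hx left_mem_uIcc
  have hyN := hKN y hy right_mem_uIcc
  have hgap : ∀ a ∈ K, ∀ b ∈ K, a ∈ uIcc x y → b ∈ uIcc x y →
      ((∀ c ∈ K, c ∈ uIcc a b → c = a ∨ c = b) ↔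
        ∀ c ∈ K, c ∈ uIcc (τ a) (τ b) → c = τ a ∨ c = τ b) := by
    intro a ha b hb hax hbx
    have haN := hKN a ha hax
    have hbN := hKN b hb hbx
    constructor
    · intro h c hc hcab
      obtain ⟨c', hc', hcN, rfl⟩ := hsurj c hc (uIcc_subset_uIcc
        ((hbetw x hxN y hyN a haN).2 hax) ((hbetw x hxN y hyN b hbN).2 hbx) hcab)
      rcases h c' hc' ((hbetw a haN b hbN c' hcN).1 hcab) with rfl | rfl <;> simp
    · intro h c hc hcab
      have hcN := hKN c hc (uIcc_subset_uIcc hax hbx hcab)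
      rcases h _ (hτK c hc) ((hbetw a haN b hbN c hcN).2 hcab) with h1 | h1
      · left
        have := (hbetw a haN a haN c hcN).1 (by rw [h1]; exact left_mem_uIcc)
        simpa using this
      · right
        have := (hbetw b hbN b hbN c hcN).1 (by rw [h1]; exact left_mem_uIcc)
        simpa using this
  have : gapLengths K (τ x) (τ y) = (r • ·) '' gapLengths K x y := by
    ext t
    constructor
    · rintro ⟨a, ha, b, hb, hax, hbx, hab, rfl⟩
      obtain ⟨a, ha', haN, rfl⟩ := hsurj a ha hax
      obtain ⟨b, hb', hbN, rfl⟩ := hsurj b hb hbx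
      rw [hbetw x hxN y hyN a haN] at hax
      rw [hbetw x hxN y hyN b hbN] at hbx
      have hab' := (hgap a ha' b hb' hax hbx).2 hab
      exact ⟨_, ⟨a, ha', b, hb', hax, hbx, hab', rfl⟩,
        (hscale a ha' b hb' haN hbN hab' hab).symm⟩
    · rintro ⟨_, ⟨a, ha, b, hb, hax, hbx, hab, rfl⟩, rfl⟩
      have haN := hKN a ha hax
      have hbN := hKN b hb hbx
      have hab' := (hgap a ha b hb hax hbx).1 hab
      exact ⟨τ a, hτK a ha, τ b, hτK b hb, (hbetw x hxN y hyN a haN).2 hax,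
        (hbetw x hxN y hyN b hbN).2 hbx, hab', (hscale a ha b hb haN hbN hab hab').symm⟩
  rw [gapDist, this, gapDist, ← smul_eq_mul, ← Real.sSup_smul_of_nonneg hr, image_smul]

end GapDist

/-! ### The gaps of the central Cantor set -/

namespace SmoothMCG

variable {lam : ℝ}

theorem leftEndpoints_succ (n : ℕ) {e : ℝ} : e ∈ leftEndpoints lam (n + 1) ↔
    ∃ e' ∈ leftEndpoints lam n, e = e' ∨ e = e' + lam ^ n - lam ^ (n + 1) := by
  simp only [leftEndpoints, Finset.mem_union, Finset.mem_image]
  constructor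
  · rintro (h | ⟨a, ha, rfl⟩)
    · exact ⟨e, h, .inl rfl⟩
    · exact ⟨a, ha, .inr rfl⟩
  · rintro ⟨a, ha, rfl | rfl⟩
    · exact .inl ha
    · exact .inr ⟨a, ha, rfl⟩

theorem lt_of_leftEndpoints (h0 : 0 < lam) (h1 : lam < 1 / 2) (n : ℕ) {e e' : ℝ}
    (he : e ∈ leftEndpoints lam n) (he' : e' ∈ leftEndpoints lam n) (hlt : e < e') :
    e + lam ^ n < e' := by
  induction n generalizing e e' with
  | zero =>
    simp only [leftEndpoints, Finset.mem_singleton] at he he'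
    linarith
  | succ n ih =>
    have hpos : 0 < lam ^ n := pow_pos h0 n
    have hsucc : 2 * lam ^ (n + 1) < lam ^ n := by
      rw [pow_succ]
      nlinarith
    have hsucc' : 0 < lam ^ (n + 1) := pow_pos h0 _
    rw [leftEndpoints_succ] at he he'
    obtain ⟨f, hf, hef⟩ := he
    obtain ⟨f', hf', hef'⟩ := he'
    rcases lt_trichotomy f f' with h | rfl | h
    · have := ih hf hf' h
      rcases hef with rfl | rfl <;> rcases hef' with rfl | rfl <;> linarith
    · rcases hef with rfl | rfl <;> rcases hef' with rfl | rfl <;> linarith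
    · have := ih hf' hf h
      rcases hef with rfl | rfl <;> rcases hef' with rfl | rfl <;> linarith

theorem exists_leftEndpoint {x : ℝ} (hx : x ∈ centralCantorSet lam) (n : ℕ) :
    ∃ e ∈ leftEndpoints lam n, x ∈ Icc e (e + lam ^ n) := by
  obtain ⟨e, he, hxe⟩ := mem_iUnion₂.1 (mem_iInter.1 hx n)
  exact ⟨e, he, hxe⟩

theorem mem_Icc_or_mem_Icc (h0 : 0 < lam) (h1 : lam < 1 / 2) {n : ℕ} {e x : ℝ}
    (he : e ∈ leftEndpoints lam n) (hx : x ∈ centralCantorSet lam) (hxe : x ∈ Icc e (e + lam ^ n)) :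
    x ∈ Icc e (e + lam ^ (n + 1)) ∨ x ∈ Icc (e + lam ^ n - lam ^ (n + 1)) (e + lam ^ n) := by
  obtain ⟨f, hf, hxf⟩ := exists_leftEndpoint hx (n + 1)
  obtain ⟨e', he', hfe'⟩ := (leftEndpoints_succ n).1 hf
  have hpos : 0 < lam ^ n := pow_pos h0 n
  have hsucc : 2 * lam ^ (n + 1) < lam ^ n := by
    rw [pow_succ]
    nlinarith
  rw [mem_Icc] at *
  rcases lt_trichotomy e e' with h | rfl | h
  · have := lt_of_leftEndpoints h0 h1 n he he' h
    rcases hfe' with rfl | rfl <;> linarith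
  · rcases hfe' with rfl | rfl
    · exact .inl hxf
    · exact .inr ⟨hxf.1, by linarith⟩
  · have := lt_of_leftEndpoints h0 h1 n he' he h
    rcases hfe' with rfl | rfl <;> linarith

theorem exists_leftEndpoint_Icc_subset (h0 : 0 < lam) (h1 : lam < 1 / 2) {m n : ℕ} (hmn : m ≤ n)
    {e : ℝ} (he : e ∈ leftEndpoints lam n) :
    ∃ e' ∈ leftEndpoints lam m, Icc e (e + lam ^ n) ⊆ Icc e' (e' + lam ^ m) := by
  induction n, hmn using Nat.le_induction generalizing e with
  | base => exact ⟨e, he, subset_rfl⟩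
  | succ n hmn ih =>
    obtain ⟨f, hf, hef⟩ := (leftEndpoints_succ n).1 he
    obtain ⟨e', he', hsub⟩ := ih hf
    refine ⟨e', he', subset_trans (Icc_subset_Icc ?_ ?_) hsub⟩ <;>
    · have hpos : 0 < lam ^ n := pow_pos h0 n
      have hsucc : 2 * lam ^ (n + 1) < lam ^ n := by
        rw [pow_succ]
        nlinarith
      have hsucc' : 0 < lam ^ (n + 1) := pow_pos h0 _
      rcases hef with rfl | rfl <;> linarith

theorem leftEndpoints_mono (m k : ℕ) {e : ℝ} (he : e ∈ leftEndpoints lam m) :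
    e ∈ leftEndpoints lam (m + k) := by
  induction k with
  | zero => exact he
  | succ k ih => exact (leftEndpoints_succ _).2 ⟨e, ih, .inl rfl⟩

theorem rightEndpoints_mono (m k : ℕ) {e : ℝ} (he : e ∈ leftEndpoints lam m) :
    ∃ f ∈ leftEndpoints lam (m + k), f + lam ^ (m + k) = e + lam ^ m := by
  induction k with
  | zero => exact ⟨e, he, rfl⟩
  | succ k ih =>
    obtain ⟨f, hf, hfe⟩ := ih
    exact ⟨_, (leftEndpoints_succ _).2 ⟨f, hf, .inr rfl⟩, (sub_add_cancel _ _).trans hfe⟩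

theorem mem_centralCantorSet_of_forall (h0 : 0 < lam) (h1 : lam < 1 / 2) {x : ℝ} {m : ℕ}
    (hx : ∀ n, m ≤ n → ∃ e ∈ leftEndpoints lam n, x ∈ Icc e (e + lam ^ n)) :
    x ∈ centralCantorSet lam := by
  refine mem_iInter.2 fun n ↦ mem_iUnion₂.2 ?_
  obtain ⟨e, he, hxe⟩ := hx (max m n) (le_max_left _ _)
  obtain ⟨e', he', hsub⟩ := exists_leftEndpoint_Icc_subset h0 h1 (le_max_right m n) he
  exact ⟨e', he', hsub hxe⟩

theorem leftEndpoint_mem (h0 : 0 < lam) (h1 : lam < 1 / 2) {n : ℕ} {e : ℝ}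
    (he : e ∈ leftEndpoints lam n) : e ∈ centralCantorSet lam := by
  refine mem_centralCantorSet_of_forall h0 h1 (m := n) fun k hk ↦ ?_
  obtain ⟨k, rfl⟩ := Nat.exists_eq_add_of_le hk
  exact ⟨e, leftEndpoints_mono n k he, left_mem_Icc.2 (by linarith [pow_pos h0 (n + k)])⟩

theorem rightEndpoint_mem (h0 : 0 < lam) (h1 : lam < 1 / 2) {n : ℕ} {e : ℝ}
    (he : e ∈ leftEndpoints lam n) : e + lam ^ n ∈ centralCantorSet lam := by
  refine mem_centralCantorSet_of_forall h0 h1 (m := n) fun k hk ↦ ?_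
  obtain ⟨k, rfl⟩ := Nat.exists_eq_add_of_le hk
  obtain ⟨f, hf, hfe⟩ := rightEndpoints_mono n k he
  exact ⟨f, hf, by rw [← hfe]; exact right_mem_Icc.2 (by linarith [pow_pos h0 (n + k)])⟩

theorem isClosed_centralCantorSet (lam : ℝ) : IsClosed (centralCantorSet lam) :=
  isClosed_iInter fun _ ↦ Set.Finite.isClosed_biUnion (Finset.finite_toSet _) fun _ _ ↦ isClosed_Icc

theorem isCompact_centralCantorSet (lam : ℝ) : IsCompact (centralCantorSet lam) :=
  isCompact_Icc.of_isClosed_subset (isClosed_centralCantorSet lam) (centralCantorSet_subset lam)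

theorem zero_mem_centralCantorSet (h0 : 0 < lam) (h1 : lam < 1 / 2) :
    (0 : ℝ) ∈ centralCantorSet lam :=
  leftEndpoint_mem h0 h1 (n := 0) (by simp [leftEndpoints])

theorem exists_ne_mem_centralCantorSet (h0 : 0 < lam) (h1 : lam < 1 / 2) {x : ℝ}
    (hx : x ∈ centralCantorSet lam) {ε : ℝ} (hε : 0 < ε) :
    ∃ y ∈ centralCantorSet lam, y ≠ x ∧ |y - x| < ε := by
  obtain ⟨n, hn⟩ := exists_pow_lt_of_lt_one hε (by linarith : lam < 1)
  obtain ⟨e, he, hxe⟩ := exists_leftEndpoint hx n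
  have hpos := pow_pos h0 n
  rw [mem_Icc] at hxe
  by_cases h : x = e
  · exact ⟨_, rightEndpoint_mem h0 h1 he, by linarith, by rw [abs_lt]; constructor <;> linarith⟩
  · exact ⟨e, leftEndpoint_mem h0 h1 he, Ne.symm h, by rw [abs_lt]; constructor <;> linarith⟩

/-- Between two points of the Cantor set there is a gap. -/
theorem exists_gap (h0 : 0 < lam) (h1 : lam < 1 / 2) {x y : ℝ} (hx : x ∈ centralCantorSet lam)
    (hy : y ∈ centralCantorSet lam) (hxy : x < y) :
    ∃ a ∈ centralCantorSet lam, ∃ b ∈ centralCantorSet lam, x ≤ a ∧ a < b ∧ b ≤ y ∧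
      (∀ c ∈ centralCantorSet lam, c ∈ Icc a b → c = a ∨ c = b) ∧
      ∃ n : ℕ, b - a = lam ^ n * (1 - 2 * lam) := by
  classical
  -- The first step at which no interval contains both points; the middle part removed just before
  -- it separates them.
  have hex : ∃ n, ¬ ∃ e ∈ leftEndpoints lam n,
      x ∈ Icc e (e + lam ^ n) ∧ y ∈ Icc e (e + lam ^ n) := by
    obtain ⟨n, hn⟩ := exists_pow_lt_of_lt_one (sub_pos.2 hxy) (by linarith : lam < 1)
    refine ⟨n, ?_⟩
    rintro ⟨e, -, hxe, hye⟩
    rw [mem_Icc] at hxe hye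
    linarith
  have hne : Nat.find hex ≠ 0 := by
    intro h
    have := Nat.find_spec hex
    rw [h] at this
    refine this ⟨0, by simp [leftEndpoints], ?_⟩
    simpa using ⟨centralCantorSet_subset lam hx, centralCantorSet_subset lam hy⟩
  obtain ⟨n, hn⟩ := Nat.exists_eq_succ_of_ne_zero hne
  have hnot := Nat.find_spec hex
  have hyes := not_not.1 (Nat.find_min hex (m := n) (by omega))
  rw [hn] at hnot
  obtain ⟨e, he, hxe, hye⟩ := hyes
  have hl : e ∈ leftEndpoints lam (n + 1) := (leftEndpoints_succ n).2 ⟨e, he, .inl rfl⟩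
  have hr : e + lam ^ n - lam ^ (n + 1) ∈ leftEndpoints lam (n + 1) :=
    (leftEndpoints_succ n).2 ⟨e, he, .inr rfl⟩
  have hpos : 0 < lam ^ n := pow_pos h0 n
  have hsucc : 2 * lam ^ (n + 1) < lam ^ n := by
    rw [pow_succ]
    nlinarith
  have hsucc' : 0 < lam ^ (n + 1) := pow_pos h0 _
  have hx' := mem_Icc_or_mem_Icc h0 h1 he hx hxe
  have hy' := mem_Icc_or_mem_Icc h0 h1 he hy hye
  have hxl : x ≤ e + lam ^ (n + 1) := by
    by_contra hcon
    have hxr := hx'.resolve_left fun h ↦ hcon h.2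
    refine hnot ⟨_, hr, ?_, ?_⟩
    · rw [sub_add_cancel]; exact hxr
    · rw [sub_add_cancel]; exact ⟨hxr.1.trans hxy.le, hye.2⟩
  have hyr : e + lam ^ n - lam ^ (n + 1) ≤ y := by
    by_contra hcon
    have hyl := hy'.resolve_right fun h ↦ hcon h.1
    exact hnot ⟨_, hl, ⟨hxe.1, hxl⟩, hyl⟩
  refine ⟨_, rightEndpoint_mem h0 h1 hl, _, leftEndpoint_mem h0 h1 hr, hxl, by linarith, hyr, ?_,
    n, by ring⟩
  intro c hc hcab
  rcases mem_Icc_or_mem_Icc h0 h1 he hc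
    ⟨by linarith [hcab.1], by linarith [hcab.2]⟩ with h | h
  · exact .inl (le_antisymm h.2 hcab.1)
  · exact .inr (le_antisymm hcab.2 h.1)

/-- Between the two ends there is one of the removed middle intervals; its endpoints are in the
Cantor set, so they are the ends of the given gap. -/
theorem exists_abs_sub_eq_of_gap (h0 : 0 < lam) (h1 : lam < 1 / 2) {a b : ℝ}
    (ha : a ∈ centralCantorSet lam) (hb : b ∈ centralCantorSet lam) (hab : a ≠ b)
    (hgap : ∀ c ∈ centralCantorSet lam, c ∈ uIcc a b → c = a ∨ c = b) :
    ∃ n : ℕ, |b - a| = lam ^ n * (1 - 2 * lam) := by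
  wlog hlt : a < b generalizing a b
  · rw [abs_sub_comm]
    exact this hb ha hab.symm (fun c hc hcab ↦ (hgap c hc (uIcc_comm a b ▸ hcab)).symm)
      (hab.lt_or_gt.resolve_left hlt)
  rw [uIcc_of_le hlt.le] at hgap
  obtain ⟨a', ha', b', hb', h2, h3, h4, -, n, hn⟩ := exists_gap h0 h1 ha hb hlt
  have ha'' : a' = a := (hgap a' ha' ⟨h2, (h3.trans_le h4).le⟩).resolve_right (h3.trans_le h4).ne
  have hb'' : b' = b := (hgap b' hb' ⟨(h2.trans_lt h3).le, h4⟩).resolve_left (h2.trans_lt h3).ne'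
  exact ⟨n, by rw [abs_of_pos (sub_pos.2 hlt), ← hn, ha'', hb'']⟩

theorem gapDist_pos (h0 : 0 < lam) (h1 : lam < 1 / 2) {x y : ℝ} (hx : x ∈ centralCantorSet lam)
    (hy : y ∈ centralCantorSet lam) (hxy : x ≠ y) : 0 < gapDist (centralCantorSet lam) x y := by
  wlog hlt : x < y generalizing x y
  · rw [gapDist_comm]
    exact this hy hx hxy.symm (hxy.lt_or_gt.resolve_left hlt)
  obtain ⟨a, ha, b, hb, h2, h3, h4, h5, -⟩ := exists_gap h0 h1 hx hy hlt
  refine (abs_pos.2 (sub_ne_zero.2 h3.ne')).trans_le (le_gapDist ⟨a, ha, b, hb, ?_, ?_, ?_, rfl⟩)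
  · rw [uIcc_of_le hlt.le]
    exact ⟨h2, (h3.trans_le h4).le⟩
  · rw [uIcc_of_le hlt.le]
    exact ⟨(h2.trans_lt h3).le, h4⟩
  · rwa [uIcc_of_le h3.le]

end SmoothMCG

/-! ### The Cantor set with the gap metric, and its local similarities -/

/-- In a compact metric space, every sequence has two terms that are close to each other. -/
theorem exists_lt_dist_lt {X : Type*} [MetricSpace X] [CompactSpace X] (u : ℕ → X) {ε : ℝ}
    (hε : 0 < ε) : ∃ i j, i < j ∧ dist (u i) (u j) < ε := by
  obtain ⟨a, φ, hφ, ha⟩ := CompactSpace.tendsto_subseq u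
  obtain ⟨N, hN⟩ := Metric.tendsto_atTop.1 ha (ε / 2) (half_pos hε)
  refine ⟨φ N, φ (N + 1), hφ (Nat.lt_succ_self N), ?_⟩
  have h1 := hN N le_rfl
  have h2 := hN (N + 1) (by omega)
  calc _ ≤ dist (u (φ N)) a + dist (u (φ (N + 1))) a := dist_triangle_right _ _ _
    _ < ε := by simp only [Function.comp] at h1 h2; linarith

namespace SmoothMCG

/-- The points of the central Cantor set, with the gap metric. -/
@[ext]
structure CantorPoint (lam : ℝ) where
  val : ℝ
  mem : val ∈ centralCantorSet lam

namespace CantorPoint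

variable {lam : ℝ}

noncomputable instance : LinearOrder (CantorPoint lam) := LinearOrder.lift' val fun _ _ ↦ CantorPoint.ext

/-- The points of the Cantor set as a subtype. -/
def equivSubtype (lam : ℝ) : centralCantorSet lam ≃ CantorPoint lam where
  toFun x := ⟨x.1, x.2⟩
  invFun x := ⟨x.val, x.mem⟩
  left_inv _ := rfl
  right_inv _ := rfl

/-- `τ` is strictly differentiable at `x` along the Cantor set, with derivative `s`. -/
def HasStrictSlope (τ : CantorPoint lam → CantorPoint lam) (x : CantorPoint lam) (s : ℝ) : Prop :=
  ∀ ε > 0, ∃ δ > 0, ∀ y z : CantorPoint lam, |y.val - x.val| < δ → |z.val - x.val| < δ →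
    |(τ y).val - (τ z).val - s * (y.val - z.val)| ≤ ε * |y.val - z.val|

variable [Fact (0 < lam)] [Fact (lam < 1 / 2)]

noncomputable instance : MetricSpace (CantorPoint lam) where
  dist x y := gapDist (centralCantorSet lam) x.val y.val
  dist_self x := gapDist_self _ _
  dist_comm x y := gapDist_comm _ _ _
  dist_triangle x y z := (gapDist_le_max y.mem).trans
    (max_le_add_of_nonneg (gapDist_nonneg _ _ _) (gapDist_nonneg _ _ _))
  eq_of_dist_eq_zero {x y} h := by
    by_contra hne
    exact (gapDist_pos (Fact.out : 0 < lam) Fact.out x.mem y.mem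
      fun h' ↦ hne (CantorPoint.ext h')).ne' h

theorem dist_def (x y : CantorPoint lam) :
    dist x y = gapDist (centralCantorSet lam) x.val y.val := rfl

instance : IsUltrametricDist (CantorPoint lam) := ⟨fun _ y _ ↦ gapDist_le_max y.mem⟩

instance : Nonempty (CantorPoint lam) :=
  ⟨⟨0, zero_mem_centralCantorSet (Fact.out : 0 < lam) Fact.out⟩⟩

/-- The inequality between gap distance and Euclidean distance is enough for equality of topologies:
a continuous bijection from a compact space to a Hausdorff one is a homeomorphism. -/
theorem continuous_equivSubtype : Continuous (equivSubtype lam) :=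
  (LipschitzWith.of_dist_le_mul (K := 1) fun x y ↦ by
    rw [dist_def, NNReal.coe_one, one_mul, Subtype.dist_eq, Real.dist_eq, abs_sub_comm]
    exact gapDist_le_abs_sub _ _ _).continuous

instance : CompactSpace (centralCantorSet lam) :=
  isCompact_iff_compactSpace.1 (isCompact_centralCantorSet lam)

/-- The gap metric induces the topology of the line. -/
noncomputable def homeoSubtype (lam : ℝ) [Fact (0 < lam)] [Fact (lam < 1 / 2)] :
    centralCantorSet lam ≃ₜ CantorPoint lam :=
  continuous_equivSubtype.homeoOfEquivCompactToT2

instance : CompactSpace (CantorPoint lam) := (homeoSubtype lam).compactSpace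

theorem isInducing_val : Topology.IsInducing (val : CantorPoint lam → ℝ) :=
  Topology.IsInducing.subtypeVal.comp (homeoSubtype lam).symm.isInducing

theorem mem_nhds_iff {x : CantorPoint lam} {O : Set (CantorPoint lam)} :
    O ∈ 𝓝 x ↔ ∃ δ > 0, ∀ y : CantorPoint lam, |y.val - x.val| < δ → y ∈ O := by
  rw [isInducing_val.nhds_eq_comap, (nhds_basis_ball.comap _).mem_iff]
  simp only [Set.subset_def, mem_preimage, mem_ball, Real.dist_eq]

theorem neBot_nhdsNE (x : CantorPoint lam) : (𝓝[≠] x).NeBot := by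
  rw [← mem_closure_iff_nhdsWithin_neBot, mem_closure_iff_nhds]
  intro O hO
  obtain ⟨δ, hδ, hO⟩ := mem_nhds_iff.1 hO
  obtain ⟨y, hy, hne, hlt⟩ := exists_ne_mem_centralCantorSet (Fact.out : 0 < lam) Fact.out x.mem hδ
  exact ⟨⟨y, hy⟩, hO _ hlt, fun h ↦ hne (congrArg val h)⟩

/-- The integral powers of `lam` are isolated from each other. -/
theorem exists_zpow_unique {s : ℝ} (hs : 0 < s) : ∃ k : ℤ, ∀ j : ℤ,
    |lam ^ j - s| ≤ s * (1 - lam) / 4 → j = k := by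
  have h0 : 0 < lam := Fact.out
  have h1 : lam < 1 / 2 := Fact.out
  by_cases h : ∃ k : ℤ, |lam ^ k - s| ≤ s * (1 - lam) / 4
  · obtain ⟨k, hk⟩ := h
    refine ⟨k, fun j hj ↦ ?_⟩
    have key : ∀ j k : ℤ, |lam ^ j - s| ≤ s * (1 - lam) / 4 → |lam ^ k - s| ≤ s * (1 - lam) / 4 →
        ¬ j < k := by
      intro j k hj hk hlt
      have h2 : lam ^ k ≤ lam ^ (j + 1) := zpow_le_zpow_right_of_le_one₀ h0 (by linarith) hlt
      rw [zpow_add_one₀ h0.ne'] at h2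
      rw [abs_le] at hj hk
      nlinarith [mul_pos hs h0]
    exact le_antisymm (not_lt.1 (key k j hk hj)) (not_lt.1 (key j k hj hk))
  · exact ⟨0, fun j hj ↦ absurd ⟨j, hj⟩ h⟩

/-- A homeomorphism of the Cantor set with a nonzero strict derivative is a local similarity, and it
is locally monotone. -/
theorem exists_similarity_of_hasStrictSlope (τ : CantorPoint lam ≃ₜ CantorPoint lam)
    {x : CantorPoint lam} {s : ℝ} (hs : s ≠ 0) (hτ : HasStrictSlope τ x s) :
    ∃ k : ℤ, ∃ O ∈ 𝓝 x, (∀ y ∈ O, ∀ z ∈ O, dist (τ y) (τ z) = lam ^ k * dist y z) ∧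
      (MonotoneOn τ O ∨ AntitoneOn τ O) := by
  have h0 : 0 < lam := Fact.out
  have h1 : lam < 1 / 2 := Fact.out
  have hs' := abs_pos.2 hs
  obtain ⟨k, hk⟩ := exists_zpow_unique (lam := lam) hs'
  have hε : 0 < |s| * (1 - lam) / 4 := by
    have : 0 < 1 - lam := by linarith
    positivity
  have hεs : |s| * (1 - lam) / 4 < |s| := by nlinarith
  set ε := |s| * (1 - lam) / 4
  obtain ⟨δ₁, hδ₁, hslope⟩ := hτ ε hε
  -- Continuity of the inverse ensures that every point of the Cantor set between two nearby images
  -- comes from the region where the slope estimate holds; without it, gaps might not go to gaps.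
  obtain ⟨η, hη, hηinv⟩ := mem_nhds_iff.1 (τ.symm.continuous.continuousAt (x := τ x)
    (mem_nhds_iff.2 ⟨δ₁, hδ₁, fun y hy ↦ by rw [τ.symm_apply_apply] at hy; exact hy⟩ :
      {y : CantorPoint lam | |y.val - x.val| < δ₁} ∈ 𝓝 (τ.symm (τ x))))
  obtain ⟨δ₂, hδ₂, hδ₂'⟩ := mem_nhds_iff.1 (inter_mem (τ.continuous.continuousAt (x := x)
    (mem_nhds_iff.2 ⟨η, hη, fun y hy ↦ hy⟩ : {y : CantorPoint lam | |y.val - (τ x).val| < η} ∈ _))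
    (mem_nhds_iff.2 ⟨δ₁, hδ₁, fun y hy ↦ hy⟩ : {y : CantorPoint lam | |y.val - x.val| < δ₁} ∈ _))
  classical
  set T : ℝ → ℝ := fun t ↦ if ht : t ∈ centralCantorSet lam then (τ ⟨t, ht⟩).val else t with hT
  have hTv (y : CantorPoint lam) : T y.val = (τ y).val := by simp [hT, y.mem]
  set N : Set ℝ := {t | t ∈ centralCantorSet lam ∧ |t - x.val| < δ₁} with hN
  have hTslope : ∀ a ∈ N, ∀ b ∈ N, |T a - T b - s * (a - b)| ≤ ε * |a - b| := by
    rintro a ⟨ha, ha'⟩ b ⟨hb, hb'⟩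
    have := hslope ⟨a, ha⟩ ⟨b, hb⟩ ha' hb'
    rwa [← hTv, ← hTv] at this
  have hmono : StrictMonoOn T N ∨ StrictAntiOn T N := by
    rcases hs.lt_or_gt with hneg | hpos
    · right
      intro a ha b hb hab
      have := hTslope b hb a ha
      rw [abs_of_neg hneg] at hεs
      rw [abs_of_pos (sub_pos.2 hab), abs_le] at this
      nlinarith
    · left
      intro a ha b hb hab
      have := hTslope b hb a ha
      rw [abs_of_pos hpos] at hεs
      rw [abs_of_pos (sub_pos.2 hab), abs_le] at this
      nlinarith
  have hbetw : ∀ a ∈ N, ∀ b ∈ N, ∀ c ∈ N, (T c ∈ uIcc (T a) (T b) ↔ c ∈ uIcc a b) := by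
    intro a ha b hb c hc
    rcases hmono with h | h
    · simp only [mem_uIcc, h.le_iff_le ha hc, h.le_iff_le hc hb, h.le_iff_le hb hc,
        h.le_iff_le hc ha]
    · simp only [mem_uIcc, h.le_iff_ge ha hc, h.le_iff_ge hc hb, h.le_iff_ge hb hc,
        h.le_iff_ge hc ha]
      tauto
  have hscale : ∀ a ∈ centralCantorSet lam, ∀ b ∈ centralCantorSet lam, a ∈ N → b ∈ N →
      (∀ c ∈ centralCantorSet lam, c ∈ uIcc a b → c = a ∨ c = b) →
      (∀ c ∈ centralCantorSet lam, c ∈ uIcc (T a) (T b) → c = T a ∨ c = T b) →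
      |T b - T a| = lam ^ k * |b - a| := by
    intro a ha b hb haN hbN hgap hgap'
    rcases eq_or_ne a b with rfl | hab
    · simp
    have hTab : T a ≠ T b := by
      rcases hmono with h | h
      · exact h.injOn.ne haN hbN hab
      · exact h.injOn.ne haN hbN hab
    have hTmem : ∀ c ∈ centralCantorSet lam, T c ∈ centralCantorSet lam := by
      intro c hc
      rw [hTv ⟨c, hc⟩]
      exact (τ _).mem
    obtain ⟨n, hn⟩ := exists_abs_sub_eq_of_gap h0 h1 ha hb hab hgap
    obtain ⟨m, hm⟩ := exists_abs_sub_eq_of_gap h0 h1 (hTmem a ha) (hTmem b hb) hTab hgap'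
    have hratio : |T b - T a| = lam ^ ((m : ℤ) - n) * |b - a| := by
      rw [hm, hn, zpow_sub₀ h0.ne', zpow_natCast, zpow_natCast]
      field_simp
    have hpos : 0 < |b - a| := abs_pos.2 (sub_ne_zero.2 hab.symm)
    -- The ratio of the two gap lengths is a power of `lam` within `ε` of `|s|`, and only the
    -- exponent `k` is possible.
    have h3 := (abs_abs_sub_abs_le (T b - T a) (s * (b - a))).trans (hTslope b hbN a haN)
    rw [abs_mul, hratio, ← sub_mul, abs_mul, abs_of_pos hpos] at h3
    rw [hratio, hk _ (le_of_mul_le_mul_right h3 hpos)]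
  have hon : ∀ y : CantorPoint lam, |y.val - x.val| < δ₂ → y.val ∈ N := fun y hy ↦
    ⟨y.mem, (hδ₂' y hy).2⟩
  refine ⟨k, {y | |y.val - x.val| < δ₂}, mem_nhds_iff.2 ⟨δ₂, hδ₂, fun y hy ↦ hy⟩, ?_, ?_⟩
  · intro y hy z hz
    have hconv : ∀ {u v w p d : ℝ}, |u - p| < d → |v - p| < d → w ∈ uIcc u v → |w - p| < d := by
      intro u v w p d hu hv hw
      rw [abs_lt] at *
      rcases mem_uIcc.1 hw with hw | hw <;> constructor <;> linarith
    rw [dist_def, dist_def, ← hTv, ← hTv]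
    refine gapDist_image (N := N) (zpow_pos h0 k).le y.mem z.mem ?_ ?_ hbetw ?_ hscale
    · intro c hc hcyz
      exact hon ⟨c, hc⟩ (hconv hy hz hcyz)
    · intro c hc
      rw [hTv ⟨c, hc⟩]
      exact (τ _).mem
    · intro c hc hcyz
      rw [hTv, hTv] at hcyz
      have h3 : |c - (τ x).val| < η := hconv (hδ₂' y hy).1 (hδ₂' z hz).1 hcyz
      have h4 := hηinv ⟨c, hc⟩ h3
      exact ⟨_, (τ.symm ⟨c, hc⟩).mem, ⟨(τ.symm ⟨c, hc⟩).mem, h4⟩, by rw [hTv]; simp⟩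
  · refine hmono.imp (fun h y hy z hz hyz ↦ ?_) fun h y hy z hz hyz ↦ ?_
    · have := h.monotoneOn (hon y hy) (hon z hz) hyz
      rwa [hTv, hTv] at this
    · have := h.antitoneOn (hon y hy) (hon z hz) hyz
      rwa [hTv, hTv] at this

theorem dist_le_dist_of_le {x y z w : CantorPoint lam} (h : uIcc x.val y.val ⊆ uIcc z.val w.val) :
    dist x y ≤ dist z w := gapDist_mono x.mem h

/-- A monotone isometry of a ball into itself is the identity. -/
theorem eq_of_monotoneOn {u : CantorPoint lam → CantorPoint lam} {B : Set (CantorPoint lam)}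
    (hmono : MonotoneOn u B) (hmaps : MapsTo u B B)
    (hisom : ∀ y ∈ B, ∀ z ∈ B, dist (u y) (u z) = dist y z) {y : CantorPoint lam} (hy : y ∈ B) :
    u y = y := by
  by_contra hne
  have hmem (i : ℕ) : u^[i] y ∈ B := hmaps.iterate i hy
  have hstep (i : ℕ) : dist (u^[i] y) (u^[i + 1] y) = dist y (u y) := by
    induction i with
    | zero => rfl
    | succ i ih =>
      rw [Function.iterate_succ_apply', Function.iterate_succ_apply' u (i + 1),
        hisom _ (hmem i) _ (hmem _), ih]
  -- The orbit is monotone with steps of constant gap length. Two distant terms are at least one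
  -- step apart, which is incompatible with compactness.
  obtain ⟨i, j, hij, hlt⟩ := exists_lt_dist_lt (fun i ↦ u^[i] y) (dist_pos.2 (Ne.symm hne))
  rw [← hstep i] at hlt
  refine hlt.not_ge (dist_le_dist_of_le ?_)
  rcases lt_or_gt_of_ne hne with hlt | hlt
  · have hanti : Antitone fun i ↦ u^[i] y := by
      refine antitone_nat_of_succ_le fun i ↦ ?_
      induction i with
      | zero => exact hlt.le
      | succ i ih =>
        simpa only [Function.iterate_succ_apply'] using hmono (hmem _) (hmem i) ih
    have h1 : (u^[i + 1] y).val ≤ (u^[i] y).val := hanti (Nat.le_succ i)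
    have h2 : (u^[j] y).val ≤ (u^[i + 1] y).val := hanti hij
    rw [uIcc_of_ge h1, uIcc_of_ge (h2.trans h1)]
    exact Icc_subset_Icc_left h2
  · have hmono' : Monotone fun i ↦ u^[i] y := by
      refine monotone_nat_of_le_succ fun i ↦ ?_
      induction i with
      | zero => exact hlt.le
      | succ i ih =>
        rw [Function.iterate_succ_apply', Function.iterate_succ_apply' u (i + 1)]
        exact hmono (hmem i) (hmem _) ih
    have h1 : (u^[i] y).val ≤ (u^[i + 1] y).val := hmono' (Nat.le_succ i)
    have h2 : (u^[i + 1] y).val ≤ (u^[j] y).val := hmono' hij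
    rw [uIcc_of_le h1, uIcc_of_le (h1.trans h2)]
    exact Icc_subset_Icc_right h2

/-- Below a Lebesgue number every iterate is monotone or antitone on the small ball about `x`,
because isometric iterates keep its size. By compactness some iterate brings this ball back to
itself; its square is monotone, hence the identity there. -/
theorem exists_pow_smul_eq_of_isometric {G : Type*} [Group G] [MulAction G (CantorPoint lam)] {g : G}
    (hmono : ∀ x : CantorPoint lam, ∃ O ∈ 𝓝 x, MonotoneOn (g • ·) O ∨ AntitoneOn (g • ·) O)
    {x : CantorPoint lam} {r : ℝ} (hr : 0 < r)
    (hisom : ∀ y ∈ closedBall x r, ∀ z ∈ closedBall x r, dist (g • y) (g • z) = dist y z)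
    (hmaps : ∀ y ∈ closedBall x r, g • y ∈ closedBall x r) :
    ∃ N, 0 < N ∧ ∀ᶠ y in 𝓝 x, g ^ N • y = y := by
  choose O hO hOmono using hmono
  obtain ⟨δ, hδ, hball⟩ := lebesgue_number_lemma_of_metric isCompact_univ
    (fun x ↦ isOpen_interior (s := O x))
    fun x _ ↦ mem_iUnion.2 ⟨x, mem_interior_iff_mem_nhds.2 (hO x)⟩
  set r' := min r (δ / 2)
  have hr' : 0 < r' := lt_min hr (half_pos hδ)
  have hr'r : r' ≤ r := min_le_left _ _
  have hr'δ : r' < δ := (min_le_right _ _).trans_lt (half_lt_self hδ)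
  have hmaps' (n : ℕ) : ∀ y ∈ closedBall x r, g ^ n • y ∈ closedBall x r := by
    induction n with
    | zero => simp
    | succ n ih => exact fun y hy ↦ by rw [pow_succ', mul_smul]; exact hmaps _ (ih y hy)
  have hisom' (n : ℕ) : ∀ y ∈ closedBall x r, ∀ z ∈ closedBall x r,
      dist (g ^ n • y) (g ^ n • z) = dist y z := by
    induction n with
    | zero => simp
    | succ n ih =>
      intro y hy z hz
      rw [pow_succ', mul_smul, mul_smul, hisom _ (hmaps' n y hy) _ (hmaps' n z hz), ih y hy z hz]
  have hxr : x ∈ closedBall x r := mem_closedBall_self hr.le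
  have hsub : closedBall x r' ⊆ closedBall x r := closedBall_subset_closedBall hr'r
  have hmonoball (y : CantorPoint lam) : MonotoneOn (g • ·) (closedBall y r') ∨
      AntitoneOn (g • ·) (closedBall y r') := by
    obtain ⟨i, hi⟩ := hball y (mem_univ y)
    have h1 : closedBall y r' ⊆ O i :=
      (closedBall_subset_ball hr'δ).trans (hi.trans interior_subset)
    exact (hOmono i).imp (fun h ↦ h.mono h1) fun h ↦ h.mono h1
  have hmapsn (n : ℕ) : MapsTo (g ^ n • ·) (closedBall x r') (closedBall (g ^ n • x) r') := by
    intro y hy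
    have := hisom' n y (hsub hy) x hxr
    rw [mem_closedBall] at hy ⊢
    rwa [this]
  have hmonon (n : ℕ) : MonotoneOn (g ^ n • ·) (closedBall x r') ∨
      AntitoneOn (g ^ n • ·) (closedBall x r') := by
    induction n with
    | zero => left; intro y _ z _ hyz; simpa using hyz
    | succ n ih =>
      have heq : (g ^ (n + 1) • · : CantorPoint lam → CantorPoint lam) =
          (g • ·) ∘ (g ^ n • ·) := by
        ext1 y
        simp [pow_succ', mul_smul]
      rw [heq]
      rcases hmonoball (g ^ n • x) with h1 | h1 <;> rcases ih with h2 | h2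
      · exact .inl (h1.comp h2 (hmapsn n))
      · exact .inr (h1.comp_AntitoneOn h2 (hmapsn n))
      · exact .inr (h1.comp_MonotoneOn h2 (hmapsn n))
      · exact .inl (h1.comp h2 (hmapsn n))
  obtain ⟨i, j, hij, hlt⟩ := exists_lt_dist_lt (fun i ↦ g ^ i • x) hr'
  obtain ⟨m, rfl⟩ := Nat.exists_eq_add_of_lt hij
  set N := m + 1 with hNdef
  have hNx : g ^ N • x ∈ closedBall x r' := by
    rw [show i + m + 1 = i + N by omega] at hlt
    rw [pow_add, mul_smul, hisom' i x hxr _ (hmaps' N x hxr), dist_comm] at hlt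
    exact hlt.le
  have hmapsN : MapsTo (g ^ N • ·) (closedBall x r') (closedBall x r') := by
    have := hmapsn N
    rwa [← IsUltrametricDist.closedBall_eq_of_mem hNx] at this
  have hmonoNN : MonotoneOn ((g ^ N • ·) ∘ (g ^ N • ·)) (closedBall x r') := by
    rcases hmonon N with h | h
    · exact h.comp h hmapsN
    · exact h.comp h hmapsN
  refine ⟨N + N, by omega, ?_⟩
  filter_upwards [closedBall_mem_nhds x hr'] with y hy
  have := eq_of_monotoneOn hmonoNN (hmapsN.comp hmapsN) (fun y hy z hz ↦ by
    simp only [Function.comp]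
    rw [hisom' N _ (hsub (hmapsN hy)) _ (hsub (hmapsN hz)), hisom' N _ (hsub hy) _ (hsub hz)]) hy
  rwa [pow_add, mul_smul]

theorem isLocalSimilarityAction {G : Type*} [Group G] [MulAction G (CantorPoint lam)]
    [ContinuousConstSMul G (CantorPoint lam)]
    (hslope : ∀ (g : G) (x : CantorPoint lam), ∃ s : ℝ, s ≠ 0 ∧ HasStrictSlope (g • ·) x s) :
    IsLocalSimilarityAction lam G (CantorPoint lam) where
  pos := Fact.out
  lt_one := (Fact.out : lam < 1 / 2).trans (by norm_num)
  sim g x := by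
    obtain ⟨s, hs, hτ⟩ := hslope g x
    obtain ⟨k, O, hO, hk, -⟩ := exists_similarity_of_hasStrictSlope (Homeomorph.smul g) hs hτ
    exact ⟨k, O, hO, hk⟩
  isometric_return g x r hr hisom hmaps := by
    refine exists_pow_smul_eq_of_isometric (fun y ↦ ?_) hr hisom hmaps
    obtain ⟨s, hs, hτ⟩ := hslope g y
    obtain ⟨k, O, hO, -, hmono⟩ := exists_similarity_of_hasStrictSlope (Homeomorph.smul g) hs hτ
    exact ⟨O, hO, hmono⟩
  perfect := neBot_nhdsNE

end CantorPoint

end SmoothMCG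

/-! ### Derivatives along the Cantor set -/

/-- `w` is a strict derivative of `p` at `t` along `[0, 1]`. -/
def HasStrictVelocity {E : Type*} [NormedAddCommGroup E] [NormedSpace ℝ E] (p : ℝ → E) (t : ℝ)
    (w : E) : Prop :=
  ∀ ε > 0, ∃ δ > 0, ∀ y ∈ Icc (0 : ℝ) 1, ∀ z ∈ Icc (0 : ℝ) 1, |y - t| < δ → |z - t| < δ →
    ‖p y - p z - (y - z) • w‖ ≤ ε * |y - z|

theorem ContDiffWithinAt.hasStrictVelocity {E : Type*} [NormedAddCommGroup E] [NormedSpace ℝ E]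
    {p : ℝ → E} {t : ℝ} (hp : ContDiffWithinAt ℝ 1 p (Icc 0 1) t) (ht : t ∈ Icc (0 : ℝ) 1) :
    HasStrictVelocity p t (fderivWithin ℝ p (Icc 0 1) t 1) := by
  intro ε hε
  obtain ⟨u, hu, -, -, p', hp', hcont⟩ :=
    (contDiffWithinAt_succ_iff_hasFDerivWithinAt' (n := 0) (by simp)).1 (by simpa using hp)
  rw [insert_eq_of_mem ht] at hu
  have htu : t ∈ u := mem_of_mem_nhdsWithin ht hu
  have heq : fderivWithin ℝ p (Icc 0 1) t = p' t :=
    (hp' t htu).fderivWithin (uniqueDiffOn_Icc zero_lt_one t ht)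
  have hclose : ∀ᶠ y in 𝓝[Icc 0 1] t, ‖p' y - p' t‖ ≤ ε := by
    filter_upwards [hcont.continuousWithinAt (closedBall_mem_nhds _ hε)] with y hy
    rwa [mem_preimage, mem_closedBall, dist_eq_norm] at hy
  obtain ⟨δ, hδ, hball⟩ := Metric.mem_nhdsWithin_iff.1 (inter_mem hu hclose)
  refine ⟨δ, hδ, fun y hy z hz hyt hzt ↦ ?_⟩
  have hconv : Convex ℝ (ball t δ ∩ Icc 0 1) := (convex_ball t δ).inter (convex_Icc 0 1)
  have := hconv.norm_image_sub_le_of_norm_hasFDerivWithin_le' (f := p) (f' := p') (φ := p' t)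
    (fun x hx ↦ (hp' x (hball hx).1).mono inter_subset_right) (fun x hx ↦ (hball hx).2)
    (x := z) (y := y) ⟨hzt, hz⟩ ⟨hyt, hy⟩
  rw [heq, ← map_smul, smul_eq_mul, mul_one]
  exact this

namespace SmoothMCG

/-- Comparing the strict expansions of `p` and of `q ∘ τ` shows that increments of `τ` times `z₀`
agree to first order with increments of the parameter times `w`. Hence `w` is a multiple of `z₀`,
and the factor is the slope. -/
theorem CantorPoint.exists_hasStrictSlope {E : Type*} [NormedAddCommGroup E] [NormedSpace ℝ E]
    {lam : ℝ} [Fact (0 < lam)] [Fact (lam < 1 / 2)] {τ : CantorPoint lam → CantorPoint lam}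
    (hτ : Continuous τ) {x : CantorPoint lam} {p q : ℝ → E} {w z₀ : E}
    (hp : HasStrictVelocity p x.val w) (hq : HasStrictVelocity q (τ x).val z₀)
    (hw : w ≠ 0) (hz₀ : z₀ ≠ 0) (hpq : ∀ y : CantorPoint lam, p y.val = q (τ y).val) :
    ∃ s : ℝ, s ≠ 0 ∧ HasStrictSlope τ x s := by
  have hz : 0 < ‖z₀‖ := norm_pos_iff.2 hz₀
  have hmem (y : CantorPoint lam) : y.val ∈ Icc (0 : ℝ) 1 := centralCantorSet_subset lam y.mem
  have key : ∀ ε > 0, ∃ δ > 0, ∀ y z : CantorPoint lam, |y.val - x.val| < δ →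
      |z.val - x.val| < δ →
      ‖((τ y).val - (τ z).val) • z₀ - (y.val - z.val) • w‖ ≤ ε * |y.val - z.val| := by
    intro ε hε
    -- A Lipschitz constant for `τ` near `x`: with error at most `‖z₀‖ / 2`, the term in `|b|` on
    -- the right is absorbed by the left side of `h7`.
    set K : ℝ := 2 * (‖w‖ + ‖z₀‖ / 2) / ‖z₀‖
    have hK : 0 < 1 + K := by positivity
    set ε₁ : ℝ := min (‖z₀‖ / 2) (ε / (1 + K))
    have hε₁ : 0 < ε₁ := lt_min (by positivity) (by positivity)
    obtain ⟨δ₁, hδ₁, h1⟩ := hp ε₁ hε₁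
    obtain ⟨δ₂, hδ₂, h2⟩ := hq ε₁ hε₁
    obtain ⟨δ₃, hδ₃, h3⟩ := mem_nhds_iff.1 (hτ.continuousAt (x := x)
      (mem_nhds_iff.2 ⟨δ₂, hδ₂, fun y hy ↦ hy⟩ :
        {y : CantorPoint lam | |y.val - (τ x).val| < δ₂} ∈ 𝓝 (τ x)))
    refine ⟨min δ₁ δ₃, lt_min hδ₁ hδ₃, fun y z hy hz' ↦ ?_⟩
    have h4 := h1 y.val (hmem y) z.val (hmem z) (hy.trans_le (min_le_left _ _))
      (hz'.trans_le (min_le_left _ _))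
    have h5 := h2 (τ y).val (hmem _) (τ z).val (hmem _) (h3 y (hy.trans_le (min_le_right _ _)))
      (h3 z (hz'.trans_le (min_le_right _ _)))
    rw [hpq, hpq] at h4
    set a := y.val - z.val
    set b := (τ y).val - (τ z).val
    have h6 : ‖b • z₀ - a • w‖ ≤ ε₁ * (|a| + |b|) := by
      have := norm_sub_le (q (τ y).val - q (τ z).val - a • w) (q (τ y).val - q (τ z).val - b • z₀)
      rw [sub_sub_sub_cancel_left] at this
      linarith
    have h7 : |b| * ‖z₀‖ ≤ |a| * ‖w‖ + ‖z₀‖ / 2 * (|a| + |b|) := by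
      have h8 := norm_sub_norm_le (b • z₀) (a • w)
      rw [norm_smul, norm_smul, Real.norm_eq_abs, Real.norm_eq_abs] at h8
      have h9 : ε₁ * (|a| + |b|) ≤ ‖z₀‖ / 2 * (|a| + |b|) := by
        gcongr
        exact min_le_left _ _
      linarith
    have h10 : |b| ≤ K * |a| := by
      rw [div_mul_eq_mul_div, le_div_iff₀ hz]
      linarith
    calc _ ≤ ε₁ * (|a| + |b|) := h6
      _ ≤ ε / (1 + K) * (|a| + K * |a|) := by
        gcongr
        exact min_le_right _ _
      _ = ε * |a| := by field_simp
  -- Difference quotients of `τ` times `z₀` approximate `w`, and a line is closed. Nearby points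
  -- exist because the Cantor set is perfect.
  have hspan : w ∈ Submodule.span ℝ {z₀} := by
    rw [← SetLike.mem_coe,
      ← (Submodule.closed_of_finiteDimensional (Submodule.span ℝ {z₀})).closure_eq]
    refine Metric.mem_closure_iff.2 fun ε hε ↦ ?_
    obtain ⟨δ, hδ, h1⟩ := key (ε / 2) (half_pos hε)
    obtain ⟨y, hy, hne, hlt⟩ :=
      exists_ne_mem_centralCantorSet (Fact.out : 0 < lam) Fact.out x.mem hδ
    have h2 := h1 ⟨y, hy⟩ x hlt (by simpa using hδ)
    have h3 : y - x.val ≠ 0 := sub_ne_zero.2 hne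
    refine ⟨(((τ ⟨y, hy⟩).val - (τ x).val) / (y - x.val)) • z₀,
      Submodule.smul_mem _ _ (Submodule.mem_span_singleton_self z₀), ?_⟩
    have h4 : ((τ ⟨y, hy⟩).val - (τ x).val) • z₀ - (y - x.val) • w =
        (y - x.val) • ((((τ ⟨y, hy⟩).val - (τ x).val) / (y - x.val)) • z₀ - w) := by
      rw [smul_sub, smul_smul, mul_div_cancel₀ _ h3]
    rw [h4, norm_smul, Real.norm_eq_abs, mul_comm] at h2
    rw [dist_comm, dist_eq_norm]
    exact (le_of_mul_le_mul_right h2 (abs_pos.2 h3)).trans_lt (half_lt_self hε)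
  obtain ⟨s, rfl⟩ := Submodule.mem_span_singleton.1 hspan
  refine ⟨s, fun hs ↦ hw (by rw [hs, zero_smul]), fun ε hε ↦ ?_⟩
  obtain ⟨δ, hδ, h1⟩ := key (ε * ‖z₀‖) (by positivity)
  refine ⟨δ, hδ, fun y z hy hz' ↦ ?_⟩
  have h2 := h1 y z hy hz'
  rw [smul_smul, ← sub_smul, norm_smul, Real.norm_eq_abs, mul_right_comm, mul_comm _ s] at h2
  exact le_of_mul_le_mul_right h2 hz

variable {H : Type*} [TopologicalSpace H] {I : ModelWithCorners ℝ Plane H}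
  {S : Type*} [TopologicalSpace S] [ChartedSpace H S]

/-- A smooth curve with nonzero velocity has a nonzero strict velocity in a chart. -/
theorem exists_hasStrictVelocity {σ : ℝ → S} {t : ℝ} (ht : t ∈ Icc (0 : ℝ) 1)
    (hσ : ContMDiffWithinAt 𝓘(ℝ, ℝ) I ∞ σ (Icc 0 1) t)
    (hv : mfderivWithin 𝓘(ℝ, ℝ) I σ (Icc 0 1) t ≠ 0) :
    ∃ w : Plane, w ≠ 0 ∧ HasStrictVelocity (extChartAt I (σ t) ∘ σ) t w := by
  have h1 : ContDiffWithinAt ℝ 1 (extChartAt I (σ t) ∘ σ) (Icc 0 1) t := by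
    have := (contMDiffWithinAt_iff.1 hσ).2
    simp only [mfld_simps] at this
    exact this.of_le (by simp)
  refine ⟨_, fun h0 ↦ hv ?_, h1.hasStrictVelocity ht⟩
  have h2 := (hσ.mdifferentiableWithinAt (by simp)).mfderivWithin
  simp only [mfld_simps, writtenInExtChartAt] at h2
  rw [h2]
  exact ContinuousLinearMap.ext_ring h0

/-- The curves `f ∘ l.toFun` at `x` and `l.toFun` at `τ x` pass through the same point and are read
in the same chart. They need to agree, through `τ`, only along the Cantor set. -/
theorem EmbeddedSegment.exists_hasStrictSlope [IsManifold I ∞ S] (l : EmbeddedSegment I S)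
    (f : S ≃ₘ⟮I, I⟯ S) {lam : ℝ} [Fact (0 < lam)] [Fact (lam < 1 / 2)]
    {τ : CantorPoint lam → CantorPoint lam} (hτ : Continuous τ)
    (hf : ∀ y : CantorPoint lam, f (l.toFun y.val) = l.toFun (τ y).val) (x : CantorPoint lam) :
    ∃ s : ℝ, s ≠ 0 ∧ CantorPoint.HasStrictSlope τ x s := by
  have hmem (y : CantorPoint lam) : y.val ∈ Icc (0 : ℝ) 1 := centralCantorSet_subset lam y.mem
  obtain ⟨z₀, hz₀, hq⟩ := exists_hasStrictVelocity (hmem (τ x)) (l.smooth _ (hmem (τ x)))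
    (l.velocity_ne_zero _ (hmem (τ x)))
  have hsm := l.smooth _ (hmem x)
  obtain ⟨w, hw, hp⟩ := exists_hasStrictVelocity (σ := f ∘ l.toFun) (hmem x)
    (f.contMDiff.contMDiffAt.comp_contMDiffWithinAt x.val hsm) (by
      rw [mfderiv_comp_mfderivWithin x.val (f.mdifferentiable (by simp) _)
        (hsm.mdifferentiableWithinAt (by simp))
        ((uniqueDiffOn_Icc zero_lt_one x.val (hmem x)).uniqueMDiffWithinAt)]
      intro h0
      refine l.velocity_ne_zero _ (hmem x) (ContinuousLinearMap.ext fun v ↦ ?_)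
      have h1 := congrArg (fun L ↦ L v) h0
      exact (differential f (l.toFun x.val)).map_eq_zero_iff.1 h1)
  refine CantorPoint.exists_hasStrictSlope hτ hp hq hw hz₀ fun y ↦ ?_
  simp only [Function.comp, hf]

variable [T2Space S]

/-- The Cantor set in an embedded segment is homeomorphic to the standard one. -/
noncomputable def EmbeddedSegment.homeoCantorSet (l : EmbeddedSegment I S) (lam : ℝ)
    [Fact (0 < lam)] [Fact (lam < 1 / 2)] : CantorPoint lam ≃ₜ l.cantorSet lam :=
  (CantorPoint.homeoSubtype lam).symm.trans
    (Continuous.homeoOfEquivCompactToT2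
      (f := Equiv.Set.imageOfInjOn l.toFun _ (l.injOn.mono (centralCantorSet_subset lam)))
      ((l.smooth.continuousOn.mono (centralCantorSet_subset lam)).domRestrict.subtype_mk _))

theorem EmbeddedSegment.coe_homeoCantorSet (l : EmbeddedSegment I S) {lam : ℝ}
    [Fact (0 < lam)] [Fact (lam < 1 / 2)] (x : CantorPoint lam) :
    (l.homeoCantorSet lam x : S) = l.toFun x.val := rfl

end SmoothMCG

/-! ### Transfer to the surface -/

namespace SmoothMCG

variable {H : Type*} [TopologicalSpace H] {I : ModelWithCorners ℝ Plane H}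
  {S : Type*} [TopologicalSpace S] [ChartedSpace H S] [IsManifold I ∞ S] [T2Space S]

/-- A group acting on the Cantor set of an embedded segment acts on the standard Cantor set. -/
@[reducible]
noncomputable def EmbeddedSegment.mulAction (l : EmbeddedSegment I S) {lam : ℝ}
    [Fact (0 < lam)] [Fact (lam < 1 / 2)] {G : Type*} [Group G]
    (ρ : G →* (l.cantorSet lam ≃ₜ l.cantorSet lam)) : MulAction G (CantorPoint lam) where
  smul g x := (l.homeoCantorSet lam).symm (ρ g (l.homeoCantorSet lam x))
  one_smul x := by
    change (l.homeoCantorSet lam).symm (ρ 1 (l.homeoCantorSet lam x)) = x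
    rw [map_one]
    exact (l.homeoCantorSet lam).symm_apply_apply x
  mul_smul g h x := by
    change (l.homeoCantorSet lam).symm (ρ (g * h) (l.homeoCantorSet lam x)) =
      (l.homeoCantorSet lam).symm (ρ g (l.homeoCantorSet lam
        ((l.homeoCantorSet lam).symm (ρ h (l.homeoCantorSet lam x)))))
    rw [map_mul, Homeomorph.apply_symm_apply]
    rfl

/-- The Tits alternative for a group acting on the Cantor set of an embedded segment by restrictions
of diffeomorphisms of the surface. -/
theorem EmbeddedSegment.exists_freeGroup_or_exists_measure [MeasurableSpace S] [BorelSpace S]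
    (l : EmbeddedSegment I S) {lam : ℝ} (h0 : 0 < lam) (h1 : lam < 1 / 2) {G : Type*} [Group G]
    (ρ : G →* (l.cantorSet lam ≃ₜ l.cantorSet lam))
    (hρ : ∀ g, ∃ f : S ≃ₘ⟮I, I⟯ S, ∀ x : l.cantorSet lam, f x = (ρ g x : S)) :
    (∃ φ : FreeGroup (Fin 2) →* G, Function.Injective φ) ∨
      ∃ μ : Measure (l.cantorSet lam), IsProbabilityMeasure μ ∧ ∀ g, μ.map (ρ g) = μ := by
  have : Fact (0 < lam) := ⟨h0⟩
  have : Fact (lam < 1 / 2) := ⟨h1⟩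
  let e := l.homeoCantorSet lam
  let := l.mulAction ρ
  have hsmul (g : G) (x : CantorPoint lam) : e (g • x) = ρ g (e x) := e.apply_symm_apply _
  have : ContinuousConstSMul G (CantorPoint lam) :=
    ⟨fun g ↦ e.symm.continuous.comp ((ρ g).continuous.comp e.continuous)⟩
  let : MeasurableSpace (CantorPoint lam) := borel _
  have : BorelSpace (CantorPoint lam) := ⟨rfl⟩
  have h : IsLocalSimilarityAction lam G (CantorPoint lam) := by
    refine CantorPoint.isLocalSimilarityAction fun g x ↦ ?_
    obtain ⟨f, hf⟩ := hρ g
    refine l.exists_hasStrictSlope f (continuous_const_smul g) (fun y ↦ ?_) x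
    rw [← l.coe_homeoCantorSet, ← l.coe_homeoCantorSet]
    exact (hf _).trans (congrArg Subtype.val (hsmul g y).symm)
  refine h.exists_freeGroup_or_exists_measure.imp_right ?_
  rintro ⟨μ, hμ⟩
  refine ⟨(μ : Measure (CantorPoint lam)).map e,
    Measure.isProbabilityMeasure_map e.measurable.aemeasurable, fun g ↦ ?_⟩
  rw [Measure.map_map (ρ g).measurable e.measurable]
  nth_rewrite 2 [← hμ g]
  rw [Measure.map_map e.measurable (measurable_const_smul g)]
  exact congrArg (fun u ↦ Measure.map u (μ : Measure (CantorPoint lam)))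
    (funext fun x ↦ (hsmul g x).symm)

end SmoothMCG

end

theorem mainTheorem4 {H : Type*} [TopologicalSpace H]
    (I : ModelWithCorners ℝ (EuclideanSpace ℝ (Fin 2)) H)
    {S : Type*} [TopologicalSpace S] [ChartedSpace H S] [IsManifold I ∞ S]
    [T2Space S] [SecondCountableTopology S] [ConnectedSpace S]
    [MeasurableSpace S] [BorelSpace S]
    (o : SmoothMCG.SurfaceOrientation I S)
    (lam : ℝ) (hlam_pos : 0 < lam) (hlam_lt : lam < 1 / 2)
    (l : SmoothMCG.EmbeddedSegment I S)
    (Γ : Subgroup (SmoothMCG.MCG o (l.cantorSet lam))) :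
    (∃ φ : FreeGroup (Fin 2) →* Γ, Function.Injective φ) ∨
    (∃ μ : MeasureTheory.Measure (l.cantorSet lam), MeasureTheory.IsProbabilityMeasure μ ∧
      ∀ g ∈ Γ, μ.map (SmoothMCG.MCG.action o
        (l.isTotallyDisconnected_cantorSet hlam_pos hlam_lt) g) = μ) := by
  refine (l.exists_freeGroup_or_exists_measure hlam_pos hlam_lt
    ((SmoothMCG.MCG.action o (l.isTotallyDisconnected_cantorSet hlam_pos hlam_lt)).comp Γ.subtype)
    ?_).imp_right ?_
  · rintro ⟨g, -⟩
    obtain ⟨f, rfl⟩ := QuotientGroup.mk_surjective g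
    exact ⟨f.1, fun _ ↦ rfl⟩
  · rintro ⟨μ, hμ, hinv⟩
    exact ⟨μ, hμ, fun g hg ↦ hinv ⟨g, hg⟩⟩
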